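/- Let $n\ge 1$, $\kappa\in\mathbb{R}$, let $\rho_0\colon(0,\infty)\to\mathbb{R}$ satisfy $\rho_0\ge 0$ a.e. and $\rho_0(|\mathbf{x}|)\in L^1(\mathbb{R}^n)$, let $u_0\in C^1([0,\infty))$, and assume that the initial momentum is integrable, $\rho_0(|\mathbf{x}|)u_0(|\mathbf{x}|)\in L^1(\mathbb{R}^n)$. For $r,t\ge 0$ put $$E_0(r)=\int_0^r s^{n-1}\rho_0(s)\,ds,\qquad Q_{r,t}(s)=s+tu_0(s)+\tfrac12\kappa E_0(s)t^2-r,$$ $$F_{r,t}(y)=\int_0^y Q_{r,t}(s)\,s^{n-1}\rho_0(s)\,ds\quad(0\le y<\infty),\qquad F_{r,t}(\infty)=\lim_{y\to\infty}F_{r,t}(y)\in(-\infty,\infty],$$ and let $y(r,t)\in[0,\infty]$ be the supremum of the set of minimizers of $F_{r,t}$ over $[0,\infty]$. Then $y(r,t)$ is itself a minimizer. Let $$\mathcal{M}(r,t)=\int_0^{y(r,t)}\rho_0(s)s^{n-1}ds,\qquad \mathcal{P}(r,t)=\int_0^{y(r,t)}\rho_0(s)\big(u_0(s)+\kappa E_0(s)t\big)s^{n-1}ds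 .$$ Then the weighted pressureless Euler–Poisson system on $[0,\infty)\times\mathbb{R}^n$ $$\rho_t+\nabla\cdot(\rho\mathbf{u})=0,\qquad (\rho\mathbf{u})_t+\nabla\cdot(\rho\mathbf{u}\otimes\mathbf{u})=\kappa\rho|\mathbf{x}|^{n-1}\nabla V,\qquad \Delta V=\rho,$$ with initial density $\rho_0(|\mathbf{x}|)$ and initial momentum $\rho_0(|\mathbf{x}|)u_0(|\mathbf{x}|)\frac{\mathbf{x}}{|\mathbf{x}|}$, has a global weak radial solution of the form $$\rho(\mathbf{x},t)=\frac1{r^{n-1}}\frac{\partial\mathcal{M}(r,t)}{\partial r},\qquad \rho\mathbf{u}(\mathbf{x},t)=\frac{\mathbf{x}}{r}\frac1{r^{n-1}}\frac{\partial\mathcal{P}(r,t)}{\partial r},\qquad r=|\mathbf{x}|.$$ Here, for each $t\ge0$, $\mu_t=\partial_r\mathcal{M}(\cdot,t)$ is the measure on $[0,\infty)$ with $\mu_t([0,r])=\mathcal{M}(r,t)$ for all $r\ge 0$ (so $\mathcal{M}(0,t)$ is its atom at $r=0$), and $\rho(\cdot,t)$ is the measure $\int\varphi\,d\rho(\cdot,t)=\int_{[0,\infty)}\int_{S^{n-1}}\varphi(r\omega)\,d\omega\,d\mu_t(r)$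 on $\mathbb{R}^n$. On $(0,\infty)$ one has $\partial_r\mathcal{P}(\cdot,t)=w(\cdot,t)\,\mu_t$ with $w(\cdot,t)$ integrable with respect to $\mu_t$, and $\mathbf{u}(\mathbf{x},t)=w(r,t)\mathbf{x}/r$, with $\mathbf{u}(0,t)=0$. The field is $\nabla V=r^{1-n}E(r,t)\frac{\mathbf{x}}{r}$ (and $0$ at the origin) with $E(r,t)=\frac12\big(\mu_t([0,r))+\mu_t([0,r])\big)$; it is the weak gradient of $V(\cdot,t)$, and $\Delta V=\rho$ holds in the sense of distributions, for every $t\ge0$. Weak solution means that $\rho$, $\rho|\mathbf{u}|^2$ and $\rho|\mathbf{x}|^{n-1}|\nabla V|$ have finite mass on bounded subsets of $[0,\infty)\times\mathbb{R}^n$ and that, for all $\varphi\in C_c^\infty([0,\infty)\times\mathbb{R}^n)$ and $\Phi\in C_c^\infty([0,\infty)\times\mathbb{R}^n;\mathbb{R}^n)$, $$\int_0^\infty\!\!\int(\varphi_t+\mathbf{u}\cdot\nabla\varphi)\,d\rho\,dt+\int\varphi(\mathbf{x},0)\rho_0(|\mathbf{x}|)\,d\mathbf{x}=0,$$ $$\int_0^\infty\!\!\int\big(\mathbf{u}\cdot\Phi_t+(\mathbf{u}\otimes\mathbf{u}):\nabla\Phi+\kappa|\mathbf{x}|^{n-1}\nabla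 V\cdot\Phi\big)\,d\rho\,dt+\int\rho_0(|\mathbf{x}|)u_0(|\mathbf{x}|)\frac{\mathbf{x}}{|\mathbf{x}|}\cdot\Phi(\mathbf{x},0)\,d\mathbf{x}=0 .$$ -/

import Mathlib

open MeasureTheory Set Filter
open scoped ENNReal ContDiff RealInnerProductSpace

noncomputable section

namespace EulerPoisson

/-- Euclidean space `ℝⁿ`. -/
abbrev Space (n : ℕ) : Type := EuclideanSpace ℝ (Fin n)

/-! ### The weighted variational formula -/

/-- The initial electric field `E₀(r) = ∫₀ʳ s^(n-1) ρ₀(s) ds`, for `r ≥ 0`. -/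
def initialField (n : ℕ) (ρ₀ : ℝ → ℝ) (r : ℝ) : ℝ :=
  ∫ s in (0 : ℝ)..r, s ^ (n - 1) * ρ₀ s

/-- `Q_{r,t}(s) = s + t u₀(s) + ½ κ E₀(s) t² - r`. -/
def quadForm (n : ℕ) (κ : ℝ) (ρ₀ u₀ : ℝ → ℝ) (r t s : ℝ) : ℝ :=
  s + t * u₀ s + 1 / 2 * κ * initialField n ρ₀ s * t ^ 2 - r

/-- The functional `y ↦ ∫₀ʸ Q_{r,t}(s) s^(n-1) ρ₀(s) ds`, for finite `y ≥ 0`. -/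
def action (n : ℕ) (κ : ℝ) (ρ₀ u₀ : ℝ → ℝ) (r t y : ℝ) : ℝ :=
  ∫ s in (0 : ℝ)..y, quadForm n κ ρ₀ u₀ r t s * s ^ (n - 1) * ρ₀ s

/-- The functional on the closed half-line `[0, ∞]`; its value at `∞` is its limit there. (The
infimum may be approached at `y = ∞` only, for instance when all the mass has moved into the ball
of radius `r`.) -/
def extAction (n : ℕ) (κ : ℝ) (ρ₀ u₀ : ℝ → ℝ) (r t : ℝ) (y : ℝ≥0∞) : EReal :=
  if y = ⊤ then liminf (fun z : ℝ => (action n κ ρ₀ u₀ r t z : EReal)) atTop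
  else (action n κ ρ₀ u₀ r t y.toReal : EReal)

/-- The set of minimizers in `[0, ∞]`. -/
def minimizers (n : ℕ) (κ : ℝ) (ρ₀ u₀ : ℝ → ℝ) (r t : ℝ) : Set ℝ≥0∞ :=
  {y | ∀ z : ℝ≥0∞, extAction n κ ρ₀ u₀ r t y ≤ extAction n κ ρ₀ u₀ r t z}

/-- `y(r,t)`, the supremum of the minimizers. -/
def minimizer (n : ℕ) (κ : ℝ) (ρ₀ u₀ : ℝ → ℝ) (r t : ℝ) : ℝ≥0∞ :=
  sSup (minimizers n κ ρ₀ u₀ r t)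

/-- The real interval `(0, y)` for `y ∈ [0, ∞]`. -/
def below (y : ℝ≥0∞) : Set ℝ := {s | 0 < s ∧ ENNReal.ofReal s < y}

/-- The radial mass `𝓜(r,t) = ∫₀^{y(r,t)} ρ₀(s) s^(n-1) ds`. -/
def radialMass (n : ℕ) (κ : ℝ) (ρ₀ u₀ : ℝ → ℝ) (r t : ℝ) : ℝ :=
  ∫ s in below (minimizer n κ ρ₀ u₀ r t), ρ₀ s * s ^ (n - 1)

/-- The radial momentum `𝓟(r,t) = ∫₀^{y(r,t)} ρ₀(s) (u₀(s) + κ E₀(s) t) s^(n-1) ds`. -/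
def radialMomentum (n : ℕ) (κ : ℝ) (ρ₀ u₀ : ℝ → ℝ) (r t : ℝ) : ℝ :=
  ∫ s in below (minimizer n κ ρ₀ u₀ r t),
    ρ₀ s * (u₀ s + κ * initialField n ρ₀ s * t) * s ^ (n - 1)

/-! ### Radial measures and fields -/

/-- The unit radial vector `x / |x|` (zero at the origin). -/
def radialDir {n : ℕ} (x : Space n) : Space n := ‖x‖⁻¹ • x

/-- `μ` is the derivative `∂_r M` of the function `M` on `[0, ∞)`, where `M` is continued by `0` to
negative arguments, so that `M 0` is the mass of `μ` at `r = 0`. -/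
def IsRadialDerivative (M : ℝ → ℝ) (μ : Measure ℝ) : Prop :=
  μ (Iio 0) = 0 ∧ ∀ r : ℝ, 0 ≤ r → μ (Iic r) = ENNReal.ofReal (M r)

/-- `∂_r P = w μ` on `(0, ∞)`. -/
def HasRadialDensity (P : ℝ → ℝ) (w : ℝ → ℝ) (μ : Measure ℝ) : Prop :=
  IntegrableOn w (Ioi 0) μ ∧
    ∀ a b : ℝ, 0 ≤ a → a ≤ b → ∫ r in Ioc a b, w r ∂μ = P b - P a

/-- The spherically symmetric measure `r^(1-n) μ` on `ℝⁿ`: its integral of `φ` is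
`∫ (∫_{S^(n-1)} φ(r ω) dω) dμ(r)`, with `dω` the (unnormalized) surface measure. -/
def radialMeasure (n : ℕ) (μ : Measure ℝ) : Measure (Space n) :=
  (μ.prod (volume : Measure (Space n)).toSphere).map
    (fun p : ℝ × Metric.sphere (0 : Space n) 1 => p.1 • (p.2 : Space n))

/-- The electric field `E(r) = ½ (∫₀^{r-} dμ + ∫₀^{r+} dμ)`, given by the average rule. -/
def electricField (μ : Measure ℝ) (r : ℝ) : ℝ :=
  1 / 2 * ((μ (Iio r)).toReal + (μ (Iic r)).toReal)

/-- The field `∇V` with `r^(n-1) V_r = E`. -/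
def radialGradient (n : ℕ) (μ : Measure ℝ) (x : Space n) : Space n :=
  ((‖x‖ ^ (n - 1))⁻¹ * electricField μ ‖x‖) • radialDir x

/-! ### Weak solutions -/

/-- `G` is the weak gradient of `V`. -/
def IsWeakGradient {n : ℕ} (V : Space n → ℝ) (G : Space n → Space n) : Prop :=
  LocallyIntegrable V ∧ LocallyIntegrable G ∧
    ∀ (ψ : Space n → ℝ) (e : Space n), ContDiff ℝ ∞ ψ → HasCompactSupport ψ →
      ∫ x, V x * fderiv ℝ ψ x e = - ∫ x, ⟪G x, e⟫ * ψ x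

/-- `∇ · G = ρ` weakly. -/
def HasWeakDivergence {n : ℕ} (G : Space n → Space n) (ρ : Measure (Space n)) : Prop :=
  ∀ ψ : Space n → ℝ, ContDiff ℝ ∞ ψ → HasCompactSupport ψ →
    ∫ x, fderiv ℝ ψ x (G x) = - ∫ x, ψ x ∂ρ

/-- `(ρ, u, V)` is a global weak solution of
`ρ_t + ∇·(ρ u) = 0`, `(ρ u)_t + ∇·(ρ u ⊗ u) = κ ρ |x|^(n-1) ∇V`, `ΔV = ρ`
on `[0, ∞) × ℝⁿ` with initial density `ρ₀` and initial momentum `m₀`. The density `ρ t` is a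
measure and `G t` is the representative of `∇V` that the force uses. Test functions are smooth with
compact support in `ℝ × ℝⁿ`; they need not vanish at `t = 0`. -/
structure IsWeakSolution (n : ℕ) (κ : ℝ) (ρ₀ : Space n → ℝ) (m₀ : Space n → Space n)
    (ρ : ℝ → Measure (Space n)) (u : ℝ → Space n → Space n)
    (V : ℝ → Space n → ℝ) (G : ℝ → Space n → Space n) : Prop where
  measurable_density : Measurable ρ
  measurable_velocity : Measurable (fun p : ℝ × Space n => u p.1 p.2)
  measurable_gradient : Measurable (fun p : ℝ × Space n => G p.1 p.2)
  /-- Density, momentum and momentum flux have finite mass on bounded sets of space-time. -/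
  finite_energy : ∀ T R : ℝ,
    ∫⁻ t in Ioc 0 T, ∫⁻ x in Metric.ball 0 R, (1 + ‖u t x‖ₑ ^ 2) ∂(ρ t) < ⊤
  /-- The force has finite mass on bounded sets of space-time. -/
  finite_force : ∀ T R : ℝ,
    ∫⁻ t in Ioc 0 T, ∫⁻ x in Metric.ball 0 R, ‖‖x‖ ^ (n - 1) • G t x‖ₑ ∂(ρ t) < ⊤
  /-- `G = ∇V`. -/
  gradient : ∀ t : ℝ, 0 ≤ t → IsWeakGradient (V t) (G t)
  /-- `ΔV = ρ`. -/
  poisson : ∀ t : ℝ, 0 ≤ t → IsLocallyFiniteMeasure (ρ t) ∧ HasWeakDivergence (G t) (ρ t)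
  /-- `∬ (∂_t φ + u · ∇φ) dρ dt + ∫ φ(0,x) ρ₀(x) dx = 0`. -/
  mass : ∀ φ : ℝ × Space n → ℝ, ContDiff ℝ ∞ φ → HasCompactSupport φ →
    (∫ t in Ioi 0, ∫ x, (fderiv ℝ φ (t, x) (1, 0) + fderiv ℝ φ (t, x) (0, u t x)) ∂(ρ t))
      + ∫ x, φ (0, x) * ρ₀ x = 0
  /-- `∬ (u · ∂_t Φ + (u ⊗ u) : ∇Φ + κ |x|^(n-1) ∇V · Φ) dρ dt + ∫ m₀(x) · Φ(0,x) dx = 0`. -/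
  momentum : ∀ Φ : ℝ × Space n → Space n, ContDiff ℝ ∞ Φ → HasCompactSupport Φ →
    (∫ t in Ioi 0, ∫ x, (⟪u t x, fderiv ℝ Φ (t, x) (1, 0)⟫
        + ⟪u t x, fderiv ℝ Φ (t, x) (0, u t x)⟫
        + κ * ‖x‖ ^ (n - 1) * ⟪G t x, Φ (t, x)⟫) ∂(ρ t))
      + ∫ x, ⟪m₀ x, Φ (0, x)⟫ = 0

end EulerPoisson

end

open scoped Topology

noncomputable section

namespace EulerPoisson


/-! ### The variational principle for a finite measure on the half-line -/

/-! Let `m` be the mass measure `s^(n-1) ρ₀ ds` on the half-line. It is finite and has no atoms. Up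
to its first collision, the particle starting at `s` moves freely along `S.pos t s`. The action
`∫_{(0,y)} (S.pos t s - r) dm` selects which particles have reached radius at most `r` at time `t`:
if it is minimal at `y`, the mean position of every slab ending at `y` is at most `r`, and that of
every slab starting at `y` is at least `r`. The sticky trajectory `S.traj t s` is the generalized
inverse of `r ↦ S.ymax r t`, and the density at time `t` is the image of `m` under it. Particles
with a common image fill the slab between the smallest and the largest minimizer.

Comparing means over slabs around `s` shows that `t ↦ S.traj t s` is locally Lipschitz
(`exists_traj_lipschitz`). At almost every time its derivative is `S.speed`, the mean free velocity
of the slab (`ae_hasDerivAt_traj`). This is an envelope argument: every minimizer `y` touches the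
minimal action from above along the trajectory, so `S.mom t y - x' * S.mass y` is the same for all
of them. A cluster at the origin stays there with speed `0`.

Off the origin, the speed at the particle's position is the conditional expectation of its free
velocity given that position. The electric field is likewise the conditional expectation of the
initial field; the average rule for `E` is the identity `(M² - N²)/2 = (M - N)(M + N)/2`
(`two_mul_cum_field`, `isFibreAverage_elec`). The mass equation follows by differentiating `G(t,
traj)` in time and integrating over particles. For momentum one differentiates `F(t, traj) * vel`,
with the free velocity of the individual particle, and then conditions on the position: `speed *
vel` becomes `speed²`, and `field` becomes `elec`. The test function must vanish at the origin, as
the radial part of a spherically averaged vector field does.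

The delicate point is integrability of `speed * vel`, since the data give only one moment of the
velocity. The one-sided bound `speed_le` limits how fast trajectories move outwards, so `arctan` of
a trajectory has total variation bounded uniformly in the particle on `[a, b]` with `a > 0`.
Inserting `arctan r` in the resulting momentum identity bounds the weighted kinetic energy
independently of `a`, and `a → 0` becomes possible.

In `ℝⁿ`, test functions are averaged over spheres. The weight `|x|^(n-1)` cancels the singularity of
`∇V`, so the radial problem is the same in every dimension. The Poisson equation is Fubini in polar
coordinates, and `∇V` is identified by cutting the potential off near the origin. -/

lemma measurableSet_below (y : ℝ≥0∞) : MeasurableSet (below y) :=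
  measurableSet_Ioi.inter (measurableSet_lt ENNReal.measurable_ofReal measurable_const)

lemma below_mono {a b : ℝ≥0∞} (h : a ≤ b) : below a ⊆ below b :=
  fun _ hs => ⟨hs.1, hs.2.trans_le h⟩

lemma below_top : below ⊤ = Ioi 0 := by
  ext s; simp [below]

lemma below_ofReal (y : ℝ) : below (ENNReal.ofReal y) = Ioo 0 y := by
  ext s
  simp only [below, mem_Ioo]
  constructor
  · rintro ⟨h0, h⟩
    exact ⟨h0, (ENNReal.ofReal_lt_ofReal_iff_of_nonneg h0.le).1 h⟩
  · rintro ⟨h0, h⟩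
    exact ⟨h0, (ENNReal.ofReal_lt_ofReal_iff_of_nonneg h0.le).2 h⟩

/-- Radial initial data: the mass measure `s^(n-1) ρ₀(s) ds` on `(0, ∞)`, the velocity and the
coupling constant. -/
structure RadialData where
  m : Measure ℝ
  u : ℝ → ℝ
  κ : ℝ
  finite : IsFiniteMeasure m
  noAtoms : NullSingletonClass m
  null_nonpos : m (Iic 0) = 0
  cont : Continuous u
  integrable : Integrable u m

attribute [instance] RadialData.finite RadialData.noAtoms

namespace RadialData

variable (S : RadialData)

/-- The mass in `(0, s]`. -/
def field (s : ℝ) : ℝ := S.m.real (Iic s)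

/-- The velocity at time `t` of the free particle starting at `s`. -/
def vel (t s : ℝ) : ℝ := S.u s + S.κ * S.field s * t

/-- The position at time `t` of the free particle starting at `s`. -/
def pos (t s : ℝ) : ℝ := s + t * S.u s + 1 / 2 * S.κ * S.field s * t ^ 2

/-- The total mass. -/
def total : ℝ := S.m.real univ

/-- The cumulative integral over `(0, y)`. -/
def cum (f : ℝ → ℝ) (y : ℝ≥0∞) : ℝ := ∫ s in below y, f s ∂S.m

/-- The mass of `(0, y)`. -/
def mass (y : ℝ≥0∞) : ℝ := S.m.real (below y)

/-- The action functional on `[0, ∞]`. -/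
def act (r t : ℝ) (y : ℝ≥0∞) : ℝ := S.cum (fun s => S.pos t s - r) y

/-- The points of `[0, ∞]` where the action is finite. -/
def Admissible (y : ℝ≥0∞) : Prop := IntegrableOn (fun s => s) (below y) S.m

/-- Minimizers of the action. -/
def IsMin (r t : ℝ) (y : ℝ≥0∞) : Prop :=
  S.Admissible y ∧ ∀ z, S.Admissible z → S.act r t y ≤ S.act r t z

lemma ae_pos : ∀ᵐ s ∂S.m, 0 < s := by
  have := S.null_nonpos
  rw [measure_eq_zero_iff_ae_notMem] at this
  filter_upwards [this] with s hs using not_le.1 hs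

lemma total_nonneg : 0 ≤ S.total := measureReal_nonneg

lemma field_nonneg (s : ℝ) : 0 ≤ S.field s := measureReal_nonneg

lemma field_le (s : ℝ) : S.field s ≤ S.total := measureReal_mono (subset_univ _)

lemma continuous_field : Continuous S.field := by
  have : S.field = fun x => ∫ s, (Iic x).indicator (fun _ => (1 : ℝ)) s ∂S.m := by
    ext x
    rw [integral_indicator measurableSet_Iic]
    simp [field]
  rw [this, continuous_iff_continuousAt]
  intro x
  refine continuousAt_of_dominated (bound := fun _ => 1) ?_ ?_ (integrable_const _) ?_
  · exact Eventually.of_forall fun y =>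
      (measurable_const.indicator measurableSet_Iic).aestronglyMeasurable
  · refine Eventually.of_forall fun y => Eventually.of_forall fun s => ?_
    by_cases h : s ∈ Iic y <;> simp [h]
  · have : ∀ᵐ s ∂S.m, s ≠ x := by
      simp [ae_iff]
    filter_upwards [this] with s hs
    rcases lt_or_gt_of_ne hs with h | h
    · refine ContinuousAt.congr (f := fun _ => (1 : ℝ)) continuousAt_const ?_
      filter_upwards [lt_mem_nhds h] with y hy
      simp [indicator, hy.le]
    · refine ContinuousAt.congr (f := fun _ => (0 : ℝ)) continuousAt_const ?_
      filter_upwards [gt_mem_nhds h] with y hy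
      simp [indicator, hy]

lemma measurable_field : Measurable S.field := S.continuous_field.measurable

lemma integrable_field : Integrable S.field S.m := by
  refine Integrable.of_bound S.measurable_field.aestronglyMeasurable S.total ?_
  refine Eventually.of_forall fun s => ?_
  rw [Real.norm_of_nonneg (S.field_nonneg s)]
  exact S.field_le s

lemma continuous_vel : Continuous fun p : ℝ × ℝ => S.vel p.1 p.2 := by
  have := S.continuous_field
  have := S.cont
  unfold vel
  fun_prop

lemma continuous_pos : Continuous fun p : ℝ × ℝ => S.pos p.1 p.2 := by
  have := S.continuous_field
  have := S.cont
  unfold pos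
  fun_prop

lemma integrable_vel (t : ℝ) : Integrable (S.vel t) S.m :=
  S.integrable.add ((S.integrable_field.const_mul S.κ).mul_const t)

/-- Dominated convergence: moving the endpoint changes the integrand at `s` only when the endpoint
crosses `s`, and single points are null. The endpoint `∞` is included, which makes the compactness
of `[0, ∞]` usable below. -/
lemma continuous_cum {f : ℝ → ℝ} (hf : Integrable f S.m) : Continuous (S.cum f) := by
  have : S.cum f = fun y => ∫ s, (below y).indicator f s ∂S.m := by
    ext y
    rw [integral_indicator (measurableSet_below y)]
    rfl
  rw [this, continuous_iff_continuousAt]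
  intro y
  refine continuousAt_of_dominated (bound := fun s => ‖f s‖) ?_ ?_ hf.norm ?_
  · exact Eventually.of_forall fun y =>
      hf.aestronglyMeasurable.indicator (measurableSet_below y)
  · exact Eventually.of_forall fun y => Eventually.of_forall fun s => norm_indicator_le_norm_self ..
  · have : ∀ᵐ s ∂S.m, s ≠ y.toReal := by
      simp [ae_iff]
    filter_upwards [this, S.ae_pos] with s hs h0
    rcases lt_trichotomy (ENNReal.ofReal s) y with h | h | h
    · refine ContinuousAt.congr (f := fun _ => f s) continuousAt_const ?_
      filter_upwards [lt_mem_nhds h] with z hz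
      simp [indicator, below, hz, h0]
    · exact absurd (by rw [← h, ENNReal.toReal_ofReal h0.le]) hs
    · refine ContinuousAt.congr (f := fun _ => (0 : ℝ)) continuousAt_const ?_
      filter_upwards [gt_mem_nhds h] with z hz
      have : ¬ ENNReal.ofReal s < z := not_lt.2 hz.le
      simp [indicator, below, this]

lemma mass_eq_cum : S.mass = S.cum fun _ => 1 := by
  ext y; simp [mass, cum]

lemma continuous_mass : Continuous S.mass := by
  rw [mass_eq_cum]; exact S.continuous_cum (integrable_const _)

lemma mass_nonneg (y : ℝ≥0∞) : 0 ≤ S.mass y := measureReal_nonneg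

lemma mass_le (y : ℝ≥0∞) : S.mass y ≤ S.total := measureReal_mono (subset_univ _)

lemma cum_sub_cum {f : ℝ → ℝ} {a b : ℝ≥0∞} (hab : a ≤ b) (hf : IntegrableOn f (below b) S.m) :
    S.cum f b - S.cum f a = ∫ s in below b \ below a, f s ∂S.m := by
  rw [setIntegral_sdiff (measurableSet_below a) hf (below_mono hab)]
  rfl

lemma mass_sub_mass {a b : ℝ≥0∞} (hab : a ≤ b) :
    S.mass b - S.mass a = S.m.real (below b \ below a) := by
  rw [mass_eq_cum, S.cum_sub_cum hab (integrable_const _).integrableOn]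
  simp

variable {S}

lemma Admissible.mono {a b : ℝ≥0∞} (h : S.Admissible b) (hab : a ≤ b) : S.Admissible a :=
  IntegrableOn.mono_set h (below_mono hab)

lemma admissible_of_ne_top {y : ℝ≥0∞} (hy : y ≠ ⊤) : S.Admissible y := by
  refine IntegrableOn.of_bound (C := y.toReal) (measure_lt_top _ _)
    measurable_id.aestronglyMeasurable ?_
  refine (ae_restrict_mem (measurableSet_below y)).mono fun s hs => ?_
  rw [Real.norm_of_nonneg hs.1.le]
  exact ((ENNReal.ofReal_lt_iff_lt_toReal hs.1.le hy).1 hs.2).le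

lemma Admissible.integrableOn_pos {y : ℝ≥0∞} (hy : S.Admissible y) (t : ℝ) :
    IntegrableOn (S.pos t) (below y) S.m := by
  have h1 : IntegrableOn (fun s => t * S.u s) (below y) S.m :=
    (S.integrable.const_mul t).integrableOn
  have h2 : IntegrableOn (fun s => 1 / 2 * S.κ * S.field s * t ^ 2) (below y) S.m :=
    ((S.integrable_field.const_mul _).mul_const _).integrableOn
  exact (Integrable.add hy h1).add h2

lemma Admissible.integrableOn_pos_sub {y : ℝ≥0∞} (hy : S.Admissible y) (r t : ℝ) :
    IntegrableOn (fun s => S.pos t s - r) (below y) S.m :=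
  (hy.integrableOn_pos t).sub (integrable_const _)

variable (S) in
/-- The part of the action which is continuous up to `y = ∞`. -/
def actRest (r t : ℝ) (y : ℝ≥0∞) : ℝ :=
  t * S.cum S.u y + 1 / 2 * S.κ * t ^ 2 * S.cum S.field y - r * S.mass y

lemma act_eq {y : ℝ≥0∞} (hy : S.Admissible y) (r t : ℝ) :
    S.act r t y = S.cum (fun s => s) y + S.actRest r t y := by
  have h1 : IntegrableOn (fun s => t * S.u s) (below y) S.m :=
    (S.integrable.const_mul t).integrableOn
  have h2 : IntegrableOn (fun s => 1 / 2 * S.κ * t ^ 2 * S.field s) (below y) S.m :=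
    (S.integrable_field.const_mul _).integrableOn
  have h3 : IntegrableOn (fun _ => r) (below y) S.m := integrable_const _
  have : S.act r t y = ∫ s in below y, (s + t * S.u s + 1 / 2 * S.κ * t ^ 2 * S.field s) - r ∂S.m := by
    unfold act cum pos
    congr 1 with s; ring
  have h4 := integral_sub ((Integrable.add hy h1).add h2) h3
  have h5 := integral_add (Integrable.add hy h1) h2
  have h6 := integral_add hy h1
  simp only [Pi.add_apply] at h4 h5 h6
  rw [this, h4, h5, h6, integral_const_mul, integral_const_mul]
  simp only [cum, mass, actRest, integral_const, smul_eq_mul, measureReal_restrict_apply_univ]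
  ring

lemma continuous_actRest :
    Continuous fun p : (ℝ × ℝ) × ℝ≥0∞ => S.actRest p.1.1 p.1.2 p.2 := by
  have h1 := S.continuous_cum S.integrable
  have h2 := S.continuous_cum S.integrable_field
  have h3 := S.continuous_mass
  unfold actRest
  fun_prop

lemma integrable_trunc (N : ℕ) : Integrable (fun s => min |s| (N : ℝ)) S.m := by
  refine Integrable.of_bound (by fun_prop) (N : ℝ) (Eventually.of_forall fun s => ?_)
  rw [Real.norm_of_nonneg (le_min (abs_nonneg _) N.cast_nonneg)]
  exact min_le_right _ _

lemma tendsto_trunc (s : ℝ) : Tendsto (fun N : ℕ => min |s| (N : ℝ)) atTop (𝓝 |s|) := by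
  refine tendsto_const_nhds.congr' ?_
  obtain ⟨N, hN⟩ := exists_nat_ge |s|
  filter_upwards [eventually_ge_atTop N] with k hk
  exact (min_eq_left (hN.trans (by exact_mod_cast hk))).symm

lemma cum_abs (y : ℝ≥0∞) : S.cum (fun s => |s|) y = S.cum (fun s => s) y :=
  setIntegral_congr_fun (measurableSet_below y) fun _ hs => abs_of_pos hs.1

/-- Only the term `∫ s dm` of the action can fail to be continuous at `∞`. It is the supremum of its
truncations, which are continuous on `[0, ∞]`, so minimality becomes a family of closed conditions,
with admissibility of `y` as a consequence. -/
lemma isMin_iff {r t : ℝ} {y : ℝ≥0∞} :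
    S.IsMin r t y ↔ ∀ z, S.Admissible z → ∀ N : ℕ,
      S.cum (fun s => min |s| (N : ℝ)) y + S.actRest r t y ≤ S.act r t z := by
  constructor
  · rintro ⟨hy, h⟩ z hz N
    refine le_trans ?_ (h z hz)
    rw [act_eq hy, ← cum_abs]
    gcongr
    exact setIntegral_mono (integrable_trunc N).integrableOn hy.norm fun s => min_le_left _ _
  · intro h
    have hy : S.Admissible y := by
      -- Comparison with `z = 0` bounds the truncated first moments independently of `N`, and Fatou
      -- then gives integrability of `s`.
      have h0 := h 0 (admissible_of_ne_top ENNReal.zero_ne_top)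
      refine integrable_of_tendsto (G := fun N s => min |s| (N : ℝ)) (f := fun s => s) ?_ ?_ ?_
      · refine (ae_restrict_mem (measurableSet_below y)).mono fun s hs => ?_
        simpa only [abs_of_pos hs.1] using tendsto_trunc s
      · exact fun N => (integrable_trunc N).aestronglyMeasurable.restrict
      · refine ne_top_of_le_ne_top
          (ENNReal.ofReal_ne_top (r := S.act r t 0 - S.actRest r t y)) ?_
        refine liminf_le_of_le (by isBoundedDefault) fun b hb => ?_
        obtain ⟨N, hN⟩ := hb.exists
        refine hN.trans ?_
        rw [← ofReal_integral_norm_eq_lintegral_enorm (integrable_trunc N).integrableOn]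
        refine ENNReal.ofReal_le_ofReal ?_
        have : ∫ s in below y, ‖min |s| (N : ℝ)‖ ∂S.m = S.cum (fun s => min |s| (N : ℝ)) y := by
          refine setIntegral_congr_fun (measurableSet_below y) fun s hs => ?_
          exact Real.norm_of_nonneg (le_min (abs_nonneg _) N.cast_nonneg)
        rw [this]
        linarith [h0 N]
    refine ⟨hy, fun z hz => ?_⟩
    have hlim : Tendsto (fun N : ℕ => S.cum (fun s => min |s| (N : ℝ)) y) atTop
        (𝓝 (S.cum (fun s => |s|) y)) := by
      refine tendsto_integral_of_dominated_convergence (fun s => |s|) ?_ hy.norm ?_ ?_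
      · exact fun N => (integrable_trunc N).aestronglyMeasurable.restrict
      · refine fun N => Eventually.of_forall fun s => ?_
        rw [Real.norm_of_nonneg (le_min (abs_nonneg _) N.cast_nonneg)]
        exact min_le_left _ _
      · exact Eventually.of_forall tendsto_trunc
    rw [act_eq hy, ← cum_abs]
    exact le_of_tendsto (hlim.add_const _) (Eventually.of_forall (h z hz))

variable (S) in
lemma continuous_act {z : ℝ≥0∞} (hz : S.Admissible z) :
    Continuous fun p : ℝ × ℝ => S.act p.1 p.2 z := by
  simp only [act_eq hz, actRest]
  fun_prop

lemma isClosed_trunc_le (N : ℕ) {z : ℝ≥0∞} (hz : S.Admissible z) :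
    IsClosed {p : (ℝ × ℝ) × ℝ≥0∞ | S.cum (fun s => min |s| (N : ℝ)) p.2
      + S.actRest p.1.1 p.1.2 p.2 ≤ S.act p.1.1 p.1.2 z} := by
  refine isClosed_le ?_ ((S.continuous_act hz).comp continuous_fst)
  exact ((S.continuous_cum (integrable_trunc N)).comp continuous_snd).add continuous_actRest

variable (S) in
lemma isClosed_isMin : IsClosed {p : (ℝ × ℝ) × ℝ≥0∞ | S.IsMin p.1.1 p.1.2 p.2} := by
  simp only [isMin_iff, ofPred_forall]
  exact isClosed_iInter fun z => isClosed_iInter fun hz => isClosed_iInter fun N =>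
    isClosed_trunc_le N hz

variable (S) in
-- The sets `K z` of points doing at least as well as `z` are closed in a compact space, contain
-- `z`, and are nested according to the action of `z`. Their intersection is therefore nonempty and
-- consists of minimizers; no lower bound on the action is needed beforehand.
lemma exists_isMin (r t : ℝ) : ∃ y, S.IsMin r t y := by
  let K : {z // S.Admissible z} → Set ℝ≥0∞ := fun z => ⋂ N : ℕ,
    {y | S.cum (fun s => min |s| (N : ℝ)) y + S.actRest r t y ≤ S.act r t z}
  have hcl : ∀ z, IsClosed (K z) := fun z => isClosed_iInter fun N =>
    (isClosed_trunc_le N z.2).preimage (f := fun y => ((r, t), y)) (by fun_prop)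
  have : Nonempty {z // S.Admissible z} := ⟨⟨0, admissible_of_ne_top ENNReal.zero_ne_top⟩⟩
  have hmono : ∀ z z' : {z // S.Admissible z}, S.act r t z ≤ S.act r t z' → K z ⊆ K z' := by
    intro z z' h y hy
    simp only [K, mem_iInter] at hy ⊢
    exact fun N => (hy N).trans h
  have hdir : Directed (· ⊇ ·) K := by
    intro z z'
    rcases le_total (S.act r t z) (S.act r t z') with h | h
    · exact ⟨z, Subset.rfl, hmono _ _ h⟩
    · exact ⟨z', hmono _ _ h, Subset.rfl⟩
  have hne : ∀ z, (K z).Nonempty := by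
    rintro ⟨z, hz⟩
    refine ⟨z, mem_iInter.2 fun N => ?_⟩
    rw [mem_ofPred_eq, act_eq hz, ← cum_abs]
    gcongr
    exact setIntegral_mono (integrable_trunc N).integrableOn hz.norm fun s => min_le_left _ _
  obtain ⟨y, hy⟩ := IsCompact.nonempty_iInter_of_directed_nonempty_isCompact_isClosed K hdir hne
    (fun z => (hcl z).isCompact) hcl
  refine ⟨y, isMin_iff.2 fun z hz N => ?_⟩
  have := mem_iInter.1 hy ⟨z, hz⟩
  exact mem_iInter.1 this N

variable (S) in
/-- The largest minimizer. -/
def ymax (r t : ℝ) : ℝ≥0∞ := sSup {y | S.IsMin r t y}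

variable (S) in
/-- The smallest minimizer. -/
def ymin (r t : ℝ) : ℝ≥0∞ := sInf {y | S.IsMin r t y}

lemma isClosed_isMin_fiber (r t : ℝ) : IsClosed {y | S.IsMin r t y} :=
  S.isClosed_isMin.preimage (f := fun y => ((r, t), y)) (by fun_prop)

lemma isMin_ymax (r t : ℝ) : S.IsMin r t (S.ymax r t) :=
  (isClosed_isMin_fiber r t).csSup_mem (S.exists_isMin r t) (OrderTop.bddAbove _)

lemma isMin_ymin (r t : ℝ) : S.IsMin r t (S.ymin r t) :=
  (isClosed_isMin_fiber r t).csInf_mem (S.exists_isMin r t) (OrderBot.bddBelow _)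

lemma IsMin.le_ymax {r t : ℝ} {y : ℝ≥0∞} (h : S.IsMin r t y) : y ≤ S.ymax r t := le_sSup h

lemma IsMin.ymin_le {r t : ℝ} {y : ℝ≥0∞} (h : S.IsMin r t y) : S.ymin r t ≤ y := sInf_le h

lemma ymin_le_ymax (r t : ℝ) : S.ymin r t ≤ S.ymax r t := (isMin_ymin r t).le_ymax

/-- Projection along the compact factor `[0, ∞]` is a closed map. This makes `ymax` upper and `ymin`
lower semicontinuous in `(r, t)`, hence both measurable. -/
lemma isClosed_exists_isMin {C : Set ℝ≥0∞} (hC : IsClosed C) :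
    IsClosed {p : ℝ × ℝ | ∃ y ∈ C, S.IsMin p.1 p.2 y} := by
  have := isClosedMap_fst_of_compactSpace (X := ℝ × ℝ) (Y := ℝ≥0∞) _
    (S.isClosed_isMin.inter (hC.preimage continuous_snd))
  convert this using 1
  ext p
  constructor
  · rintro ⟨y, hy, h⟩; exact ⟨(p, y), ⟨h, hy⟩, rfl⟩
  · rintro ⟨⟨q, y⟩, ⟨h, hy⟩, rfl⟩; exact ⟨y, hy, h⟩

lemma isClosed_le_ymax (c : ℝ≥0∞) : IsClosed {p : ℝ × ℝ | c ≤ S.ymax p.1 p.2} := by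
  convert isClosed_exists_isMin (S := S) (isClosed_Ici (a := c)) using 1
  ext p
  exact ⟨fun h => ⟨_, h, isMin_ymax _ _⟩, fun ⟨y, hy, h⟩ => le_trans hy h.le_ymax⟩

lemma isClosed_ymin_le (c : ℝ≥0∞) : IsClosed {p : ℝ × ℝ | S.ymin p.1 p.2 ≤ c} := by
  convert isClosed_exists_isMin (S := S) (isClosed_Iic (a := c)) using 1
  ext p
  exact ⟨fun h => ⟨_, h, isMin_ymin _ _⟩, fun ⟨y, hy, h⟩ => le_trans h.ymin_le hy⟩

variable (S) in
lemma measurable_ymax : Measurable fun p : ℝ × ℝ => S.ymax p.1 p.2 :=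
  measurable_of_Ici fun c => (isClosed_le_ymax c).measurableSet

variable (S) in
lemma measurable_ymin : Measurable fun p : ℝ × ℝ => S.ymin p.1 p.2 :=
  measurable_of_Iic fun c => (isClosed_ymin_le c).measurableSet

/-! ### Comparison of minimizers -/

lemma act_sub_act {a b : ℝ≥0∞} (hab : a ≤ b) (hb : S.Admissible b) (r t : ℝ) :
    S.act r t b - S.act r t a = ∫ s in below b \ below a, (S.pos t s - r) ∂S.m :=
  S.cum_sub_cum hab (hb.integrableOn_pos_sub r t)

lemma act_sub_act_eq {a b : ℝ≥0∞} (hab : a ≤ b) (hb : S.Admissible b) (r t : ℝ) :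
    S.act r t b - S.act r t a
      = ∫ s in below b \ below a, S.pos t s ∂S.m - r * S.m.real (below b \ below a) := by
  rw [act_sub_act hab hb, integral_sub]
  · simp [mul_comm]
  · exact (hb.integrableOn_pos t).mono_set sdiff_subset
  · exact integrable_const _

/-- Removing a slab below a minimizer cannot lower the action. Together with
`IsMin.integral_nonneg`, for adding a slab above, this is the form in which minimality is used
throughout. -/
lemma IsMin.integral_nonpos {r t : ℝ} {a b : ℝ≥0∞} (hb : S.IsMin r t b) (hab : a ≤ b) :
    ∫ s in below b \ below a, S.pos t s ∂S.m ≤ r * S.m.real (below b \ below a) := by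
  have := hb.2 a (hb.1.mono hab)
  have h := act_sub_act_eq hab hb.1 r t
  linarith

lemma IsMin.integral_nonneg {r t : ℝ} {a b : ℝ≥0∞} (ha : S.IsMin r t a) (hab : a ≤ b)
    (hb : S.Admissible b) :
    r * S.m.real (below b \ below a) ≤ ∫ s in below b \ below a, S.pos t s ∂S.m := by
  have := ha.2 b hb
  have h := act_sub_act_eq hab hb r t
  linarith

lemma IsMin.le_of_integral_nonpos {r t : ℝ} {a b : ℝ≥0∞} (ha : S.IsMin r t a) (hab : a ≤ b)
    (hb : S.Admissible b)
    (h : ∫ s in below b \ below a, S.pos t s ∂S.m ≤ r * S.m.real (below b \ below a)) :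
    S.IsMin r t b := by
  refine ⟨hb, fun z hz => le_trans ?_ (ha.2 z hz)⟩
  have := act_sub_act_eq hab hb r t
  linarith

/-- If `r ≤ r'` but the largest minimizer dropped, the slab between the two would have mean position
at most `r`, hence at most `r'`, and could be added to the minimizer for `r'`, contradicting that it
is the largest. -/
lemma ymax_mono (t : ℝ) : Monotone fun r => S.ymax r t := by
  intro r r' hr
  by_contra! h
  have h1 := (isMin_ymax (S := S) r t).integral_nonpos h.le
  refine absurd ((isMin_ymax (S := S) r' t).le_of_integral_nonpos h.le (isMin_ymax r t).1
    (h1.trans ?_)).le_ymax (not_le.2 h)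
  gcongr

end RadialData


/-! ### Points charged from both sides -/

/-- Every one-sided neighbourhood of `s > 0` has positive mass. -/
structure Charged (m : Measure ℝ) (s : ℝ) : Prop where
  pos : 0 < s
  left : ∀ c < s, 0 < m (Ioo c s)
  right : ∀ c > s, 0 < m (Ioo s c)

/-- It suffices to treat rational right endpoints `q`. The bad points `s` for `q` lie in the union
of the null intervals `(s, q)`, which is null because nullity is a local property, except possibly
for a smallest bad point, and one point has no mass. -/
lemma ae_right_charged (m : Measure ℝ) [NullSingletonClass m] :
    ∀ᵐ s ∂m, ∀ c > s, 0 < m (Ioo s c) := by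
  have key : ∀ q : ℚ, m {s : ℝ | s < (q : ℝ) ∧ m (Ioo s (q : ℝ)) = 0} = 0 := by
    intro q
    set A := {s : ℝ | s < (q : ℝ) ∧ m (Ioo s (q : ℝ)) = 0} with hA
    set W := ⋃ s ∈ A, Ioo s (q : ℝ) with hW
    have hWnull : m W = 0 := by
      refine measure_null_of_locally_null _ fun x hx => ?_
      obtain ⟨s, hs, hx⟩ := mem_iUnion₂.1 hx
      exact ⟨Ioo s (q : ℝ), mem_nhdsWithin_of_mem_nhds (Ioo_mem_nhds hx.1 hx.2), hs.2⟩
    have hsub : (A \ W).Subsingleton := by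
      intro x hx y hy
      by_contra hne
      rcases lt_or_gt_of_ne hne with h | h
      · exact hy.2 (mem_iUnion₂.2 ⟨x, hx.1, h, hy.1.1⟩)
      · exact hx.2 (mem_iUnion₂.2 ⟨y, hy.1, h, hx.1.1⟩)
    refine measure_mono_null (t := W ∪ A \ W) (by simp) (measure_union_null hWnull ?_)
    exact hsub.measure_zero m
  have h2 : ∀ᵐ s ∂m, ∀ q : ℚ, ¬ (s < (q : ℝ) ∧ m (Ioo s (q : ℝ)) = 0) := by
    rw [ae_all_iff]
    intro q
    simpa [ae_iff] using key q
  filter_upwards [h2] with s hs c hc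
  obtain ⟨q, hq1, hq2⟩ := exists_rat_btwn hc
  have h3 : m (Ioo s (q : ℝ)) ≠ 0 := fun h => hs q ⟨hq1, h⟩
  exact (pos_iff_ne_zero.2 h3).trans_le (measure_mono (Ioo_subset_Ioo_right hq2.le))

lemma ae_left_charged (m : Measure ℝ) [NullSingletonClass m] :
    ∀ᵐ s ∂m, ∀ c < s, 0 < m (Ioo c s) := by
  have hneg : MeasurableEmbedding (Neg.neg : ℝ → ℝ) := (Homeomorph.neg ℝ).measurableEmbedding
  have : NullSingletonClass (m.map Neg.neg) := ⟨fun x => by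
    rw [hneg.map_apply]; simp⟩
  have := ae_right_charged (m.map Neg.neg)
  rw [hneg.ae_map_iff] at this
  filter_upwards [this] with s hs c hc
  have := hs (-c) (by simpa using hc)
  rwa [hneg.map_apply, show (Neg.neg ⁻¹' Ioo (-s) (-c) : Set ℝ) = Ioo c s by simp] at this

namespace RadialData

variable (S : RadialData)

lemma ae_charged : ∀ᵐ s ∂S.m, Charged S.m s := by
  filter_upwards [S.ae_pos, ae_left_charged S.m, ae_right_charged S.m] with s h1 h2 h3
  exact ⟨h1, h2, h3⟩

variable {S}

lemma mem_slab {a b : ℝ≥0∞} {x : ℝ} :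
    x ∈ below b \ below a ↔ 0 < x ∧ a ≤ ENNReal.ofReal x ∧ ENNReal.ofReal x < b := by
  simp only [below, Set.mem_sdiff, mem_ofPred_eq, not_and, not_lt]
  tauto

lemma measurableSet_slab (a b : ℝ≥0∞) : MeasurableSet (below b \ below a) :=
  (measurableSet_below b).diff (measurableSet_below a)

/-- Positivity of the mass allows it to be cancelled when two bounds for the integral of `S.pos t`
over the same slab are compared. -/
lemma slab_pos_left {s : ℝ} (hs : Charged S.m s) {a b : ℝ≥0∞} (ha : a < ENNReal.ofReal s)
    (hb : ENNReal.ofReal s ≤ b) : 0 < S.m.real (below b \ below a) := by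
  have ha' : a ≠ ⊤ := ne_top_of_lt ha
  refine ENNReal.toReal_pos (ne_of_gt ?_) (measure_ne_top _ _)
  refine (hs.left a.toReal ((ENNReal.lt_ofReal_iff_toReal_lt ha').1 ha)).trans_le
    (measure_mono fun x hx => ?_)
  have hx0 : 0 < x := ENNReal.toReal_nonneg.trans_lt hx.1
  exact mem_slab.2 ⟨hx0, ((ENNReal.lt_ofReal_iff_toReal_lt ha').2 hx.1).le,
    ((ENNReal.ofReal_lt_ofReal_iff hs.pos).2 hx.2).trans_le hb⟩

lemma slab_pos_right {s : ℝ} (hs : Charged S.m s) {a b : ℝ≥0∞} (ha : a ≤ ENNReal.ofReal s)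
    (hb : ENNReal.ofReal s < b) : 0 < S.m.real (below b \ below a) := by
  obtain ⟨c, hsc, hcb⟩ : ∃ c, s < c ∧ ENNReal.ofReal c ≤ b := by
    by_cases hb' : b = ⊤
    · exact ⟨s + 1, by linarith, by simp [hb']⟩
    · exact ⟨b.toReal, (ENNReal.ofReal_lt_iff_lt_toReal hs.pos.le hb').1 hb,
        (ENNReal.ofReal_toReal hb').le⟩
  refine ENNReal.toReal_pos (ne_of_gt ?_) (measure_ne_top _ _)
  refine (hs.right c hsc).trans_le (measure_mono fun x hx => ?_)
  have hx0 : 0 < x := hs.pos.trans hx.1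
  exact mem_slab.2 ⟨hx0, ha.trans (ENNReal.ofReal_le_ofReal hx.1.le),
    ((ENNReal.ofReal_lt_ofReal_iff (hx0.trans hx.2)).2 hx.2).trans_le hcb⟩

lemma integral_slab_le {a b : ℝ≥0∞} (hb : S.Admissible b) {t q : ℝ}
    (h : ∀ x, 0 < x → a ≤ ENNReal.ofReal x → ENNReal.ofReal x < b → S.pos t x ≤ q) :
    ∫ x in below b \ below a, S.pos t x ∂S.m ≤ q * S.m.real (below b \ below a) := by
  have : ∫ _ in below b \ below a, q ∂S.m = q * S.m.real (below b \ below a) := by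
    simp [mul_comm]
  rw [← this]
  refine setIntegral_mono_on ((hb.integrableOn_pos t).mono_set sdiff_subset)
    (integrable_const _) (measurableSet_slab _ _) fun x hx => ?_
  obtain ⟨h0, h1, h2⟩ := mem_slab.1 hx
  exact h x h0 h1 h2

lemma le_integral_slab {a b : ℝ≥0∞} (hb : S.Admissible b) {t q : ℝ}
    (h : ∀ x, 0 < x → a ≤ ENNReal.ofReal x → ENNReal.ofReal x < b → q ≤ S.pos t x) :
    q * S.m.real (below b \ below a) ≤ ∫ x in below b \ below a, S.pos t x ∂S.m := by
  have : ∫ _ in below b \ below a, q ∂S.m = q * S.m.real (below b \ below a) := by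
    simp [mul_comm]
  rw [← this]
  refine setIntegral_mono_on (integrable_const _) ((hb.integrableOn_pos t).mono_set sdiff_subset)
    (measurableSet_slab _ _) fun x hx => ?_
  obtain ⟨h0, h1, h2⟩ := mem_slab.1 hx
  exact h x h0 h1 h2

/-! ### Trajectories -/

variable (S) in
/-- The position at time `t` of the particle starting at `s`. -/
def traj (t s : ℝ) : ℝ := sInf {r | 0 ≤ r ∧ ENNReal.ofReal s ≤ S.ymax r t}

/-- Take `r` above the maximum of `S.pos t` on `[0, s]`: every slab ending at `s` then has mean at
most `r`, so a minimizer below `s` can be enlarged to `s`. -/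
lemma exists_le_ymax (t s : ℝ) : ∃ r, 0 ≤ r ∧ ENNReal.ofReal s ≤ S.ymax r t := by
  obtain ⟨R, hR⟩ := (isCompact_Icc (a := (0 : ℝ)) (b := s)).exists_bound_of_continuousOn
    (f := S.pos t) (S.continuous_pos.comp (by fun_prop : Continuous fun s => (t, s))).continuousOn
  refine ⟨max R 0, le_max_right _ _, ?_⟩
  by_contra! h
  refine absurd ((isMin_ymax (S := S) _ t).le_of_integral_nonpos h.le
    (admissible_of_ne_top ENNReal.ofReal_ne_top) ?_).le_ymax (not_le.2 h)
  refine integral_slab_le (admissible_of_ne_top ENNReal.ofReal_ne_top) fun x h0 _ h1 => ?_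
  have hxs : x < s := (ENNReal.ofReal_lt_ofReal_iff_of_nonneg h0.le).1 h1
  exact (le_abs_self _).trans ((hR x ⟨h0.le, hxs.le⟩).trans (le_max_left _ _))

lemma traj_nonneg (t s : ℝ) : 0 ≤ S.traj t s := Real.sInf_nonneg fun _ h => h.1

lemma le_ymax_traj (t s : ℝ) : ENNReal.ofReal s ≤ S.ymax (S.traj t s) t := by
  have hcl : IsClosed {r | 0 ≤ r ∧ ENNReal.ofReal s ≤ S.ymax r t} :=
    isClosed_Ici.inter ((isClosed_le_ymax _).preimage (f := fun r => (r, t)) (by fun_prop))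
  exact (hcl.csInf_mem (exists_le_ymax t s) ⟨0, fun _ h => h.1⟩).2

/-- A Galois connection: the infimum in `traj` is attained because `{c ≤ ymax}` is closed, and
`ymax` is monotone in `r`. -/
lemma traj_le_iff {r t s : ℝ} (hr : 0 ≤ r) : S.traj t s ≤ r ↔ ENNReal.ofReal s ≤ S.ymax r t :=
  ⟨fun h => (le_ymax_traj t s).trans (ymax_mono t h), fun h => csInf_le ⟨0, fun _ h => h.1⟩ ⟨hr, h⟩⟩

variable (S) in
lemma measurable_traj : Measurable fun p : ℝ × ℝ => S.traj p.1 p.2 := by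
  refine measurable_of_Iic fun r => ?_
  rcases lt_or_ge r 0 with hr | hr
  · convert MeasurableSet.empty
    ext p
    simp [hr.trans_le (traj_nonneg p.1 p.2)]
  · have : (fun p : ℝ × ℝ => S.traj p.1 p.2) ⁻¹' Iic r
        = {p | ENNReal.ofReal p.2 ≤ S.ymax r p.1} := by
      ext p; exact traj_le_iff hr
    rw [this]
    have h : Measurable fun p : ℝ × ℝ => S.ymax r p.1 :=
      S.measurable_ymax.comp (f := fun p : ℝ × ℝ => (r, p.1)) (by fun_prop)
    exact measurableSet_le (by fun_prop) h

variable (S) in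
lemma measurable_traj_right (t : ℝ) : Measurable (S.traj t) := by
  have h : Measurable (Function.uncurry S.traj) := S.measurable_traj
  exact h.of_uncurry_left

/-- For radii just below the trajectory the largest minimizer is still below `s`. Closedness passes
this to the limit, as the existence of some minimizer below `s`. Positivity provides nonnegative
radii to approach from. -/
lemma ymin_traj_le {t s : ℝ} (h : 0 < S.traj t s) : S.ymin (S.traj t s) t ≤ ENNReal.ofReal s := by
  have hcl : IsClosed {r | ∃ y ∈ Iic (ENNReal.ofReal s), S.IsMin r t y} :=
    (isClosed_exists_isMin isClosed_Iic).preimage (f := fun r => (r, t)) (by fun_prop)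
  have hsub : Ico 0 (S.traj t s) ⊆ {r | ∃ y ∈ Iic (ENNReal.ofReal s), S.IsMin r t y} := by
    intro r hr
    refine ⟨_, ?_, isMin_ymax r t⟩
    exact (not_le.1 fun h' => not_le.2 hr.2 ((traj_le_iff hr.1).2 h')).le
  have := hcl.closure_subset_iff.2 hsub
  rw [closure_Ico h.ne] at this
  obtain ⟨y, hy, hmin⟩ := this (right_mem_Icc.2 h.le)
  exact hmin.ymin_le.trans hy

/-- At a point which is charged from both sides, the positions of minimizers are critical. -/
lemma IsMin.pos_eq {r t s : ℝ} (hs : Charged S.m s) (h : S.IsMin r t (ENNReal.ofReal s)) :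
    S.pos t s = r := by
  have hcont : Continuous (S.pos t) :=
    S.continuous_pos.comp (by fun_prop : Continuous fun s => (t, s))
  apply le_antisymm
  -- Thin slabs to the left of `s` have positive mass, mean at most `r` by minimality, and mean
  -- close to `S.pos t s` by continuity. Slabs to the right give the opposite inequality.
  · refine le_of_forall_lt fun q hq => ?_
    obtain ⟨q', hq', hq''⟩ := exists_between hq
    obtain ⟨ε, hε, hball⟩ := Metric.eventually_nhds_iff.1
      (hcont.continuousAt.eventually (lt_mem_nhds hq''))
    have hlt : ENNReal.ofReal (s - ε / 2) < ENNReal.ofReal s :=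
      (ENNReal.ofReal_lt_ofReal_iff hs.pos).2 (by linarith)
    refine hq'.trans_le (le_of_mul_le_mul_right ?_ (slab_pos_left hs hlt le_rfl))
    refine (le_integral_slab h.1 fun x h0 h3 h4 => ?_).trans (h.integral_nonpos hlt.le)
    have h5 := (ENNReal.ofReal_le_ofReal_iff h0.le).1 h3
    have h6 := (ENNReal.ofReal_lt_ofReal_iff_of_nonneg h0.le).1 h4
    refine (hball ?_).le
    rw [Real.dist_eq, abs_of_nonpos] <;> linarith
  · refine le_of_forall_gt fun q hq => ?_
    obtain ⟨q', hq', hq''⟩ := exists_between hq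
    obtain ⟨ε, hε, hball⟩ := Metric.eventually_nhds_iff.1
      (hcont.continuousAt.eventually (gt_mem_nhds hq'))
    have hlt : ENNReal.ofReal s < ENNReal.ofReal (s + ε) :=
      (ENNReal.ofReal_lt_ofReal_iff (by linarith [hs.pos])).2 (by linarith)
    have hadm : S.Admissible (ENNReal.ofReal (s + ε)) := admissible_of_ne_top ENNReal.ofReal_ne_top
    refine (le_of_mul_le_mul_right ?_ (slab_pos_right hs le_rfl hlt)).trans_lt hq''
    refine (h.integral_nonneg hlt.le hadm).trans (integral_slab_le hadm fun x h0 h3 h4 => ?_)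
    have h5 := (ENNReal.ofReal_le_ofReal_iff h0.le).1 h3
    have h6 := (ENNReal.ofReal_lt_ofReal_iff_of_nonneg h0.le).1 h4
    refine (hball ?_).le
    rw [Real.dist_eq, abs_of_nonneg] <;> linarith

/-- At time `0` the integrand of the action is `x - r`, which changes sign exactly at `r`. The
charge to the left of `s` excludes a minimizer that reaches `s` at a smaller radius. -/
lemma traj_zero {s : ℝ} (hs : Charged S.m s) : S.traj 0 s = s := by
  apply le_antisymm
  · rw [traj_le_iff hs.pos.le]
    by_contra! h
    have hadm : S.Admissible (ENNReal.ofReal s) := admissible_of_ne_top ENNReal.ofReal_ne_top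
    refine absurd ((isMin_ymax (S := S) s 0).le_of_integral_nonpos h.le hadm
      (integral_slab_le hadm fun x h0 _ h1 => ?_)).le_ymax (not_le.2 h)
    simpa [pos] using ((ENNReal.ofReal_lt_ofReal_iff_of_nonneg h0.le).1 h1).le
  · refine le_of_forall_lt fun c hc => ?_
    by_contra! h
    obtain ⟨c', hc', hc''⟩ := exists_between hc
    have hb : ENNReal.ofReal s ≤ S.ymax (S.traj 0 s) 0 := le_ymax_traj 0 s
    have hlt : ENNReal.ofReal c' < ENNReal.ofReal s := (ENNReal.ofReal_lt_ofReal_iff hs.pos).2 hc''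
    refine absurd (le_of_mul_le_mul_right ?_ (slab_pos_left hs hlt hb)) (not_le.2 (h.trans_lt hc'))
    have hmin := isMin_ymax (S := S) (S.traj 0 s) 0
    refine (le_integral_slab hmin.1 fun x h0 h3 _ => ?_).trans
      (hmin.integral_nonpos (hlt.le.trans hb))
    simpa [pos] using (ENNReal.ofReal_le_ofReal_iff h0.le).1 h3

/-- Means of `g` over slabs containing `s` are bounded however long or thin the slab is. The part
below `s + 1` is controlled by the maximum of `g` there. A slab reaching beyond `s + 1` contains
`(s, s + 1)`, whose positive mass can be divided into the total integral of `g`. -/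
lemma exists_average_bound {s : ℝ} (hs : Charged S.m s) {g : ℝ → ℝ} (hg : Continuous g)
    (hg0 : ∀ x, 0 ≤ g x) (hgi : Integrable g S.m) :
    ∃ K : ℝ, 0 ≤ K ∧ ∀ a b : ℝ≥0∞, a ≤ ENNReal.ofReal s → ENNReal.ofReal s ≤ b →
      ∫ x in below b \ below a, g x ∂S.m ≤ K * S.m.real (below b \ below a) := by
  obtain ⟨G, hG⟩ := (isCompact_Icc (a := (0 : ℝ)) (b := s + 1)).exists_bound_of_continuousOn
    hg.continuousOn
  have hG0 : 0 ≤ G := (norm_nonneg _).trans (hG 0 ⟨le_rfl, by linarith [hs.pos]⟩)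
  have hμ : 0 < S.m.real (Ioo s (s + 1)) :=
    ENNReal.toReal_pos (hs.right _ (by linarith)).ne' (measure_ne_top _ _)
  have hI : 0 ≤ ∫ x, g x ∂S.m := integral_nonneg hg0
  refine ⟨G + (∫ x, g x ∂S.m) / S.m.real (Ioo s (s + 1)), by positivity, fun a b ha hb => ?_⟩
  set A := below b \ below a with hA
  rw [← integral_inter_add_sdiff (s := A) measurableSet_Iio (hgi.integrableOn) (t := Iio (s + 1)),
    add_mul]
  gcongr ?_ + ?_
  · calc ∫ x in A ∩ Iio (s + 1), g x ∂S.m ≤ ∫ _ in A ∩ Iio (s + 1), G ∂S.m := by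
          refine setIntegral_mono_on hgi.integrableOn (integrable_const _)
            ((measurableSet_slab a b).inter measurableSet_Iio) fun x hx => ?_
          exact (le_abs_self _).trans (hG x ⟨(mem_slab.1 hx.1).1.le, (mem_Iio.1 hx.2).le⟩)
      _ = G * S.m.real (A ∩ Iio (s + 1)) := by simp [mul_comm]
      _ ≤ G * S.m.real A := mul_le_mul_of_nonneg_left (measureReal_mono inter_subset_left) hG0
  · rcases le_or_gt b (ENNReal.ofReal (s + 1)) with h | h
    · have : A \ Iio (s + 1) = ∅ := by
        refine eq_empty_of_forall_notMem fun x hx => hx.2 ?_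
        obtain ⟨h0, -, h1⟩ := mem_slab.1 hx.1
        exact (ENNReal.ofReal_lt_ofReal_iff_of_nonneg h0.le).1 (h1.trans_le h)
      rw [this]
      simp only [Measure.restrict_empty, integral_zero_measure]
      positivity
    · rw [div_mul_eq_mul_div, le_div_iff₀ hμ]
      have h1 : ∫ x in A \ Iio (s + 1), g x ∂S.m ≤ ∫ x, g x ∂S.m :=
        setIntegral_le_integral hgi (Eventually.of_forall hg0)
      have h2 : S.m.real (Ioo s (s + 1)) ≤ S.m.real A := by
        refine measureReal_mono fun x hx => mem_slab.2 ?_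
        have hx0 := hs.pos.trans hx.1
        exact ⟨hx0, ha.trans (ENNReal.ofReal_le_ofReal hx.1.le),
          (ENNReal.ofReal_le_ofReal hx.2.le).trans_lt h⟩
      gcongr

lemma pos_sub_pos_le {L t t' : ℝ} (ht : |t| ≤ L) (ht' : |t'| ≤ L) (s : ℝ) :
    S.pos t' s - S.pos t s ≤ |t' - t| * (|S.u s| + |S.κ| * S.total * L) := by
  have : S.pos t' s - S.pos t s = (t' - t) * (S.u s + S.κ * S.field s * ((t' + t) / 2)) := by
    unfold pos; ring
  rw [this]
  refine (le_abs_self _).trans ?_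
  rw [abs_mul]
  gcongr
  refine (abs_add_le _ _).trans ?_
  gcongr
  rw [abs_mul, abs_mul, abs_of_nonneg (S.field_nonneg s)]
  have hL : |(t' + t) / 2| ≤ L := by
    rw [abs_le] at *
    constructor <;> linarith
  have := S.field_le s
  have := S.total_nonneg
  gcongr

/-- Let `0 ≤ r' < S.traj t' s`. The slab from `S.ymax r' t'` to `S.ymax (S.traj t s) t` contains
mass just left of `s`; its mean position is at least `r'` at time `t'` and at most `S.traj t s` at
time `t`. The two means differ by at most the mean speed bound times `|t' - t|`. -/
lemma exists_traj_lipschitz {s : ℝ} (hs : Charged S.m s) (L : ℝ) (hL : 0 ≤ L) :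
    ∃ K : ℝ, 0 ≤ K ∧ ∀ t t', |t| ≤ L → |t'| ≤ L → S.traj t' s - S.traj t s ≤ K * |t' - t| := by
  have := S.total_nonneg
  have := S.cont
  obtain ⟨K, hK0, hK⟩ := exists_average_bound hs
    (g := fun x => |S.u x| + |S.κ| * S.total * L) (by fun_prop) (fun x => by positivity)
    (S.integrable.abs.add (integrable_const _))
  refine ⟨K, hK0, fun t t' ht ht' => ?_⟩
  rw [sub_le_iff_le_add']
  refine le_of_forall_lt fun r hr => ?_
  obtain ⟨r', hr1, hr2⟩ := exists_between hr
  refine hr1.trans_le ?_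
  rcases lt_or_ge r' 0 with hneg | hr'
  · have := traj_nonneg (S := S) t s
    have : 0 ≤ K * |t' - t| := by positivity
    linarith
  have ha : S.ymax r' t' < ENNReal.ofReal s :=
    not_le.1 fun h => not_le.2 hr2 ((traj_le_iff hr').2 h)
  have hb : ENNReal.ofReal s ≤ S.ymax (S.traj t s) t := le_ymax_traj t s
  set a := S.ymax r' t'
  set b := S.ymax (S.traj t s) t
  have hm := slab_pos_left hs ha hb
  have hbm : S.IsMin (S.traj t s) t b := isMin_ymax _ _
  have h1 := (isMin_ymax (S := S) r' t').integral_nonneg (ha.le.trans hb) hbm.1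
  have h2 := hbm.integral_nonpos (ha.le.trans hb)
  have hi : ∀ t, IntegrableOn (S.pos t) (below b \ below a) S.m :=
    fun t => (hbm.1.integrableOn_pos t).mono_set sdiff_subset
  have h3 : ∫ x in below b \ below a, S.pos t' x ∂S.m - ∫ x in below b \ below a, S.pos t x ∂S.m
      ≤ ∫ x in below b \ below a, |t' - t| * (|S.u x| + |S.κ| * S.total * L) ∂S.m := by
    rw [← integral_sub (hi t') (hi t)]
    refine setIntegral_mono ((hi t').sub (hi t)) ?_ fun x => pos_sub_pos_le ht ht' x
    exact ((S.integrable.abs.add (integrable_const _)).const_mul _).integrableOn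
  rw [integral_const_mul] at h3
  have h4 := mul_le_mul_of_nonneg_left (hK a b ha.le hb) (abs_nonneg (t' - t))
  have : r' * S.m.real (below b \ below a)
      ≤ (S.traj t s + K * |t' - t|) * S.m.real (below b \ below a) := by
    change r' * S.m.real (below b \ below a) ≤ _ at h1
    linarith
  exact le_of_mul_le_mul_right this hm

lemma exists_traj_lipschitzOnWith {s : ℝ} (hs : Charged S.m s) (L : ℝ) :
    ∃ K, LipschitzOnWith K (fun t => S.traj t s) (Icc (-L) L) := by
  rcases lt_or_ge L 0 with hL | hL
  · exact ⟨0, by simp [Icc_eq_empty_of_lt (show L < -L by linarith)]⟩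
  obtain ⟨K, hK0, hK⟩ := exists_traj_lipschitz hs L hL
  refine ⟨K.toNNReal, LipschitzOnWith.of_dist_le_mul fun t ht t' ht' => ?_⟩
  have h1 := hK t t' (abs_le.2 ht) (abs_le.2 ht')
  have h2 := hK t' t (abs_le.2 ht') (abs_le.2 ht)
  rw [abs_sub_comm] at h1
  rw [Real.dist_eq, Real.dist_eq, abs_le, Real.coe_toNNReal K hK0]
  constructor <;> linarith

lemma continuous_traj {s : ℝ} (hs : Charged S.m s) : Continuous fun t => S.traj t s := by
  rw [continuous_iff_continuousAt]
  intro t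
  obtain ⟨K, hK⟩ := exists_traj_lipschitzOnWith hs (|t| + 1)
  refine hK.continuousOn.continuousAt (Icc_mem_nhds ?_ ?_)
  · linarith [neg_abs_le t]
  · linarith [le_abs_self t]

end RadialData


/-! ### One-dimensional differentiation -/

lemma ae_differentiableAt_of_locally_lipschitz {f : ℝ → ℝ}
    (h : ∀ L : ℝ, ∃ K, LipschitzOnWith K f (Icc (-L) L)) : ∀ᵐ t, DifferentiableAt ℝ f t := by
  have h1 : ∀ N : ℕ, ∀ᵐ t, t ∈ Icc (-(N : ℝ)) N → DifferentiableWithinAt ℝ f (Icc (-(N : ℝ)) N) t :=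
    fun N => (h N).choose_spec.ae_differentiableWithinAt_of_mem_real
  filter_upwards [ae_all_iff.2 h1] with t ht
  obtain ⟨N, hN⟩ := exists_nat_gt |t|
  obtain ⟨h2, h3⟩ := abs_lt.1 hN
  exact (ht N ⟨h2.le, h3.le⟩).differentiableAt (Icc_mem_nhds h2 h3)

/-- Two functions have the same derivative at almost every point where they agree. -/
lemma ae_hasDerivAt_eq_of_eq (f g : ℝ → ℝ) :
    ∀ᵐ t, f t = g t → ∀ f' g', HasDerivAt f f' t → HasDerivAt g g' t → f' = g' := by
  -- Only countably many points of the coincidence set are isolated from the right within it. At the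
  -- others it accumulates, so the derivative within it is unique.
  have hc := (countable_setOfPred_isolated_right_within (s := {t | f t = g t})).ae_notMem volume
  filter_upwards [hc] with t ht hfg f' g' hf hg
  have hne : (𝓝[{t | f t = g t} ∩ Ioi t] t).NeBot := ⟨fun h => ht ⟨hfg, h⟩⟩
  have hacc : AccPt t (𝓟 {t | f t = g t}) := by
    rw [accPt_principal_iff_nhdsWithin]
    exact hne.mono (nhdsWithin_mono _ fun x hx => ⟨hx.1, (mem_Ioi.1 hx.2).ne'⟩)
  have hu : UniqueDiffWithinAt ℝ {t | f t = g t} t := uniqueDiffWithinAt_iff_accPt.2 hacc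
  exact hu.eq_deriv _ hf.hasDerivWithinAt
    (hg.hasDerivWithinAt.congr (fun x hx => hx) hfg)

namespace RadialData

variable {S : RadialData}

/-! ### The velocity field -/

variable (S) in
/-- The free momentum of `(0, y)` at time `t`. -/
def mom (t : ℝ) (y : ℝ≥0∞) : ℝ := S.cum (S.vel t) y

lemma mom_eq (t : ℝ) (y : ℝ≥0∞) : S.mom t y = S.cum S.u y + S.κ * t * S.cum S.field y := by
  unfold mom cum vel
  rw [integral_add S.integrable.integrableOn
    ((S.integrable_field.const_mul S.κ).mul_const t).integrableOn, ← integral_const_mul]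
  congr 2 with s; ring

variable (S) in
lemma continuous_mom : Continuous fun p : ℝ × ℝ≥0∞ => S.mom p.1 p.2 := by
  have h1 := S.continuous_cum S.integrable
  have h2 := S.continuous_cum S.integrable_field
  simp only [mom_eq]
  fun_prop

lemma mom_sub_mom {a b : ℝ≥0∞} (hab : a ≤ b) (t : ℝ) :
    S.mom t b - S.mom t a = ∫ s in below b \ below a, S.vel t s ∂S.m :=
  S.cum_sub_cum hab (S.integrable_vel t).integrableOn

variable (S) in
/-- The velocity at time `t` and radius `r`. -/
def speed (t r : ℝ) : ℝ :=
  if 0 < r then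
    if S.mass (S.ymin r t) < S.mass (S.ymax r t) then
      (S.mom t (S.ymax r t) - S.mom t (S.ymin r t))
        / (S.mass (S.ymax r t) - S.mass (S.ymin r t))
    -- If `S.ymax r t = ⊤` this is a junk value. On positive radii `r = S.traj t s` with `s`
    -- charged, this branch has `S.ymax r t = ENNReal.ofReal s`.
    else S.vel t (S.ymax r t).toReal
  else 0

variable (S) in
lemma measurable_speed : Measurable fun p : ℝ × ℝ => S.speed p.1 p.2 := by
  have hmax : Measurable fun p : ℝ × ℝ => S.ymax p.2 p.1 :=
    S.measurable_ymax.comp (f := fun p : ℝ × ℝ => (p.2, p.1)) (by fun_prop)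
  have hmin : Measurable fun p : ℝ × ℝ => S.ymin p.2 p.1 :=
    S.measurable_ymin.comp (f := fun p : ℝ × ℝ => (p.2, p.1)) (by fun_prop)
  have h1 : Measurable fun p : ℝ × ℝ => S.mass (S.ymax p.2 p.1) :=
    S.continuous_mass.measurable.comp (f := fun p : ℝ × ℝ => S.ymax p.2 p.1) hmax
  have h2 : Measurable fun p : ℝ × ℝ => S.mass (S.ymin p.2 p.1) :=
    S.continuous_mass.measurable.comp (f := fun p : ℝ × ℝ => S.ymin p.2 p.1) hmin
  have h3 : Measurable fun p : ℝ × ℝ => S.mom p.1 (S.ymax p.2 p.1) :=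
    S.continuous_mom.measurable.comp (f := fun p : ℝ × ℝ => (p.1, S.ymax p.2 p.1))
      (measurable_fst.prodMk hmax)
  have h4 : Measurable fun p : ℝ × ℝ => S.mom p.1 (S.ymin p.2 p.1) :=
    S.continuous_mom.measurable.comp (f := fun p : ℝ × ℝ => (p.1, S.ymin p.2 p.1))
      (measurable_fst.prodMk hmin)
  have h5 : Measurable fun p : ℝ × ℝ => S.vel p.1 (S.ymax p.2 p.1).toReal :=
    S.continuous_vel.measurable.comp (f := fun p : ℝ × ℝ => (p.1, (S.ymax p.2 p.1).toReal))
      (measurable_fst.prodMk hmax.ennreal_toReal)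
  unfold speed
  refine Measurable.ite (measurableSet_lt measurable_const measurable_snd) ?_ measurable_const
  exact Measurable.ite (measurableSet_lt h2 h1) ((h3.sub h4).div (h1.sub h2)) h5

lemma speed_of_nonpos {t r : ℝ} (hr : r ≤ 0) : S.speed t r = 0 := by
  simp [speed, not_lt.2 hr]

lemma mass_lt_of_slab_pos {a b : ℝ≥0∞} (hab : a ≤ b) (h : 0 < S.m.real (below b \ below a)) :
    S.mass a < S.mass b := by
  rw [← S.mass_sub_mass hab] at h
  linarith

/-- If the particles starting at `s` have not merged with others, then they are free. -/
lemma free_of_not_mass_lt {t s : ℝ} (hs : Charged S.m s) (hr : 0 < S.traj t s)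
    (h : ¬ S.mass (S.ymin (S.traj t s) t) < S.mass (S.ymax (S.traj t s) t)) :
    S.ymin (S.traj t s) t = ENNReal.ofReal s ∧ S.ymax (S.traj t s) t = ENNReal.ofReal s ∧
      S.pos t s = S.traj t s := by
  have h1 : S.ymin (S.traj t s) t = ENNReal.ofReal s := by
    refine (ymin_traj_le hr).antisymm (not_lt.1 fun hlt => h ?_)
    exact mass_lt_of_slab_pos (ymin_le_ymax _ _) (slab_pos_left hs hlt (le_ymax_traj t s))
  have h2 : S.ymax (S.traj t s) t = ENNReal.ofReal s := by
    refine le_antisymm (not_lt.1 fun hlt => h ?_) (le_ymax_traj t s)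
    exact mass_lt_of_slab_pos (ymin_le_ymax _ _) (slab_pos_right hs (ymin_traj_le hr) hlt)
  exact ⟨h1, h2, (h2 ▸ isMin_ymax _ _ : S.IsMin (S.traj t s) t (ENNReal.ofReal s)).pos_eq hs⟩

lemma speed_of_not_mass_lt {t s : ℝ} (hs : Charged S.m s) (hr : 0 < S.traj t s)
    (h : ¬ S.mass (S.ymin (S.traj t s) t) < S.mass (S.ymax (S.traj t s) t)) :
    S.speed t (S.traj t s) = S.vel t s := by
  rw [speed, if_pos hr, if_neg h, (free_of_not_mass_lt hs hr h).2.1, ENNReal.toReal_ofReal hs.pos.le]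

/-- One-sided bound on the velocity. -/
lemma speed_le {t s : ℝ} (hs : Charged S.m s) (ht : 0 < t) :
    S.speed t (S.traj t s) ≤ (S.traj t s + 1 / 2 * |S.κ| * S.total * t ^ 2) / t := by
  have htot := S.total_nonneg
  -- The identity `t * vel = pos - x + ½ κ field t²` loses the favourable term `-x`. For a merged
  -- slab it is averaged, and minimality bounds the mean position by the radius.
  have hkey : ∀ x, 0 ≤ x →
      t * S.vel t x ≤ S.pos t x + 1 / 2 * |S.κ| * S.total * t ^ 2 := by
    intro x hx
    have h1 : t * S.vel t x = S.pos t x - x + 1 / 2 * (S.κ * S.field x) * t ^ 2 := by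
      unfold vel pos; ring
    have h2 : S.κ * S.field x ≤ |S.κ| * S.total :=
      (mul_le_mul_of_nonneg_right (le_abs_self _) (S.field_nonneg x)).trans
        (mul_le_mul_of_nonneg_left (S.field_le x) (abs_nonneg _))
    have h3 : 1 / 2 * (S.κ * S.field x) * t ^ 2 ≤ 1 / 2 * (|S.κ| * S.total) * t ^ 2 := by gcongr
    rw [h1]
    linarith
  rw [le_div_iff₀ ht, mul_comm]
  rcases (traj_nonneg (S := S) t s).eq_or_lt with h0 | hr
  · rw [← h0, speed_of_nonpos le_rfl, mul_zero, zero_add]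
    positivity
  by_cases h : S.mass (S.ymin (S.traj t s) t) < S.mass (S.ymax (S.traj t s) t)
  · rw [speed, if_pos hr, if_pos h, ← mul_div_assoc, div_le_iff₀ (by linarith)]
    set r := S.traj t s
    have hle := ymin_le_ymax (S := S) r t
    have hmax := isMin_ymax (S := S) r t
    rw [mom_sub_mom hle, S.mass_sub_mass hle, add_mul]
    have h1 := hmax.integral_nonpos hle
    have hi : IntegrableOn (S.pos t) (below (S.ymax r t) \ below (S.ymin r t)) S.m :=
      (hmax.1.integrableOn_pos t).mono_set sdiff_subset
    have h2 : t * ∫ x in below (S.ymax r t) \ below (S.ymin r t), S.vel t x ∂S.m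
        ≤ ∫ x in below (S.ymax r t) \ below (S.ymin r t),
          (S.pos t x + 1 / 2 * |S.κ| * S.total * t ^ 2) ∂S.m := by
      rw [← integral_const_mul]
      refine setIntegral_mono_on ((S.integrable_vel t).const_mul t).integrableOn
        (hi.add (integrable_const _)) (measurableSet_slab _ _) fun x hx => ?_
      exact hkey x (mem_slab.1 hx).1.le
    rw [integral_add hi (integrable_const _)] at h2
    simp only [integral_const, measureReal_restrict_apply_univ, smul_eq_mul] at h2
    linarith
  · rw [speed_of_not_mass_lt hs hr h, ← (free_of_not_mass_lt hs hr h).2.2]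
    exact hkey s hs.pos.le

/-! ### Differentiation along trajectories -/

lemma hasDerivAt_pos (t s : ℝ) : HasDerivAt (fun τ => S.pos τ s) (S.vel t s) t := by
  unfold pos vel
  have h1 : HasDerivAt (fun τ : ℝ => τ * S.u s) (1 * S.u s) t := (hasDerivAt_id t).mul_const _
  have h2 := (hasDerivAt_pow 2 t).const_mul (1 / 2 * S.κ * S.field s)
  convert! (h1.const_add s).add h2 using 1
  norm_num
  ring

lemma hasDerivAt_act {y : ℝ≥0∞} (hy : S.Admissible y) {x : ℝ → ℝ} {x' t : ℝ}
    (hx : HasDerivAt x x' t) :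
    HasDerivAt (fun τ => S.act (x τ) τ y) (S.mom t y - x' * S.mass y) t := by
  simp only [act_eq hy, actRest]
  have h1 : HasDerivAt (fun τ : ℝ => τ * S.cum S.u y) (1 * S.cum S.u y) t :=
    (hasDerivAt_id t).mul_const _
  have h2 := ((hasDerivAt_pow 2 t).const_mul (1 / 2 * S.κ)).mul_const (S.cum S.field y)
  convert! ((h1.add h2).sub (hx.mul_const (S.mass y))).const_add (S.cum (fun s => s) y) using 1
  rw [mom_eq]
  simp only [Nat.cast_ofNat]
  ring

variable (S) in
/-- The minimal action. -/
def minAct (r t : ℝ) : ℝ := S.act r t (S.ymax r t)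

lemma minAct_le {y : ℝ≥0∞} (hy : S.Admissible y) (r t : ℝ) : S.minAct r t ≤ S.act r t y :=
  (isMin_ymax r t).2 y hy

lemma IsMin.act_eq_minAct {r t : ℝ} {y : ℝ≥0∞} (hy : S.IsMin r t y) :
    S.act r t y = S.minAct r t :=
  le_antisymm (hy.2 _ (isMin_ymax r t).1) (minAct_le hy.1 r t)

lemma abs_cum_le {f : ℝ → ℝ} (hf : Integrable f S.m) (y : ℝ≥0∞) :
    |S.cum f y| ≤ ∫ s, |f s| ∂S.m :=
  (norm_integral_le_integral_norm (f := f)).trans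
    (setIntegral_le_integral hf.norm (Eventually.of_forall fun _ => norm_nonneg _))

/-- The minimizer for `(r', t')` is used as a competitor for `(r, t)`. The first moment, the only
term without a bound uniform in `y`, cancels in the difference. -/
lemma minAct_sub_le {L t t' : ℝ} (ht : |t| ≤ L) (ht' : |t'| ≤ L) (r r' : ℝ) :
    S.minAct r t - S.minAct r' t' ≤
      (∫ s, |S.u s| ∂S.m + |S.κ| * L * ∫ s, |S.field s| ∂S.m) * |t - t'|
        + S.total * |r - r'| := by
  set y := S.ymax r' t'
  have hy : S.Admissible y := (isMin_ymax r' t').1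
  have h1 : S.minAct r t - S.minAct r' t' ≤ S.act r t y - S.act r' t' y :=
    sub_le_sub_right (minAct_le hy r t) _
  refine h1.trans ?_
  have h2 : S.act r t y - S.act r' t' y = (t - t') * S.cum S.u y
      + (S.κ * ((t + t') / 2)) * (t - t') * S.cum S.field y - (r - r') * S.mass y := by
    rw [act_eq hy, act_eq hy]; unfold actRest; ring
  have hL : |(t + t') / 2| ≤ L := by
    rw [abs_le] at *
    constructor <;> linarith
  have h3 : (t - t') * S.cum S.u y ≤ |t - t'| * ∫ s, |S.u s| ∂S.m := by
    refine (le_abs_self _).trans ?_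
    rw [abs_mul]
    exact mul_le_mul_of_nonneg_left (abs_cum_le S.integrable y) (abs_nonneg _)
  have h4 : (S.κ * ((t + t') / 2)) * (t - t') * S.cum S.field y
      ≤ (|S.κ| * L) * |t - t'| * ∫ s, |S.field s| ∂S.m := by
    refine (le_abs_self _).trans ?_
    rw [abs_mul, abs_mul, abs_mul]
    have h0 := abs_cum_le S.integrable_field y
    have hL0 : 0 ≤ L := (abs_nonneg _).trans hL
    have h1 : |S.κ| * |(t + t') / 2| * |t - t'| ≤ |S.κ| * L * |t - t'| := by gcongr
    exact mul_le_mul h1 h0 (abs_nonneg _) (by positivity)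
  have h5 : -((r - r') * S.mass y) ≤ |r - r'| * S.total := by
    refine (neg_le_abs _).trans ?_
    rw [abs_mul, abs_of_nonneg (S.mass_nonneg y)]
    exact mul_le_mul_of_nonneg_left (S.mass_le y) (abs_nonneg _)
  rw [h2]
  linarith

lemma exists_minAct_lipschitzOnWith {x : ℝ → ℝ} {L : ℝ} {K : NNReal}
    (hx : LipschitzOnWith K x (Icc (-L) L)) :
    ∃ K', LipschitzOnWith K' (fun t => S.minAct (x t) t) (Icc (-L) L) := by
  rcases lt_or_ge L 0 with hL | hL
  · exact ⟨0, by simp [Icc_eq_empty_of_lt (show L < -L by linarith)]⟩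
  set C := ∫ s, |S.u s| ∂S.m + |S.κ| * L * ∫ s, |S.field s| ∂S.m with hC
  have hC0 : 0 ≤ C := by
    have h1 : 0 ≤ ∫ s, |S.u s| ∂S.m := integral_nonneg fun _ => abs_nonneg _
    have h2 : 0 ≤ ∫ s, |S.field s| ∂S.m := integral_nonneg fun _ => abs_nonneg _
    positivity
  have htot := S.total_nonneg
  have key : ∀ t ∈ Icc (-L) L, ∀ t' ∈ Icc (-L) L,
      S.minAct (x t) t - S.minAct (x t') t' ≤ (C + S.total * K) * |t - t'| := by
    intro t ht t' ht'
    have h1 := minAct_sub_le (S := S) (abs_le.2 ht) (abs_le.2 ht') (x t) (x t')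
    have h2 := hx.dist_le_mul t ht t' ht'
    rw [Real.dist_eq, Real.dist_eq] at h2
    have h3 := mul_le_mul_of_nonneg_left h2 htot
    linarith
  refine ⟨(C + S.total * K).toNNReal, LipschitzOnWith.of_dist_le_mul fun t ht t' ht' => ?_⟩
  rw [Real.dist_eq, Real.dist_eq, abs_le, Real.coe_toNNReal _ (by positivity)]
  have h1 := key t ht t' ht'
  have h2 := key t' ht' t ht
  rw [abs_sub_comm] at h2
  constructor <;> linarith

/-- The particles move with the velocity field. -/
theorem ae_hasDerivAt_traj {s : ℝ} (hs : Charged S.m s) :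
    ∀ᵐ t, HasDerivAt (fun τ => S.traj τ s) (S.speed t (S.traj t s)) t := by
  have hlip := exists_traj_lipschitzOnWith (S := S) hs
  have hd1 := ae_differentiableAt_of_locally_lipschitz hlip
  have hd2 := ae_differentiableAt_of_locally_lipschitz
    (f := fun t => S.minAct (S.traj t s) t) fun L =>
      exists_minAct_lipschitzOnWith (hlip L).choose_spec
  filter_upwards [hd1, hd2, ae_hasDerivAt_eq_of_eq (fun τ => S.traj τ s) (fun τ => S.pos τ s)]
    with t h1 h2 h3
  obtain ⟨x', hx⟩ : ∃ x', HasDerivAt (fun τ => S.traj τ s) x' t := ⟨_, h1.hasDerivAt⟩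
  obtain ⟨v', hv⟩ : ∃ v', HasDerivAt (fun t => S.minAct (S.traj t s) t) v' t := ⟨_, h2.hasDerivAt⟩
  suffices x' = S.speed t (S.traj t s) by rwa [← this]
  rcases (traj_nonneg (S := S) t s).eq_or_lt with h0 | hr
  · rw [← h0, speed_of_nonpos le_rfl]
    -- Trajectories are nonnegative, so a time spent at the origin is a minimum of the trajectory.
    refine IsLocalMin.hasDerivAt_eq_zero (Eventually.of_forall fun τ => ?_) hx
    rw [← h0]
    exact traj_nonneg τ s
  by_cases h : S.mass (S.ymin (S.traj t s) t) < S.mass (S.ymax (S.traj t s) t)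
  -- Envelope argument: along the trajectory the action of `y` minus the minimal action is
  -- nonnegative and vanishes at time `t`, so its derivative is zero. Subtracting the identities for
  -- the two extreme minimizers solves for `x'`.
  · have key : ∀ y, S.IsMin (S.traj t s) t y → S.mom t y - x' * S.mass y = v' := by
      intro y hy
      have hd := (hasDerivAt_act hy.1 hx).sub hv
      refine sub_eq_zero.1 (IsLocalMin.hasDerivAt_eq_zero (Eventually.of_forall fun τ => ?_) hd)
      simp only [Pi.sub_apply]
      rw [hy.act_eq_minAct, sub_self, sub_nonneg]
      exact minAct_le hy.1 _ _
    have k1 := key _ (isMin_ymax _ _)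
    have k2 := key _ (isMin_ymin _ _)
    rw [speed, if_pos hr, if_pos h, eq_div_iff (by linarith)]
    linarith
  · rw [speed_of_not_mass_lt hs hr h]
    -- An unmerged particle is known to sit on its free path only at the time `t` itself; equality
    -- of the derivatives holds for almost every such time.
    exact h3 (free_of_not_mass_lt hs hr h).2.2.symm _ _ hx (hasDerivAt_pos t s)

end RadialData


/-! ### Averaging over the fibres of a real function -/

section FibreAverage

variable {m : Measure ℝ} [IsFiniteMeasure m] {T f w k : ℝ → ℝ}

/-- The σ-algebra generated by `T`. -/
abbrev fibres (T : ℝ → ℝ) : MeasurableSpace ℝ := MeasurableSpace.comap T Real.measurableSpace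

/-- `w ∘ T` averages `f` over each fibre of `T` of positive measure, and equals `f` almost
everywhere on the fibres of measure zero. -/
structure IsFibreAverage (m : Measure ℝ) (T f w : ℝ → ℝ) : Prop where
  measurable_map : Measurable T
  measurable : Measurable w
  integrable : Integrable f m
  null : ∀ᵐ s ∂m, m (T ⁻¹' {T s}) = 0 → w (T s) = f s
  atom : ∀ r, m (T ⁻¹' {r}) ≠ 0 → ∫ s in T ⁻¹' {r}, f s ∂m = w r * m.real (T ⁻¹' {r})

/-- At most countably many fibres carry mass, so the union `N` of the null fibres is measurable for
the σ-algebra of `T`. On `N`, `f` agrees almost everywhere with a function of `T` and is its own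
conditional expectation. On a fibre with mass the conditional expectation is constant, and its
integral determines the constant. -/
lemma IsFibreAverage.ae_eq_condExp (h : IsFibreAverage m T f w) :
    (fun s => w (T s)) =ᵐ[m] m[f | fibres T] := by
  have hle : fibres T ≤ Real.measurableSpace := h.measurable_map.comap_le
  have hwT : Measurable[fibres T] fun s => w (T s) := h.measurable.comp (comap_measurable T)
  have hAc : {r | 0 < m (T ⁻¹' {r})}.Countable :=
    Measure.countable_meas_level_set_pos h.measurable_map
  set N : Set ℝ := T ⁻¹' {r | 0 < m (T ⁻¹' {r})}ᶜ with hN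
  have hNm : MeasurableSet[fibres T] N := ⟨_, hAc.measurableSet.compl, rfl⟩
  have hind : N.indicator f =ᵐ[m] N.indicator fun s => w (T s) := by
    filter_upwards [h.null] with s hs
    by_cases hsN : s ∈ N
    · rw [indicator_of_mem hsN, indicator_of_mem hsN, hs]
      simpa [hN] using hsN
    · rw [indicator_of_notMem hsN, indicator_of_notMem hsN]
  have h1 := condExp_indicator (m := fibres T) h.integrable hNm
  have h2 : m[N.indicator f | fibres T] =ᵐ[m] N.indicator fun s => w (T s) := by
    refine (condExp_congr_ae hind).trans ?_
    rw [condExp_of_stronglyMeasurable hle]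
    · exact ((hwT.indicator hNm).stronglyMeasurable)
    · exact (h.integrable.indicator (hle _ hNm)).congr hind
  have hfac : (m[f | fibres T]).FactorsThrough T := stronglyMeasurable_condExp.factorsThrough
  filter_upwards [h1, h2] with s hs1 hs2
  by_cases hsN : s ∈ N
  · rw [hs1, indicator_of_mem hsN, indicator_of_mem hsN] at hs2
    exact hs2.symm
  · have hpos : m (T ⁻¹' {T s}) ≠ 0 := by simpa [hN] using hsN
    have hms : MeasurableSet[fibres T] (T ⁻¹' {T s}) := ⟨_, measurableSet_singleton _, rfl⟩
    have h3 := setIntegral_condExp hle h.integrable hms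
    rw [h.atom _ hpos, setIntegral_congr_fun (g := fun _ => (m[f | fibres T]) s) (hle _ hms)
      (fun x hx => hfac hx)] at h3
    simp only [integral_const, measureReal_restrict_apply_univ, smul_eq_mul] at h3
    rw [mul_comm] at h3
    exact (mul_right_cancel₀ (ENNReal.toReal_ne_zero.2 ⟨hpos, measure_ne_top _ _⟩) h3).symm

lemma IsFibreAverage.integrable_comp (h : IsFibreAverage m T f w) :
    Integrable (fun s => w (T s)) m :=
  integrable_condExp.congr h.ae_eq_condExp.symm

lemma IsFibreAverage.integral_abs_le (h : IsFibreAverage m T f w) :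
    ∫ s, |w (T s)| ∂m ≤ ∫ s, |f s| ∂m := by
  refine le_of_eq_of_le (integral_congr_ae ?_)
    (integral_abs_condExp_le (m := fibres T) f)
  filter_upwards [h.ae_eq_condExp] with s hs
  rw [hs]

lemma IsFibreAverage.mul_ae_eq_condExp (h : IsFibreAverage m T f w) (hk : Measurable k)
    (hkf : Integrable (fun s => k (T s) * f s) m) :
    (fun s => k (T s) * w (T s)) =ᵐ[m]
      m[fun s => k (T s) * f s | fibres T] := by
  have hkT : Measurable[fibres T] fun s => k (T s) :=
    hk.comp (comap_measurable T)
  refine EventuallyEq.trans ?_ (condExp_mul_of_stronglyMeasurable_left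
    (m := fibres T) (f := fun s => k (T s)) (g := f)
    hkT.stronglyMeasurable hkf h.integrable).symm
  filter_upwards [h.ae_eq_condExp] with s hs
  rw [hs]
  rfl

lemma IsFibreAverage.integrable_mul (h : IsFibreAverage m T f w) (hk : Measurable k)
    (hkf : Integrable (fun s => k (T s) * f s) m) : Integrable (fun s => k (T s) * w (T s)) m :=
  integrable_condExp.congr (h.mul_ae_eq_condExp hk hkf).symm

/-- Quantities of single particles may be replaced by fields when tested against functions of the
position. Integrability of the product is enough; `k` may be unbounded, and this is used with `k`
containing the speed. -/
lemma IsFibreAverage.integral_mul (h : IsFibreAverage m T f w) (hk : Measurable k)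
    (hkf : Integrable (fun s => k (T s) * f s) m) :
    ∫ s, k (T s) * w (T s) ∂m = ∫ s, k (T s) * f s ∂m := by
  rw [integral_congr_ae (h.mul_ae_eq_condExp hk hkf),
    integral_condExp h.measurable_map.comap_le]

end FibreAverage

namespace RadialData

variable {S : RadialData}

/-! ### The mass distribution at time `t` -/

lemma ae_ofReal_ne (y : ℝ≥0∞) : ∀ᵐ s ∂S.m, ENNReal.ofReal s ≠ y := by
  have : ∀ᵐ s ∂S.m, s ≠ y.toReal := by
    simp [ae_iff]
  filter_upwards [this, S.ae_pos] with s h1 h2 h3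
  exact h1 (by rw [← h3, ENNReal.toReal_ofReal h2.le])

lemma traj_preimage_Iic {r : ℝ} (hr : 0 ≤ r) (t : ℝ) :
    S.traj t ⁻¹' Iic r =ᵐ[S.m] below (S.ymax r t) := by
  filter_upwards [ae_ofReal_ne (S.ymax r t), S.ae_pos] with s h1 h2
  refine propext ?_
  change S.traj t s ≤ r ↔ s ∈ below (S.ymax r t)
  rw [traj_le_iff hr]
  exact ⟨fun h => ⟨h2, h.lt_of_ne h1⟩, fun h => h.2.le⟩

lemma traj_preimage_singleton {r : ℝ} (hr : 0 < r) (t : ℝ) :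
    S.traj t ⁻¹' {r} =ᵐ[S.m] (below (S.ymax r t) \ below (S.ymin r t) : Set ℝ) := by
  filter_upwards [ae_ofReal_ne (S.ymax r t), ae_ofReal_ne (S.ymin r t), S.ae_charged] with s h1 h2 hs
  refine propext ?_
  change S.traj t s = r ↔ s ∈ below (S.ymax r t) \ below (S.ymin r t)
  rw [mem_slab]
  constructor
  · rintro rfl
    exact ⟨hs.pos, ymin_traj_le hr, (le_ymax_traj t s).lt_of_ne h1⟩
  · rintro ⟨-, h3, h4⟩
    refine le_antisymm ((traj_le_iff hr.le).2 h4.le) (not_lt.1 fun hlt => ?_)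
    -- If the particle were at a radius below `r`, the slab from `S.ymin r t` to `S.ymax (S.traj t
    -- s) t` would have positive mass and a mean position at least `r` but at most `S.traj t s`.
    have h5 : ENNReal.ofReal s ≤ S.ymax (S.traj t s) t := le_ymax_traj t s
    have h6 := slab_pos_left hs (h3.lt_of_ne h2.symm) h5
    have h7 := isMin_ymax (S := S) (S.traj t s) t
    have h8 := h7.integral_nonpos (h3.trans h5)
    have h9 := (isMin_ymin (S := S) r t).integral_nonneg (h3.trans h5) h7.1
    exact not_le.2 hlt (le_of_mul_le_mul_right (h9.trans h8) h6)

variable (S) in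
/-- The radial mass distribution at time `t`. -/
def dist (t : ℝ) : Measure ℝ := S.m.map (S.traj t)

instance (t : ℝ) : IsFiniteMeasure (S.dist t) := by
  unfold dist; infer_instance

lemma dist_Iic {r : ℝ} (hr : 0 ≤ r) (t : ℝ) : (S.dist t).real (Iic r) = S.mass (S.ymax r t) := by
  rw [dist, map_measureReal_apply (S.measurable_traj_right t) measurableSet_Iic,
    measureReal_congr (traj_preimage_Iic hr t)]
  rfl

lemma dist_Iio_zero (t : ℝ) : S.dist t (Iio 0) = 0 := by
  rw [dist, Measure.map_apply (S.measurable_traj_right t) measurableSet_Iio]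
  convert measure_empty (μ := S.m)
  ext s
  simp [traj_nonneg]

lemma real_preimage_singleton {r : ℝ} (hr : 0 < r) (t : ℝ) :
    S.m.real (S.traj t ⁻¹' {r}) = S.mass (S.ymax r t) - S.mass (S.ymin r t) := by
  rw [S.mass_sub_mass (ymin_le_ymax r t), measureReal_congr (traj_preimage_singleton hr t)]

lemma preimage_singleton_ne_zero_iff {r : ℝ} (hr : 0 < r) (t : ℝ) :
    S.m (S.traj t ⁻¹' {r}) ≠ 0 ↔ S.mass (S.ymin r t) < S.mass (S.ymax r t) := by
  rw [← sub_pos, ← real_preimage_singleton hr, Measure.real, ENNReal.toReal_pos_iff, pos_iff_ne_zero]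
  simp [measure_lt_top]

lemma dist_Iio {r : ℝ} (hr : 0 < r) (t : ℝ) : (S.dist t).real (Iio r) = S.mass (S.ymin r t) := by
  have h1 : (S.dist t).real (Iic r) = (S.dist t).real (Iio r) + (S.dist t).real {r} := by
    rw [← measureReal_union (by simp) (measurableSet_singleton r), Iio_union_right]
  have h2 : (S.dist t).real {r} = S.mass (S.ymax r t) - S.mass (S.ymin r t) := by
    rw [dist, map_measureReal_apply (S.measurable_traj_right t) (measurableSet_singleton r),
      real_preimage_singleton hr]
  rw [dist_Iic hr.le] at h1
  linarith

lemma setIntegral_traj_pos (f : ℝ → ℝ) {t : ℝ} {A : Set ℝ} (hA : MeasurableSet A)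
    (h : A ⊆ {s | 0 < S.traj t s}) :
    ∫ s in A, {s | 0 < S.traj t s}.indicator f s ∂S.m = ∫ s in A, f s ∂S.m :=
  setIntegral_congr_fun hA fun _ hs => indicator_of_mem (h hs) f

lemma measurableSet_traj_pos (t : ℝ) : MeasurableSet {s | 0 < S.traj t s} :=
  measurableSet_lt measurable_const (S.measurable_traj_right t)

/-- A fibre average on the part of the half-line which is not at the origin. -/
lemma isFibreAverage_of_pos {t : ℝ} {f w : ℝ → ℝ} (hf : Integrable f S.m) (hw : Measurable w)
    (h0 : w 0 = 0)
    (hnull : ∀ s, Charged S.m s → 0 < S.traj t s →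
      ¬ S.mass (S.ymin (S.traj t s) t) < S.mass (S.ymax (S.traj t s) t) → w (S.traj t s) = f s)
    (hatom : ∀ r, 0 < r → S.mass (S.ymin r t) < S.mass (S.ymax r t) →
      S.cum f (S.ymax r t) - S.cum f (S.ymin r t)
        = w r * (S.mass (S.ymax r t) - S.mass (S.ymin r t))) :
    IsFibreAverage S.m (S.traj t) ({s | 0 < S.traj t s}.indicator f) w where
  measurable_map := S.measurable_traj_right t
  measurable := hw
  integrable := hf.indicator (measurableSet_traj_pos t)
  null := by
    filter_upwards [S.ae_charged] with s hs h
    rcases (traj_nonneg (S := S) t s).eq_or_lt with h1 | h1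
    · rw [← h1, h0, indicator_of_notMem]
      simp [← h1]
    · rw [indicator_of_mem (show s ∈ {s | 0 < S.traj t s} from h1)]
      refine hnull s hs h1 fun hlt => ?_
      exact (preimage_singleton_ne_zero_iff h1 t).2 hlt h
  atom := by
    intro r hr
    have hms : MeasurableSet (S.traj t ⁻¹' {r}) :=
      S.measurable_traj_right t (measurableSet_singleton r)
    rcases lt_trichotomy r 0 with h1 | rfl | h1
    · refine absurd ?_ hr
      convert measure_empty (μ := S.m)
      ext s
      simpa using (h1.trans_le (traj_nonneg t s)).ne'
    · rw [h0, zero_mul]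
      refine setIntegral_eq_zero_of_forall_eq_zero fun s hs => indicator_of_notMem ?_ _
      simp [show S.traj t s = 0 from hs]
    · have hlt := (preimage_singleton_ne_zero_iff h1 t).1 hr
      rw [setIntegral_traj_pos f hms (fun s hs => by
        rw [mem_ofPred_eq, show S.traj t s = r from hs]; exact h1),
        setIntegral_congr_set (traj_preimage_singleton h1 t), real_preimage_singleton h1,
        ← hatom r h1 hlt, S.cum_sub_cum (ymin_le_ymax r t) hf.integrableOn]

lemma isFibreAverage_speed (t : ℝ) :
    IsFibreAverage S.m (S.traj t) ({s | 0 < S.traj t s}.indicator (S.vel t)) (S.speed t) := by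
  refine isFibreAverage_of_pos (S.integrable_vel t) ?_ (speed_of_nonpos le_rfl)
    (fun s hs hr h => speed_of_not_mass_lt hs hr h) fun r hr h => ?_
  · have h : Measurable (Function.uncurry S.speed) := S.measurable_speed
    exact h.of_uncurry_left
  · rw [speed, if_pos hr, if_pos h, div_mul_cancel₀ _ (by linarith)]
    rfl

/-- The square of the mass is the product measure of a square. The two halves on either side of the
diagonal have equal measure by symmetry, and the diagonal is null since `m` has no atoms. -/
lemma two_mul_cum_field (y : ℝ≥0∞) : 2 * S.cum S.field y = S.mass y ^ 2 := by
  set ν := S.m.restrict (below y) with hν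
  have hν1 : ν univ = S.m (below y) := by simp [hν]
  have hms : MeasurableSet {p : ℝ × ℝ | p.2 ≤ p.1} := measurableSet_le measurable_snd measurable_fst
  have h1 := Measure.prod_apply (μ := ν) (ν := ν) hms
  have h2 := Measure.prod_apply_symm (μ := ν) (ν := ν) hms
  have e1 : ∀ x : ℝ, Prod.mk x ⁻¹' {p : ℝ × ℝ | p.2 ≤ p.1} = Iic x := fun x => by ext; simp
  have e2 : ∀ x : ℝ, (fun z => (z, x)) ⁻¹' {p : ℝ × ℝ | p.2 ≤ p.1} = Ici x := fun x => by ext; simp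
  simp only [e1, e2] at h1 h2
  have h3 : ∫⁻ x, ν (Iic x) ∂ν + ∫⁻ x, ν (Ici x) ∂ν = ν univ * ν univ := by
    rw [← lintegral_add_right _ (by
      have : Antitone fun x => ν (Ici x) := fun _ _ h => measure_mono (Ici_subset_Ici.2 h)
      exact this.measurable)]
    have : ∀ x, ν (Iic x) + ν (Ici x) = ν univ := by
      intro x
      rw [measure_congr (Ioi_ae_eq_Ici (μ := ν)).symm, ← measure_union (by simp) measurableSet_Ioi]
      simp
    simp [this]
  have h4 : 2 * ∫⁻ x, ν (Iic x) ∂ν = ν univ * ν univ := by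
    rw [← h3, two_mul, ← h1, h2]
  have h5 : S.cum S.field y = (∫⁻ x, ν (Iic x) ∂ν).toReal := by
    rw [cum, integral_eq_lintegral_of_nonneg_ae (Eventually.of_forall S.field_nonneg)
      S.measurable_field.aestronglyMeasurable]
    congr 1
    refine setLIntegral_congr_fun (measurableSet_below y) fun s hs => ?_
    simp only [field]
    rw [ofReal_measureReal, hν, Measure.restrict_apply measurableSet_Iic]
    refine measure_congr ?_
    filter_upwards [S.ae_pos] with x hx
    refine propext ⟨fun h => ⟨h, hx, ?_⟩, fun h => h.1⟩
    exact (ENNReal.ofReal_le_ofReal h).trans_lt hs.2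
  have h6 := congrArg ENNReal.toReal h4
  rw [ENNReal.toReal_mul, ENNReal.toReal_mul, ← h5, hν1] at h6
  simpa [pow_two, mass, Measure.real] using h6

variable (S) in
/-- The electric field away from the origin. -/
def elec (t r : ℝ) : ℝ := if 0 < r then electricField (S.dist t) r else 0

lemma elec_eq {r : ℝ} (hr : 0 < r) (t : ℝ) :
    S.elec t r = 1 / 2 * (S.mass (S.ymin r t) + S.mass (S.ymax r t)) := by
  rw [elec, if_pos hr, electricField, ← dist_Iio hr, ← dist_Iic hr.le]
  rfl

variable (S) in
lemma measurable_elec : Measurable fun p : ℝ × ℝ => S.elec p.1 p.2 := by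
  have h1 : Measurable fun p : ℝ × ℝ => S.mass (S.ymax p.2 p.1) :=
    S.continuous_mass.measurable.comp (f := fun p : ℝ × ℝ => S.ymax p.2 p.1)
      (S.measurable_ymax.comp (f := fun p : ℝ × ℝ => (p.2, p.1)) (by fun_prop))
  have h2 : Measurable fun p : ℝ × ℝ => S.mass (S.ymin p.2 p.1) :=
    S.continuous_mass.measurable.comp (f := fun p : ℝ × ℝ => S.ymin p.2 p.1)
      (S.measurable_ymin.comp (f := fun p : ℝ × ℝ => (p.2, p.1)) (by fun_prop))
  have : (fun p : ℝ × ℝ => S.elec p.1 p.2) = fun p => if 0 < p.2 then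
      1 / 2 * (S.mass (S.ymin p.2 p.1) + S.mass (S.ymax p.2 p.1)) else 0 := by
    ext p
    split_ifs with h
    · exact elec_eq h p.1
    · simp [elec, h]
  rw [this]
  exact Measurable.ite (measurableSet_lt measurable_const measurable_snd)
    ((h2.add h1).const_mul _) measurable_const

lemma elec_nonneg (t r : ℝ) : 0 ≤ S.elec t r := by
  rcases lt_or_ge 0 r with h | h
  · rw [elec_eq h]
    linarith [S.mass_nonneg (S.ymin r t), S.mass_nonneg (S.ymax r t)]
  · simp [elec, not_lt.2 h]

lemma elec_le (t r : ℝ) : S.elec t r ≤ S.total := by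
  rcases lt_or_ge 0 r with h | h
  · rw [elec_eq h]
    linarith [S.mass_le (S.ymin r t), S.mass_le (S.ymax r t)]
  · simp [elec, not_lt.2 h, S.total_nonneg]

/-- On a merged slab the mean of the initial field is half the quotient of a difference of squares
of masses by the difference of the masses, hence half their sum: the average rule. On a null fibre
both masses equal the initial field at `s`. -/
lemma isFibreAverage_elec (t : ℝ) :
    IsFibreAverage S.m (S.traj t) ({s | 0 < S.traj t s}.indicator S.field) (S.elec t) := by
  refine isFibreAverage_of_pos S.integrable_field ?_ (by simp [elec]) (fun s hs hr h => ?_)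
    fun r hr h => ?_
  · have h : Measurable (Function.uncurry S.elec) := S.measurable_elec
    exact h.of_uncurry_left
  · obtain ⟨h1, h2, -⟩ := free_of_not_mass_lt hs hr h
    rw [elec_eq hr, h1, h2]
    have : S.mass (ENNReal.ofReal s) = S.field s := by
      refine measureReal_congr ?_
      rw [below_ofReal]
      have h3 : Ioo 0 s =ᵐ[S.m] Ioc 0 s := Ioo_ae_eq_Ioc
      refine h3.trans ?_
      filter_upwards [S.ae_pos] with x hx
      exact propext ⟨fun h => h.2, fun h => ⟨hx, h⟩⟩
    rw [this]
    ring
  · have h1 := two_mul_cum_field (S := S) (S.ymax r t)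
    have h2 := two_mul_cum_field (S := S) (S.ymin r t)
    rw [elec_eq hr]
    linear_combination (1 / 2) * h1 - (1 / 2) * h2

/-! ### The radial momentum -/

/-- The fibre average is tested with the indicator of `(a, b]`. Since `0 ≤ a`, particles at the
origin do not contribute, and the preimage is a slab up to a null set. -/
lemma setIntegral_speed {t a b : ℝ} (ha : 0 ≤ a) (hab : a ≤ b) :
    ∫ r in Ioc a b, S.speed t r ∂(S.dist t) = S.mom t (S.ymax b t) - S.mom t (S.ymax a t) := by
  have hT := S.measurable_traj_right t
  have hF := isFibreAverage_speed (S := S) t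
  rw [dist, setIntegral_map measurableSet_Ioc hF.measurable.aestronglyMeasurable hT.aemeasurable,
    mom_sub_mom (ymax_mono t hab)]
  have hA : MeasurableSet (S.traj t ⁻¹' Ioc a b) := hT measurableSet_Ioc
  have hmul : ∀ g : ℝ → ℝ, (fun s => (Ioc a b).indicator (fun _ => (1 : ℝ)) (S.traj t s) * g s)
      = (S.traj t ⁻¹' Ioc a b).indicator g := by
    intro g
    ext s
    by_cases h : S.traj t s ∈ Ioc a b
    · rw [indicator_of_mem h, indicator_of_mem (show s ∈ S.traj t ⁻¹' Ioc a b from h), one_mul]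
    · rw [indicator_of_notMem h, indicator_of_notMem (show s ∉ S.traj t ⁻¹' Ioc a b from h),
        zero_mul]
  have h1 := hF.integral_mul (k := (Ioc a b).indicator fun _ => 1)
    (measurable_const.indicator measurableSet_Ioc) (by
      rw [hmul]; exact hF.integrable.indicator hA)
  rw [hmul, hmul, integral_indicator hA, integral_indicator hA,
    setIntegral_traj_pos _ hA (fun s hs => ha.trans_lt hs.1)] at h1
  rw [h1]
  refine setIntegral_congr_set ?_
  have h2 : S.traj t ⁻¹' Ioc a b = S.traj t ⁻¹' Iic b \ S.traj t ⁻¹' Iic a := by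
    ext s; simp [and_comm]
  rw [h2]
  exact (traj_preimage_Iic (ha.trans hab) t).diff (traj_preimage_Iic ha t)

lemma integrable_speed_dist (t : ℝ) : Integrable (S.speed t) (S.dist t) := by
  have hF := isFibreAverage_speed (S := S) t
  rw [dist, integrable_map_measure hF.measurable.aestronglyMeasurable
    hF.measurable_map.aemeasurable]
  exact hF.integrable_comp

end RadialData


/-! ### Test functions along trajectories -/

/-- The time derivative of a function on `ℝ × ℝ`. -/
def dt (G : ℝ × ℝ → ℝ) (t r : ℝ) : ℝ := fderiv ℝ G (t, r) (1, 0)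

/-- The radial derivative of a function on `ℝ × ℝ`. -/
def dr (G : ℝ × ℝ → ℝ) (t r : ℝ) : ℝ := fderiv ℝ G (t, r) (0, 1)

lemma continuous_dt {G : ℝ × ℝ → ℝ} (hG : ContDiff ℝ 1 G) :
    Continuous fun p : ℝ × ℝ => dt G p.1 p.2 := by
  have := hG.continuous_fderiv one_ne_zero
  unfold dt
  fun_prop

lemma continuous_dr {G : ℝ × ℝ → ℝ} (hG : ContDiff ℝ 1 G) :
    Continuous fun p : ℝ × ℝ => dr G p.1 p.2 := by
  have := hG.continuous_fderiv one_ne_zero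
  unfold dr
  fun_prop

lemma hasDerivAt_curve {G : ℝ × ℝ → ℝ} (hG : ContDiff ℝ 1 G) {x : ℝ → ℝ} {x' t : ℝ}
    (hx : HasDerivAt x x' t) :
    HasDerivAt (fun τ => G (τ, x τ)) (dt G t (x t) + x' * dr G t (x t)) t := by
  have h1 := (hG.differentiable one_ne_zero (t, x t)).hasFDerivAt
  have h2 := h1.comp_hasDerivAt t ((hasDerivAt_id t).prodMk hx)
  have h3 : ((1 : ℝ), x') = (1, 0) + x' • ((0 : ℝ), (1 : ℝ)) := by simp
  rw [h3, map_add, map_smul] at h2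
  exact h2

lemma dt_eq_of_hasDerivAt {G : ℝ × ℝ → ℝ} (hG : ContDiff ℝ 1 G) {t r c : ℝ}
    (h : HasDerivAt (fun τ => G (τ, r)) c t) : dt G t r = c := by
  have := hasDerivAt_curve hG (hasDerivAt_const t r)
  simpa using this.unique h

lemma dr_eq_of_hasDerivAt {G : ℝ × ℝ → ℝ} (hG : ContDiff ℝ 1 G) {t r c : ℝ}
    (h : HasDerivAt (fun ρ => G (t, ρ)) c r) : dr G t r = c := by
  have h1 := (hG.differentiable one_ne_zero (t, r)).hasFDerivAt
  have h2 := h1.comp_hasDerivAt r ((hasDerivAt_const r t).prodMk (hasDerivAt_id r))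
  exact h2.unique h

namespace RadialData

variable {S : RadialData}

lemma locallyLipschitz_traj {s : ℝ} (hs : Charged S.m s) : LocallyLipschitz fun t => S.traj t s := by
  intro t
  obtain ⟨K, hK⟩ := exists_traj_lipschitzOnWith hs (|t| + 1)
  refine ⟨K, _, Icc_mem_nhds ?_ ?_, hK⟩
  · linarith [neg_abs_le t]
  · linarith [le_abs_self t]

lemma absolutelyContinuous_curve {G : ℝ × ℝ → ℝ} (hG : ContDiff ℝ 1 G) {s : ℝ}
    (hs : Charged S.m s) (a b : ℝ) :
    AbsolutelyContinuousOnInterval (fun t => G (t, S.traj t s)) a b := by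
  have h1 : LocallyLipschitz fun t => G (t, S.traj t s) :=
    hG.locallyLipschitz.comp (LocallyLipschitz.id.prodMk (locallyLipschitz_traj hs))
  obtain ⟨K, hK⟩ := (h1.locallyLipschitzOn (s := uIcc a b)).exists_lipschitzOnWith_of_compact
    isCompact_uIcc
  exact hK.absolutelyContinuousOnInterval

lemma ae_deriv_curve {G : ℝ × ℝ → ℝ} (hG : ContDiff ℝ 1 G) {s : ℝ} (hs : Charged S.m s) :
    ∀ᵐ t, deriv (fun τ => G (τ, S.traj τ s)) t
      = dt G t (S.traj t s) + S.speed t (S.traj t s) * dr G t (S.traj t s) := by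
  filter_upwards [ae_hasDerivAt_traj hs] with t ht
  exact (hasDerivAt_curve hG ht).deriv

lemma intervalIntegrable_curve {G : ℝ × ℝ → ℝ} (hG : ContDiff ℝ 1 G) {s : ℝ}
    (hs : Charged S.m s) (a b : ℝ) :
    IntervalIntegrable (fun t => dt G t (S.traj t s) + S.speed t (S.traj t s)
      * dr G t (S.traj t s)) volume a b :=
  (absolutelyContinuous_curve hG hs a b).intervalIntegrable_deriv.congr_ae
    (ae_restrict_of_ae (ae_deriv_curve hG hs))

lemma integral_curve {G : ℝ × ℝ → ℝ} (hG : ContDiff ℝ 1 G) {s : ℝ} (hs : Charged S.m s) (a b : ℝ) :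
    ∫ t in a..b, (dt G t (S.traj t s) + S.speed t (S.traj t s) * dr G t (S.traj t s))
      = G (b, S.traj b s) - G (a, S.traj a s) := by
  rw [← (absolutelyContinuous_curve hG hs a b).integral_deriv_eq_sub]
  refine intervalIntegral.integral_congr_ae ?_
  filter_upwards [ae_deriv_curve hG hs] with t ht _
  exact ht.symm

/-! ### Joint measurability and integrability -/

variable (S) in
lemma measurable_comp_traj {F : ℝ × ℝ → ℝ} (hF : Measurable F) :
    Measurable fun p : ℝ × ℝ => F (p.1, S.traj p.1 p.2) :=
  hF.comp (measurable_fst.prodMk S.measurable_traj)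

variable (S) in
lemma measurable_speed_traj : Measurable fun p : ℝ × ℝ => S.speed p.1 (S.traj p.1 p.2) :=
  S.measurable_comp_traj (F := fun p => S.speed p.1 p.2) S.measurable_speed

variable (S) in
lemma measurable_speed_right (t : ℝ) : Measurable (S.speed t) :=
  (isFibreAverage_speed t).measurable

variable (S) in
/-- A bound for the free velocity up to time `τ`. -/
def velBound (τ s : ℝ) : ℝ := |S.u s| + |S.κ| * S.total * |τ|

variable (S) in
lemma integrable_velBound (τ : ℝ) : Integrable (S.velBound τ) S.m :=
  S.integrable.abs.add (integrable_const _)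

lemma abs_vel_le {t τ : ℝ} (h : |t| ≤ |τ|) (s : ℝ) : |S.vel t s| ≤ S.velBound τ s := by
  have := S.total_nonneg
  refine (abs_add_le _ _).trans ?_
  unfold velBound
  rw [abs_mul, abs_mul, abs_of_nonneg (S.field_nonneg s)]
  gcongr
  exact S.field_le s

lemma velBound_nonneg (τ s : ℝ) : 0 ≤ S.velBound τ s :=
  (abs_nonneg _).trans (abs_vel_le le_rfl s)

lemma integral_abs_speed_le {t τ : ℝ} (h : |t| ≤ |τ|) :
    ∫ s, |S.speed t (S.traj t s)| ∂S.m ≤ ∫ s, S.velBound τ s ∂S.m := by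
  refine (isFibreAverage_speed t).integral_abs_le.trans ?_
  refine integral_mono (isFibreAverage_speed t).integrable.abs (S.integrable_velBound τ) fun s => ?_
  refine le_trans ?_ (abs_vel_le h s)
  exact norm_indicator_le_norm_self (S.vel t) s

lemma abs_le_of_mem_Ioc {t τ : ℝ} (h : t ∈ Ioc 0 τ) : |t| ≤ |τ| := by
  rw [abs_of_pos h.1]; exact h.2.trans (le_abs_self _)

variable (S) in
-- Conditional expectation contracts the `L¹` norm, so the free velocities bound the speed uniformly
-- in time.
lemma integrable_speed_prod (τ : ℝ) :
    Integrable (fun p : ℝ × ℝ => S.speed p.1 (S.traj p.1 p.2))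
      ((volume.restrict (Ioc 0 τ)).prod S.m) := by
  rw [integrable_prod_iff S.measurable_speed_traj.aestronglyMeasurable]
  refine ⟨Eventually.of_forall fun t => (isFibreAverage_speed t).integrable_comp, ?_⟩
  refine Integrable.of_bound (C := ∫ s, S.velBound τ s ∂S.m)
    S.measurable_speed_traj.norm.aestronglyMeasurable.integral_prod_right' ?_
  refine (ae_restrict_mem measurableSet_Ioc).mono fun t ht => ?_
  rw [Real.norm_of_nonneg (integral_nonneg fun _ => norm_nonneg _)]
  exact integral_abs_speed_le (abs_le_of_mem_Ioc ht)

/-! ### Conservation of mass -/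

lemma exists_time_bound {G : ℝ × ℝ → ℝ} (hG : HasCompactSupport G) :
    ∃ τ : ℝ, 0 < τ ∧ ∀ t r, τ ≤ t → G (t, r) = 0 ∧ dt G t r = 0 ∧ dr G t r = 0 := by
  obtain ⟨R, hR⟩ := hG.isBounded.subset_closedBall 0
  refine ⟨|R| + 1, by positivity, fun t r ht => ?_⟩
  have hn : (t, r) ∉ tsupport G := by
    intro hmem
    have h1 := hR hmem
    rw [mem_closedBall_zero_iff] at h1
    have h2 := (norm_fst_le (t, r)).trans h1
    rw [Real.norm_eq_abs] at h2
    have h3 : t ≤ |t| := le_abs_self t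
    have h4 := le_abs_self R
    simp only at h2
    linarith
  have h2 : fderiv ℝ G (t, r) = 0 :=
    image_eq_zero_of_notMem_tsupport fun h => hn (tsupport_fderiv_subset ℝ h)
  exact ⟨image_eq_zero_of_notMem_tsupport hn, by simp [dt, h2], by simp [dr, h2]⟩

/-- The decay `1 / (1 + r²)` is the derivative of `arctan`. Stating it as a bound puts compactly
supported test functions and `arctan` itself in one class. -/
lemma exists_deriv_bound {G : ℝ × ℝ → ℝ} (h1 : ContDiff ℝ 1 G) (hG : HasCompactSupport G) :
    ∃ C : ℝ, 0 ≤ C ∧ ∀ t r, |G (t, r)| ≤ C ∧ |dt G t r| ≤ C ∧ |dr G t r| ≤ C / (1 + r ^ 2) := by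
  obtain ⟨C1, hC1⟩ := hG.exists_bound_of_continuous h1.continuous
  have hf := hG.fderiv (𝕜 := ℝ)
  have hdt : HasCompactSupport fun p : ℝ × ℝ => dt G p.1 p.2 :=
    hf.comp_left (g := fun L : ℝ × ℝ →L[ℝ] ℝ => L (1, 0)) (by simp)
  have hdr : HasCompactSupport fun p : ℝ × ℝ => dr G p.1 p.2 :=
    hf.comp_left (g := fun L : ℝ × ℝ →L[ℝ] ℝ => L (0, 1)) (by simp)
  obtain ⟨C2, hC2⟩ := hdt.exists_bound_of_continuous (continuous_dt h1)
  have h4 := continuous_dr h1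
  obtain ⟨C3, hC3⟩ := (hdr.mul_left (f := fun p : ℝ × ℝ => 1 + p.2 ^ 2)).exists_bound_of_continuous
    (by fun_prop)
  refine ⟨max C1 (max C2 C3), (norm_nonneg _).trans ((hC1 (0, 0)).trans (le_max_left _ _)),
    fun t r => ⟨(hC1 (t, r)).trans (le_max_left _ _),
      (hC2 (t, r)).trans ((le_max_left _ _).trans (le_max_right _ _)), ?_⟩⟩
  have h5 : (0 : ℝ) < 1 + r ^ 2 := by positivity
  rw [le_div_iff₀ h5]
  have h6 := hC3 (t, r)
  rw [Real.norm_eq_abs, Pi.mul_apply, abs_mul, abs_of_pos h5, mul_comm] at h6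
  exact h6.trans ((le_max_right _ _).trans (le_max_right _ _))

lemma div_one_add_sq_le {C : ℝ} (hC : 0 ≤ C) (r : ℝ) : C / (1 + r ^ 2) ≤ C :=
  div_le_self hC (by nlinarith [sq_nonneg r])

lemma setIntegral_Ioi_eq_Ioc {f : ℝ → ℝ} {τ : ℝ} (h : ∀ t, τ ≤ t → f t = 0) :
    ∫ t in Ioi 0, f t = ∫ t in Ioc 0 τ, f t := by
  refine (setIntegral_eq_of_subset_of_forall_sdiff_eq_zero measurableSet_Ioi Ioc_subset_Ioi_self
    fun t ht => h t ?_)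
  by_contra! hlt
  exact ht.2 ⟨ht.1, hlt.le⟩

/-- The weak form of the conservation of mass in the radial variable. -/
theorem radial_mass {G : ℝ × ℝ → ℝ} (h1 : ContDiff ℝ 1 G) (hG : HasCompactSupport G) :
    (∫ t in Ioi 0, ∫ s, (dt G t (S.traj t s) + S.speed t (S.traj t s) * dr G t (S.traj t s)) ∂S.m)
      + ∫ s, G (0, s) ∂S.m = 0 := by
  obtain ⟨τ, hτ, hz⟩ := exists_time_bound hG
  obtain ⟨C, hC0, hC⟩ := exists_deriv_bound h1 hG
  rw [setIntegral_Ioi_eq_Ioc fun t ht => by simp [(hz t _ ht).2.1, (hz t _ ht).2.2]]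
  have hmeas : Measurable fun p : ℝ × ℝ => dt G p.1 (S.traj p.1 p.2)
      + S.speed p.1 (S.traj p.1 p.2) * dr G p.1 (S.traj p.1 p.2) :=
    (S.measurable_comp_traj (F := fun p => dt G p.1 p.2) (continuous_dt h1).measurable).add
      (S.measurable_speed_traj.mul
        (S.measurable_comp_traj (F := fun p => dr G p.1 p.2) (continuous_dr h1).measurable))
  have hint : Integrable (Function.uncurry fun t s => dt G t (S.traj t s)
      + S.speed t (S.traj t s) * dr G t (S.traj t s)) ((volume.restrict (Ioc 0 τ)).prod S.m) := by
    refine Integrable.mono' (g := fun p => C + |S.speed p.1 (S.traj p.1 p.2)| * C)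
      ((integrable_const _).add ((S.integrable_speed_prod τ).abs.mul_const C))
      hmeas.aestronglyMeasurable (Eventually.of_forall fun p => ?_)
    refine (abs_add_le _ _).trans ?_
    rw [abs_mul]
    gcongr
    · exact (hC _ _).2.1
    · exact (hC _ _).2.2.trans (div_one_add_sq_le hC0 _)
  have hG0 : Integrable (fun s => G (0, s)) S.m := by
    have : Continuous fun s : ℝ => G (0, s) := h1.continuous.comp (by fun_prop)
    exact Integrable.of_bound this.aestronglyMeasurable C (Eventually.of_forall fun s => (hC 0 s).1)
  have hadd := integral_add hint.integral_prod_right hG0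
  simp only [Function.uncurry_apply_pair] at hadd
  -- With time integrated first, each charged particle contributes the boundary term `-G (0, s)`,
  -- because `G` vanishes at `τ` and trajectories start at `s`.
  rw [integral_integral_swap hint, ← hadd]
  refine integral_eq_zero_of_ae ?_
  filter_upwards [S.ae_charged] with s hs
  have := integral_curve (S := S) h1 hs 0 τ
  rw [intervalIntegral.integral_of_le hτ.le] at this
  rw [this, (hz τ _ le_rfl).1, traj_zero hs]
  simp

/-! ### Balance of momentum -/

lemma contDiff_arctan_snd : ContDiff ℝ 1 fun p : ℝ × ℝ => Real.arctan p.2 :=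
  Real.contDiff_arctan.comp contDiff_snd

lemma dt_arctan (t r : ℝ) : dt (fun p => Real.arctan p.2) t r = 0 :=
  dt_eq_of_hasDerivAt contDiff_arctan_snd (hasDerivAt_const t (Real.arctan r))

lemma dr_arctan (t r : ℝ) : dr (fun p => Real.arctan p.2) t r = 1 / (1 + r ^ 2) :=
  dr_eq_of_hasDerivAt contDiff_arctan_snd (Real.hasDerivAt_arctan r)

/-- The total variation of the arctangent of a trajectory is bounded uniformly. -/
lemma exists_integral_abs_speed_le {a b : ℝ} (ha : 0 < a) (hab : a ≤ b) :
    ∃ K : ℝ, ∀ s, Charged S.m s →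
      IntegrableOn (fun t => S.speed t (S.traj t s) / (1 + S.traj t s ^ 2)) (Ioc a b) ∧
      ∫ t in Ioc a b, |S.speed t (S.traj t s) / (1 + S.traj t s ^ 2)| ≤ K := by
  have htot := S.total_nonneg
  set c := 1 / a + 1 / 2 * |S.κ| * S.total * b with hc
  refine ⟨2 * c * (b - a) + Real.pi, fun s hs => ?_⟩
  have h1 := intervalIntegrable_curve (S := S) contDiff_arctan_snd hs a b
  have h2 := integral_curve (S := S) contDiff_arctan_snd hs a b
  simp only [dt_arctan, dr_arctan, zero_add, mul_one_div] at h1 h2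
  rw [intervalIntegral.integral_of_le hab] at h2
  rw [intervalIntegrable_iff_integrableOn_Ioc_of_le hab] at h1
  refine ⟨h1, ?_⟩
  -- The one-sided bound grows linearly in the radius, which the weight absorbs. Its factor `1 / t`
  -- is the reason for `a > 0`.
  have hle : ∀ t ∈ Ioc a b, S.speed t (S.traj t s) / (1 + S.traj t s ^ 2) ≤ c := by
    intro t ht
    have ht0 : 0 < t := ha.trans ht.1
    have hx := traj_nonneg (S := S) t s
    have hden : 0 < 1 + S.traj t s ^ 2 := by positivity
    rw [div_le_iff₀ hden]
    refine (speed_le hs ht0).trans ?_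
    have h3 : (S.traj t s + 1 / 2 * |S.κ| * S.total * t ^ 2) / t
        = S.traj t s * (1 / t) + 1 / 2 * |S.κ| * S.total * t := by
      field_simp
    have h4 : 1 / t ≤ 1 / a := one_div_le_one_div_of_le ha ht.1.le
    have h5 : S.traj t s ≤ 1 + S.traj t s ^ 2 := by nlinarith
    have h6 : S.traj t s * (1 / t) ≤ (1 + S.traj t s ^ 2) * (1 / a) := by gcongr
    have h7 : 1 / 2 * |S.κ| * S.total * t ≤ 1 / 2 * |S.κ| * S.total * b := by
      gcongr; exact ht.2
    have h8 : 1 / 2 * |S.κ| * S.total * b ≤ 1 / 2 * |S.κ| * S.total * b * (1 + S.traj t s ^ 2) := by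
      have hb : 0 < b := ha.trans_le hab
      refine le_mul_of_one_le_right (by positivity) (by nlinarith)
    rw [h3, hc]
    linarith
  -- A function `f ≤ c` with `c ≥ 0` satisfies `|f| ≤ 2c - f`, and here the integral of `f` is a
  -- difference of arctangents, so it is at least `-π`.
  calc ∫ t in Ioc a b, |S.speed t (S.traj t s) / (1 + S.traj t s ^ 2)|
      ≤ ∫ t in Ioc a b, (2 * c - S.speed t (S.traj t s) / (1 + S.traj t s ^ 2)) := by
        refine setIntegral_mono_on h1.abs ((integrable_const _).sub h1) measurableSet_Ioc
          fun t ht => ?_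
        have := hle t ht
        have hc0 : 0 ≤ c := by
          have hb : 0 < b := ha.trans_le hab
          positivity
        rw [abs_le]
        constructor <;> linarith
    _ = 2 * c * (b - a) - (Real.arctan (S.traj b s) - Real.arctan (S.traj a s)) := by
        rw [integral_sub (integrable_const _) h1, h2]
        simp [hab]
        ring
    _ ≤ _ := by
        have h3 := Real.neg_pi_div_two_lt_arctan (S.traj b s)
        have h4 := Real.arctan_lt_pi_div_two (S.traj a s)
        linarith

/-- No bound on `speed²` is available yet. For a fixed particle the free velocity is bounded by
`velBound`, which is integrable in `s`, and the time integral of the weighted speed is bounded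
uniformly in `s`; so time is integrated first. -/
lemma integrable_speed_mul_vel_prod {a b : ℝ} (ha : 0 < a) (hab : a ≤ b) :
    Integrable (fun p : ℝ × ℝ => S.speed p.1 (S.traj p.1 p.2) / (1 + S.traj p.1 p.2 ^ 2)
      * S.vel p.1 p.2) ((volume.restrict (Ioc a b)).prod S.m) := by
  have hD : Measurable fun p : ℝ × ℝ =>
      S.speed p.1 (S.traj p.1 p.2) / (1 + S.traj p.1 p.2 ^ 2) :=
    S.measurable_speed_traj.div (measurable_const.add (S.measurable_traj.pow_const 2))
  have hmeas : Measurable fun p : ℝ × ℝ => S.speed p.1 (S.traj p.1 p.2)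
      / (1 + S.traj p.1 p.2 ^ 2) * S.vel p.1 p.2 := hD.mul S.continuous_vel.measurable
  obtain ⟨K, hK⟩ := exists_integral_abs_speed_le (S := S) ha hab
  rw [integrable_prod_iff' hmeas.aestronglyMeasurable]
  have hvel : ∀ t ∈ Ioc a b, ∀ s, |S.vel t s| ≤ S.velBound b s := fun t ht s =>
    abs_vel_le (abs_le_of_mem_Ioc ⟨ha.trans ht.1, ht.2⟩) s
  have hsec : ∀ s, Charged S.m s → Integrable (fun t => S.speed t (S.traj t s)
      / (1 + S.traj t s ^ 2) * S.vel t s) (volume.restrict (Ioc a b)) := by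
    intro s hs
    refine (hK s hs).1.mul_bdd (c := S.velBound b s) ?_ ?_
    · have : Continuous fun t => S.vel t s := S.continuous_vel.comp (f := fun t : ℝ => (t, s)) (by fun_prop)
      exact this.aestronglyMeasurable
    · exact (ae_restrict_mem measurableSet_Ioc).mono fun t ht => hvel t ht s
  constructor
  · filter_upwards [S.ae_charged] with s hs using hsec s hs
  · refine Integrable.mono' (g := fun s => K * S.velBound b s)
      ((S.integrable_velBound b).const_mul K)
      hmeas.norm.aestronglyMeasurable.prod_swap.integral_prod_right' ?_
    filter_upwards [S.ae_charged] with s hs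
    rw [Real.norm_of_nonneg (integral_nonneg fun _ => norm_nonneg _)]
    calc ∫ t in Ioc a b, ‖S.speed t (S.traj t s) / (1 + S.traj t s ^ 2) * S.vel t s‖
        ≤ ∫ t in Ioc a b, |S.speed t (S.traj t s) / (1 + S.traj t s ^ 2)| * S.velBound b s := by
          refine setIntegral_mono_on (hsec s hs).norm ((hK s hs).1.abs.mul_const _)
            measurableSet_Ioc fun t ht => ?_
          rw [norm_mul]
          exact mul_le_mul_of_nonneg_left (hvel t ht s) (norm_nonneg _)
      _ = (∫ t in Ioc a b, |S.speed t (S.traj t s) / (1 + S.traj t s ^ 2)|) * S.velBound b s :=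
          integral_mul_const _ _
      _ ≤ _ := mul_le_mul_of_nonneg_right (hK s hs).2 (velBound_nonneg b s)

end RadialData


/-! ### The radial momentum identity and the energy bound -/

namespace RadialData

variable {S : RadialData}

/-- Averages over fibres hold only off the origin, where a cluster is held at rest regardless of its
free momentum. A factor vanishing at the origin removes this restriction. -/
lemma integral_mul_of_pos {t : ℝ} {f w k : ℝ → ℝ}
    (h : IsFibreAverage S.m (S.traj t) ({s | 0 < S.traj t s}.indicator f) w) (hk : Measurable k)
    (hk0 : k 0 = 0) (hint : Integrable (fun s => k (S.traj t s) * f s) S.m) :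
    Integrable (fun s => k (S.traj t s) * w (S.traj t s)) S.m ∧
      ∫ s, k (S.traj t s) * w (S.traj t s) ∂S.m = ∫ s, k (S.traj t s) * f s ∂S.m := by
  have heq : (fun s => k (S.traj t s) * {s | 0 < S.traj t s}.indicator f s)
      = fun s => k (S.traj t s) * f s := by
    ext s
    by_cases hs : 0 < S.traj t s
    · rw [indicator_of_mem (show s ∈ {s | 0 < S.traj t s} from hs)]
    · rw [(not_lt.1 hs).antisymm (traj_nonneg t s), hk0, zero_mul, zero_mul]
  have h1 : Integrable (fun s => k (S.traj t s) * {s | 0 < S.traj t s}.indicator f s) S.m := by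
    rwa [heq]
  exact ⟨h.integrable_mul hk h1, by rw [h.integral_mul hk h1, heq]⟩

variable (S) in
/-- The rate of change of the momentum tested with `F`. -/
def momentumRate (F : ℝ × ℝ → ℝ) (t : ℝ) : ℝ :=
  ∫ s, (dt F t (S.traj t s) * S.speed t (S.traj t s)
    + dr F t (S.traj t s) * S.speed t (S.traj t s) ^ 2
    + S.κ * F (t, S.traj t s) * S.elec t (S.traj t s)) ∂S.m

/-- A test function whose radial derivative decays, and which vanishes at the origin. -/
structure IsRadialTest (F : ℝ × ℝ → ℝ) (C : ℝ) : Prop where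
  contDiff : ContDiff ℝ 1 F
  nonneg : 0 ≤ C
  zero : ∀ t, F (t, 0) = 0
  le : ∀ t r, |F (t, r)| ≤ C
  dt_le : ∀ t r, |dt F t r| ≤ C
  dr_le : ∀ t r, |dr F t r| ≤ C / (1 + r ^ 2)

section

variable {F : ℝ × ℝ → ℝ} {C : ℝ}

lemma IsRadialTest.dt_zero (hF : IsRadialTest F C) (t : ℝ) : dt F t 0 = 0 :=
  dt_eq_of_hasDerivAt hF.contDiff (by simpa only [hF.zero] using hasDerivAt_const t (0 : ℝ))

lemma IsRadialTest.measurable_right (hF : IsRadialTest F C) (t : ℝ) :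
    Measurable (fun r => F (t, r)) ∧ Measurable (dt F t) ∧ Measurable (dr F t) :=
  ⟨(hF.contDiff.continuous.comp (f := fun r : ℝ => (t, r)) (by fun_prop)).measurable,
    ((continuous_dt hF.contDiff).comp (f := fun r : ℝ => (t, r)) (by fun_prop)).measurable,
    ((continuous_dr hF.contDiff).comp (f := fun r : ℝ => (t, r)) (by fun_prop)).measurable⟩

/-- With `s` frozen, `F * vel` is a smooth enough test function of `(t, r)`, and the free velocity
has constant acceleration `κ * field`. -/
lemma integral_curve_vel (hF : ContDiff ℝ 1 F) {s : ℝ} (hs : Charged S.m s) (a b : ℝ) :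
    ∫ t in a..b, (dt F t (S.traj t s) * S.vel t s
        + dr F t (S.traj t s) * S.speed t (S.traj t s) * S.vel t s
        + S.κ * F (t, S.traj t s) * S.field s)
      = F (b, S.traj b s) * S.vel b s - F (a, S.traj a s) * S.vel a s := by
  have hG : ContDiff ℝ 1 fun p : ℝ × ℝ => F p * S.vel p.1 s := by
    unfold vel; fun_prop
  rw [← integral_curve (S := S) hG hs a b]
  congr 1 with t
  have hv : HasDerivAt (fun τ => S.vel τ s) (S.κ * S.field s) t := by
    unfold vel
    simpa using ((hasDerivAt_id t).const_mul (S.κ * S.field s)).const_add (S.u s)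
  have h1 : HasDerivAt (fun τ => F (τ, S.traj t s)) (dt F t (S.traj t s)) t := by
    simpa using hasDerivAt_curve hF (hasDerivAt_const t (S.traj t s))
  have h2 : HasDerivAt (fun ρ => F (t, ρ)) (dr F t (S.traj t s)) (S.traj t s) :=
    (hF.differentiable one_ne_zero _).hasFDerivAt.comp_hasDerivAt _
      ((hasDerivAt_const _ t).prodMk (hasDerivAt_id _))
  rw [dt_eq_of_hasDerivAt hG (h1.mul hv), dr_eq_of_hasDerivAt hG (h2.mul_const (S.vel t s))]
  ring

lemma IsRadialTest.abs_integrand_le (hF : IsRadialTest F C) {t b : ℝ} (ht : |t| ≤ |b|) (s : ℝ) :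
    |dt F t (S.traj t s) * S.vel t s
        + dr F t (S.traj t s) * S.speed t (S.traj t s) * S.vel t s
        + S.κ * F (t, S.traj t s) * S.field s| ≤
      C * S.velBound b s + C * |S.speed t (S.traj t s) / (1 + S.traj t s ^ 2) * S.vel t s|
        + |S.κ| * C * S.total := by
  have hC := hF.nonneg
  have h0 : 0 < 1 + S.traj t s ^ 2 := by positivity
  have h1 : |dt F t (S.traj t s) * S.vel t s| ≤ C * S.velBound b s := by
    rw [abs_mul]
    exact mul_le_mul (hF.dt_le _ _) (abs_vel_le ht s) (abs_nonneg _) hC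
  have h2 : |dr F t (S.traj t s) * S.speed t (S.traj t s) * S.vel t s|
      ≤ C * |S.speed t (S.traj t s) / (1 + S.traj t s ^ 2) * S.vel t s| := by
    rw [abs_mul, abs_mul, abs_mul, abs_div, abs_of_pos h0]
    calc _ ≤ C / (1 + S.traj t s ^ 2) * |S.speed t (S.traj t s)| * |S.vel t s| := by
          gcongr; exact hF.dr_le _ _
      _ = _ := by ring
  have h3 : |S.κ * F (t, S.traj t s) * S.field s| ≤ |S.κ| * C * S.total := by
    rw [abs_mul, abs_mul, abs_of_nonneg (S.field_nonneg s)]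
    have := hF.le t (S.traj t s)
    have := S.field_le s
    have := S.field_nonneg s
    gcongr
  exact (abs_add_le _ _).trans (add_le_add ((abs_add_le _ _).trans (add_le_add h1 h2)) h3)

lemma integrable_momentum_prod (hF : IsRadialTest F C) {a b : ℝ} (ha : 0 < a) (hab : a ≤ b) :
    Integrable (Function.uncurry fun t s => dt F t (S.traj t s) * S.vel t s
        + dr F t (S.traj t s) * S.speed t (S.traj t s) * S.vel t s
        + S.κ * F (t, S.traj t s) * S.field s) ((volume.restrict (Ioc a b)).prod S.m) := by
  have hm1 := S.measurable_comp_traj (F := fun p => dt F p.1 p.2)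
    (continuous_dt hF.contDiff).measurable
  have hm2 := S.measurable_comp_traj (F := fun p => dr F p.1 p.2)
    (continuous_dr hF.contDiff).measurable
  have hm3 := S.measurable_comp_traj (F := F) hF.contDiff.continuous.measurable
  have hmeas : Measurable (Function.uncurry fun t s => dt F t (S.traj t s) * S.vel t s
        + dr F t (S.traj t s) * S.speed t (S.traj t s) * S.vel t s
        + S.κ * F (t, S.traj t s) * S.field s) :=
    ((hm1.mul S.continuous_vel.measurable).add
      ((hm2.mul S.measurable_speed_traj).mul S.continuous_vel.measurable)).add
      ((hm3.const_mul S.κ).mul (S.measurable_field.comp measurable_snd))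
  refine Integrable.mono' (g := fun p => C * S.velBound b p.2
    + C * |S.speed p.1 (S.traj p.1 p.2) / (1 + S.traj p.1 p.2 ^ 2) * S.vel p.1 p.2|
    + |S.κ| * C * S.total)
    ((((S.integrable_velBound b).comp_snd _).const_mul C).add
      ((integrable_speed_mul_vel_prod ha hab).abs.const_mul C) |>.add (integrable_const _))
    hmeas.aestronglyMeasurable ?_
  have hfst : ∀ᵐ p : ℝ × ℝ ∂(volume.restrict (Ioc a b)).prod S.m, p.1 ∈ Ioc a b :=
    Measure.quasiMeasurePreserving_fst.ae (ae_restrict_mem measurableSet_Ioc)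
  filter_upwards [hfst] with p hp
  exact hF.abs_integrand_le (abs_le_of_mem_Ioc ⟨ha.trans hp.1, hp.2⟩) p.2

/-- Each term is conditioned on the position, turning `vel` into `speed` and `field` into `elec`.
Integrability of the quadratic term is inherited from `speed * vel` through conditional expectation.
-/
lemma IsRadialTest.integral_eq_momentumRate (hF : IsRadialTest F C) {t : ℝ}
    (ht : Integrable (fun s => S.speed t (S.traj t s) / (1 + S.traj t s ^ 2) * S.vel t s) S.m) :
    Integrable (fun s => dr F t (S.traj t s) * S.speed t (S.traj t s) ^ 2) S.m ∧
    ∫ s, (dt F t (S.traj t s) * S.vel t s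
        + dr F t (S.traj t s) * S.speed t (S.traj t s) * S.vel t s
        + S.κ * F (t, S.traj t s) * S.field s) ∂S.m = S.momentumRate F t := by
  obtain ⟨m1, m2, m3⟩ := hF.measurable_right t
  have hT := S.measurable_traj_right t
  have hw := S.measurable_speed_right t
  have i1 : Integrable (fun s => dt F t (S.traj t s) * S.vel t s) S.m :=
    (S.integrable_vel t).bdd_mul (m2.comp hT).aestronglyMeasurable
      (Eventually.of_forall fun s => hF.dt_le t _)
  have i2 : Integrable (fun s => (dr F t (S.traj t s) * S.speed t (S.traj t s)) * S.vel t s) S.m := by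
    have h3 : Measurable fun s => dr F t (S.traj t s) * (1 + S.traj t s ^ 2) :=
      (m3.comp hT).mul (measurable_const.add (hT.pow_const 2))
    refine (ht.bdd_mul (c := C) h3.aestronglyMeasurable
      (Eventually.of_forall fun s => ?_)).congr (Eventually.of_forall fun s => ?_)
    · have h0 : 0 < 1 + S.traj t s ^ 2 := by positivity
      rw [norm_mul, Real.norm_of_nonneg h0.le, ← le_div_iff₀ h0]
      exact hF.dr_le t _
    · have h0 : 1 + S.traj t s ^ 2 ≠ 0 := by positivity
      simp only
      field_simp
  have i3 : Integrable (fun s => (S.κ * F (t, S.traj t s)) * S.field s) S.m := by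
    refine S.integrable_field.bdd_mul (c := |S.κ| * C)
      ((m1.comp hT).const_mul S.κ).aestronglyMeasurable (Eventually.of_forall fun s => ?_)
    rw [norm_mul]
    exact mul_le_mul_of_nonneg_left (hF.le _ _) (norm_nonneg _)
  obtain ⟨j1, e1⟩ := integral_mul_of_pos (isFibreAverage_speed t) m2 (hF.dt_zero t) i1
  -- The first speed factor depends on the position alone, so it belongs to `k`; it vanishes at the
  -- origin even if `dr F` does not.
  obtain ⟨j2, e2⟩ := integral_mul_of_pos (k := fun r => dr F t r * S.speed t r)
    (isFibreAverage_speed t) (m3.mul hw) (by simp [speed_of_nonpos le_rfl]) i2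
  obtain ⟨j3, e3⟩ := integral_mul_of_pos (k := fun r => S.κ * F (t, r))
    (isFibreAverage_elec t) (m1.const_mul _) (by simp [hF.zero]) i3
  have hsq : (fun s => dr F t (S.traj t s) * S.speed t (S.traj t s) * S.speed t (S.traj t s))
      = fun s => dr F t (S.traj t s) * S.speed t (S.traj t s) ^ 2 := by
    ext s; ring
  rw [hsq] at j2 e2
  refine ⟨j2, ?_⟩
  unfold momentumRate
  have a1 := integral_add (i1.add i2) i3
  have a2 := integral_add i1 i2
  have a3 := integral_add (j1.add j2) j3
  have a4 := integral_add j1 j2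
  simp only [Pi.add_apply] at a1 a2 a3 a4
  rw [a1, a2, a3, a4, e1, e2, e3]

lemma momentum_Ioc (hF : IsRadialTest F C) {a b : ℝ} (ha : 0 < a) (hab : a ≤ b) :
    (∀ᵐ t ∂volume.restrict (Ioc a b),
      Integrable (fun s => dr F t (S.traj t s) * S.speed t (S.traj t s) ^ 2) S.m) ∧
    IntegrableOn (S.momentumRate F) (Ioc a b) ∧
    ∫ t in Ioc a b, S.momentumRate F t
      = ∫ s, F (b, S.traj b s) * S.vel b s ∂S.m - ∫ s, F (a, S.traj a s) * S.vel a s ∂S.m := by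
  have hI := integrable_momentum_prod (S := S) hF ha hab
  have hsec := (integrable_speed_mul_vel_prod (S := S) ha hab).prod_right_ae
  have hrate : (fun t => ∫ s, (dt F t (S.traj t s) * S.vel t s
        + dr F t (S.traj t s) * S.speed t (S.traj t s) * S.vel t s
        + S.κ * F (t, S.traj t s) * S.field s) ∂S.m)
      =ᵐ[volume.restrict (Ioc a b)] S.momentumRate F := by
    filter_upwards [hsec] with t ht using (hF.integral_eq_momentumRate ht).2
  refine ⟨?_, ?_, ?_⟩
  · filter_upwards [hsec] with t ht using (hF.integral_eq_momentumRate ht).1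
  · exact hI.integral_prod_left.congr hrate
  · rw [← integral_congr_ae hrate, integral_integral_swap hI]
    have hend : ∀ t, Integrable (fun s => F (t, S.traj t s) * S.vel t s) S.m := fun t =>
      (S.integrable_vel t).bdd_mul (((hF.measurable_right t).1.comp
        (S.measurable_traj_right t))).aestronglyMeasurable (Eventually.of_forall fun s => hF.le t _)
    rw [← integral_sub (hend b) (hend a)]
    refine integral_congr_ae ?_
    filter_upwards [S.ae_charged] with s hs
    rw [← intervalIntegral.integral_of_le hab]
    exact integral_curve_vel hF.contDiff hs a b

/-- A bounded, strictly increasing test function: its momentum identity controls `speed² / (1 + r²)`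
by bounded terms. -/
lemma isRadialTest_arctan : IsRadialTest (fun p => Real.arctan p.2) 2 where
  contDiff := contDiff_arctan_snd
  nonneg := by norm_num
  zero := fun t => Real.arctan_zero
  le := fun t r => by
    have h1 := Real.neg_pi_div_two_lt_arctan r
    have h2 := Real.arctan_lt_pi_div_two r
    have h3 := Real.pi_lt_four
    rw [abs_le]
    constructor <;> linarith
  dt_le := fun t r => by rw [dt_arctan]; norm_num
  dr_le := fun t r => by
    have h0 : 0 < 1 + r ^ 2 := by positivity
    rw [dr_arctan, abs_of_pos (by positivity)]
    gcongr
    norm_num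

variable (S) in
/-- The kinetic energy, weighted at infinity. -/
def energy (t : ℝ) : ℝ := ∫ s, S.speed t (S.traj t s) ^ 2 / (1 + S.traj t s ^ 2) ∂S.m

lemma integral_vel_le (hF : IsRadialTest F C) {t τ : ℝ} (h : |t| ≤ |τ|) :
    |∫ s, F (t, S.traj t s) * S.vel t s ∂S.m| ≤ C * ∫ s, S.velBound τ s ∂S.m := by
  rw [← integral_const_mul, ← Real.norm_eq_abs]
  refine norm_integral_le_of_norm_le ((S.integrable_velBound τ).const_mul C)
    (Eventually.of_forall fun s => ?_)
  rw [norm_mul]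
  exact mul_le_mul (hF.le _ _) (abs_vel_le h s) (norm_nonneg _) hF.nonneg

/-- In the momentum identity for `arctan`, the endpoint terms are controlled by the first moment of
the velocity (the `4` is two endpoints with bound `2`) and the force by the total mass. The lower
time `a` does not enter the bound. -/
lemma energy_Ioc {a b : ℝ} (ha : 0 < a) (hab : a ≤ b) :
    (∀ᵐ t ∂volume.restrict (Ioc a b),
      Integrable (fun s => S.speed t (S.traj t s) ^ 2 / (1 + S.traj t s ^ 2)) S.m) ∧
    IntegrableOn S.energy (Ioc a b) ∧
    ∫ t in Ioc a b, S.energy t ≤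
      4 * ∫ s, S.velBound b s ∂S.m + 2 * |S.κ| * S.total ^ 2 * b := by
  have htot := S.total_nonneg
  have hb : 0 < b := ha.trans_le hab
  have hF := isRadialTest_arctan
  obtain ⟨h1, h2, h3⟩ := momentum_Ioc (S := S) hF ha hab
  simp only [dr_arctan, one_div_mul_eq_div] at h1
  have hforce : ∀ t, Integrable (fun s => S.κ * Real.arctan (S.traj t s)
      * S.elec t (S.traj t s)) S.m := fun t => by
    have he := (isFibreAverage_elec (S := S) t).integrable_comp
    refine he.bdd_mul (c := |S.κ| * 2) ?_ (Eventually.of_forall fun s => ?_)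
    · exact (((hF.measurable_right t).1.comp
        (S.measurable_traj_right t)).const_mul S.κ).aestronglyMeasurable
    · rw [norm_mul]
      exact mul_le_mul_of_nonneg_left (hF.le t _) (norm_nonneg _)
  set f : ℝ → ℝ := fun t => ∫ s, S.κ * Real.arctan (S.traj t s) * S.elec t (S.traj t s) ∂S.m with hf
  have hfle : ∀ t, |f t| ≤ |S.κ| * 2 * S.total * S.total := fun t => by
    have : |f t| ≤ ∫ _, |S.κ| * 2 * S.total ∂S.m := by
      rw [← Real.norm_eq_abs]
      refine norm_integral_le_of_norm_le (integrable_const _) (Eventually.of_forall fun s => ?_)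
      rw [norm_mul, norm_mul]
      refine mul_le_mul (mul_le_mul_of_nonneg_left (hF.le t _) (norm_nonneg _)) ?_
        (norm_nonneg _) (by positivity)
      rw [Real.norm_of_nonneg (elec_nonneg _ _)]
      exact elec_le _ _
    refine this.trans (le_of_eq ?_)
    simp [total, mul_comm]
  have hfm : Measurable f := by
    have hm : Measurable fun p : ℝ × ℝ => S.κ * Real.arctan (S.traj p.1 p.2)
        * S.elec p.1 (S.traj p.1 p.2) :=
      ((S.measurable_comp_traj hF.contDiff.continuous.measurable).const_mul _).mul
        (S.measurable_comp_traj (F := fun p => S.elec p.1 p.2) S.measurable_elec)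
    exact (hm.stronglyMeasurable.integral_prod_right' (ν := S.m)).measurable
  have hfi : IntegrableOn f (Ioc a b) :=
    Integrable.of_bound hfm.aestronglyMeasurable _ (Eventually.of_forall hfle)
  have hrate : S.momentumRate (fun p => Real.arctan p.2)
      =ᵐ[volume.restrict (Ioc a b)] fun t => S.energy t + f t := by
    filter_upwards [h1] with t ht
    rw [hf, energy]
    simp only
    rw [← integral_add ht (hforce t), momentumRate]
    congr 1 with s
    rw [dt_arctan, dr_arctan]
    ring
  have he : IntegrableOn S.energy (Ioc a b) := by
    refine (h2.sub hfi).congr ?_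
    filter_upwards [hrate] with t ht
    simp [ht]
  refine ⟨h1, he, ?_⟩
  rw [integral_congr_ae hrate, integral_add he hfi] at h3
  have e1 := integral_vel_le (S := S) hF (le_refl |b|)
  have e2 := integral_vel_le (S := S) hF (t := a) (τ := b)
    (by rw [abs_of_pos ha, abs_of_pos hb]; exact hab)
  have e3 : |∫ t in Ioc a b, f t| ≤ |S.κ| * 2 * S.total * S.total * b := by
    have := norm_setIntegral_le_of_norm_le_const (μ := volume) (s := Ioc a b)
      (f := f) (C := |S.κ| * 2 * S.total * S.total) measure_Ioc_lt_top (fun t _ => hfle t)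
    refine this.trans ?_
    rw [Real.volume_real_Ioc_of_le hab]
    gcongr
    linarith
  rw [abs_le] at e1 e2 e3
  have : |S.κ| * 2 * S.total * S.total * b = 2 * |S.κ| * S.total ^ 2 * b := by ring
  linarith

lemma energy_nonneg (t : ℝ) : 0 ≤ S.energy t := integral_nonneg fun _ => by positivity

variable (S) in
lemma ae_integrable_energy (b : ℝ) : ∀ᵐ t ∂volume.restrict (Ioc 0 b),
    Integrable (fun s => S.speed t (S.traj t s) ^ 2 / (1 + S.traj t s ^ 2)) S.m := by
  have h : ∀ n : ℕ, ∀ᵐ t, t ∈ Ioc (1 / ((n : ℝ) + 1)) b →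
      Integrable (fun s => S.speed t (S.traj t s) ^ 2 / (1 + S.traj t s ^ 2)) S.m := by
    intro n
    rcases le_total (1 / ((n : ℝ) + 1)) b with hn | hn
    · exact (ae_restrict_iff' measurableSet_Ioc).1 (energy_Ioc (by positivity) hn).1
    · refine Eventually.of_forall fun t ht => absurd (ht.1.trans_le ht.2) (not_lt.2 hn)
  rw [ae_restrict_iff' measurableSet_Ioc]
  filter_upwards [ae_all_iff.2 h] with t ht htb
  obtain ⟨n, hn⟩ := exists_nat_one_div_lt htb.1
  exact ht n ⟨hn, htb.2⟩

variable (S) in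
lemma integrableOn_energy {b : ℝ} (hb : 0 < b) : IntegrableOn S.energy (Ioc 0 b) := by
  -- Lower endpoints tend to `0` and stay at most `b`, while the energy integrals remain uniformly
  -- bounded.
  have hpos : ∀ n : ℕ, 0 < min b (1 / ((n : ℝ) + 1)) := fun n => lt_min hb (by positivity)
  refine integrableOn_Ioc_of_intervalIntegral_norm_bounded_left (l := atTop)
    (a := fun n : ℕ => min b (1 / ((n : ℝ) + 1)))
    (I := 4 * ∫ s, S.velBound b s ∂S.m + 2 * |S.κ| * S.total ^ 2 * b)
    (fun n => (energy_Ioc (hpos n) (min_le_left _ _)).2.1) ?_ (Eventually.of_forall fun n => ?_)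
  · have := (tendsto_const_nhds (x := b)).min tendsto_one_div_add_atTop_nhds_zero_nat
    simpa [hb.le] using this
  · simp only [Real.norm_of_nonneg (energy_nonneg _)]
    exact (energy_Ioc (hpos n) (min_le_left _ _)).2.2

/-- The weak form of the balance of momentum in the radial variable. -/
theorem radial_momentum (h1 : ContDiff ℝ 1 F) (hcs : HasCompactSupport F) (h0 : ∀ t, F (t, 0) = 0) :
    (∫ t in Ioi 0, S.momentumRate F t) + ∫ s, F (0, s) * S.u s ∂S.m = 0 := by
  have htot := S.total_nonneg
  obtain ⟨τ, hτ, hz⟩ := exists_time_bound hcs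
  obtain ⟨C, hC0, hC⟩ := exists_deriv_bound h1 hcs
  have hF : IsRadialTest F C :=
    ⟨h1, hC0, h0, fun t r => (hC t r).1, fun t r => (hC t r).2.1, fun t r => (hC t r).2.2⟩
  rw [setIntegral_Ioi_eq_Ioc fun t ht => by
    simp [momentumRate, (hz t _ ht).1, (hz t _ ht).2.1, (hz t _ ht).2.2]]
  have hm : Measurable fun p : ℝ × ℝ => dt F p.1 (S.traj p.1 p.2) * S.speed p.1 (S.traj p.1 p.2)
      + dr F p.1 (S.traj p.1 p.2) * S.speed p.1 (S.traj p.1 p.2) ^ 2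
      + S.κ * F (p.1, S.traj p.1 p.2) * S.elec p.1 (S.traj p.1 p.2) := by
    have m1 := S.measurable_comp_traj (F := fun p => dt F p.1 p.2) (continuous_dt h1).measurable
    have m2 := S.measurable_comp_traj (F := fun p => dr F p.1 p.2) (continuous_dr h1).measurable
    have m3 := S.measurable_comp_traj (F := F) h1.continuous.measurable
    have m4 := S.measurable_comp_traj (F := fun p => S.elec p.1 p.2) S.measurable_elec
    have m5 := S.measurable_speed_traj
    exact ((m1.mul m5).add (m2.mul (m5.pow_const 2))).add ((m3.const_mul S.κ).mul m4)
  -- The energy bound gives integrability up to time `0`, whereas the momentum identity is only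
  -- available on `(a, τ]` with `a > 0`; the rest of the proof lets `a` tend to `0`.
  have hint : IntegrableOn (S.momentumRate F) (Ioc 0 τ) := by
    refine Integrable.mono' (g := fun t => C * ∫ s, S.velBound τ s ∂S.m + C * S.energy t
      + |S.κ| * C * S.total * S.total)
      (((integrable_const _).add ((S.integrableOn_energy hτ).const_mul C)).add (integrable_const _))
      (hm.stronglyMeasurable.integral_prod_right' (ν := S.m)).aestronglyMeasurable ?_
    filter_upwards [S.ae_integrable_energy τ, ae_restrict_mem measurableSet_Ioc] with t ht htm
    have hsp := (isFibreAverage_speed (S := S) t).integrable_comp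
    have hb : |S.momentumRate F t| ≤ ∫ s, (C * |S.speed t (S.traj t s)|
        + C * (S.speed t (S.traj t s) ^ 2 / (1 + S.traj t s ^ 2)) + |S.κ| * C * S.total) ∂S.m := by
      have hgi : Integrable (fun s => C * |S.speed t (S.traj t s)|
          + C * (S.speed t (S.traj t s) ^ 2 / (1 + S.traj t s ^ 2)) + |S.κ| * C * S.total) S.m :=
        ((hsp.abs.const_mul C).add (ht.const_mul C)).add (integrable_const _)
      rw [← Real.norm_eq_abs]
      refine norm_integral_le_of_norm_le hgi (Eventually.of_forall fun s => ?_)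
      refine (norm_add_le _ _).trans (add_le_add ((norm_add_le _ _).trans (add_le_add ?_ ?_)) ?_)
      · rw [norm_mul]
        exact mul_le_mul_of_nonneg_right (hF.dt_le _ _) (norm_nonneg _)
      · rw [norm_mul, Real.norm_of_nonneg (sq_nonneg _), ← mul_div_assoc, mul_div_right_comm]
        exact mul_le_mul_of_nonneg_right (hF.dr_le _ _) (sq_nonneg _)
      · rw [norm_mul, norm_mul, Real.norm_of_nonneg (elec_nonneg _ _)]
        exact mul_le_mul (mul_le_mul_of_nonneg_left (hF.le _ _) (norm_nonneg _)) (elec_le _ _)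
          (elec_nonneg _ _) (by positivity)
    refine hb.trans ?_
    have a1 := integral_add ((hsp.abs.const_mul C).add (ht.const_mul C))
      (integrable_const (μ := S.m) (|S.κ| * C * S.total))
    have a2 := integral_add (hsp.abs.const_mul C) (ht.const_mul C)
    simp only [Pi.add_apply] at a1 a2
    rw [a1, a2, integral_const_mul, integral_const_mul]
    have h2 := mul_le_mul_of_nonneg_left
      (integral_abs_speed_le (S := S) (abs_le_of_mem_Ioc htm)) hC0
    have h3 : ∫ _, |S.κ| * C * S.total ∂S.m = |S.κ| * C * S.total * S.total := by
      simp [total, mul_comm]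
    rw [h3]
    change _ + C * S.energy t + _ ≤ _
    linarith
  have hcont := intervalIntegral.continuousOn_primitive_interval_left
    (a := 0) (b := τ) (f := S.momentumRate F) (μ := volume) (by
      rw [uIcc_of_le hτ.le, integrableOn_Icc_iff_integrableOn_Ioc]
      exact hint)
  have hlim1 : Tendsto (fun a => ∫ t in a..τ, S.momentumRate F t) (𝓝[>] 0)
      (𝓝 (∫ t in Ioc 0 τ, S.momentumRate F t)) := by
    have h2 := (hcont 0 left_mem_uIcc).tendsto
    rw [intervalIntegral.integral_of_le hτ.le] at h2
    refine h2.mono_left ?_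
    rw [uIcc_of_le hτ.le, nhdsWithin_Icc_eq_nhdsGE hτ]
    exact nhdsWithin_mono _ Ioi_subset_Ici_self
  -- The free velocity, not the speed, appears at the endpoint, so the initial momentum is recovered
  -- from continuity of each trajectory and domination by `velBound`.
  have hlim2 : Tendsto (fun a => -∫ s, F (a, S.traj a s) * S.vel a s ∂S.m) (𝓝[>] 0)
      (𝓝 (-∫ s, F (0, s) * S.u s ∂S.m)) := by
    refine Tendsto.neg (tendsto_integral_filter_of_dominated_convergence
      (fun s => C * S.velBound τ s) ?_ ?_ ((S.integrable_velBound τ).const_mul C) ?_)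
    · refine Eventually.of_forall fun a => ?_
      exact (((hF.measurable_right a).1.comp (S.measurable_traj_right a)).aestronglyMeasurable).mul
        (S.integrable_vel a).aestronglyMeasurable
    · filter_upwards [Ioc_mem_nhdsGT hτ] with a ha
      refine Eventually.of_forall fun s => ?_
      rw [norm_mul]
      exact mul_le_mul (hF.le _ _) (abs_vel_le (abs_le_of_mem_Ioc ha) s) (norm_nonneg _) hC0
    · filter_upwards [S.ae_charged] with s hs
      have hc : Continuous fun a => F (a, S.traj a s) * S.vel a s :=
        (h1.continuous.comp (f := fun a => (a, S.traj a s))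
          (continuous_id.prodMk (continuous_traj hs))).mul
          (S.continuous_vel.comp (f := fun a : ℝ => (a, s)) (by fun_prop))
      have := hc.tendsto 0
      simp only [traj_zero hs] at this
      have hv : S.vel 0 s = S.u s := by simp [vel]
      rw [hv] at this
      exact this.mono_left nhdsWithin_le_nhds
  have heq : (fun a => ∫ t in a..τ, S.momentumRate F t)
      =ᶠ[𝓝[>] 0] fun a => -∫ s, F (a, S.traj a s) * S.vel a s ∂S.m := by
    filter_upwards [Ioc_mem_nhdsGT hτ] with a ha
    rw [intervalIntegral.integral_of_le ha.2, (momentum_Ioc hF ha.1 ha.2).2.2]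
    simp [(hz τ _ le_rfl).1]
  rw [tendsto_nhds_unique (hlim1.congr' heq) hlim2]
  simp

end

end RadialData


/-! ### Averages over the unit sphere -/

section SphereAverage

variable {n : ℕ}

/-- The surface measure of the unit sphere. -/
abbrev surface (n : ℕ) : Measure (Metric.sphere (0 : Space n) 1) :=
  (volume : Measure (Space n)).toSphere

lemma norm_smul_sphere {r : ℝ} (hr : 0 ≤ r) (θ : Metric.sphere (0 : Space n) 1) :
    ‖r • (θ : Space n)‖ = r := by
  rw [norm_smul, Real.norm_of_nonneg hr, norm_eq_of_mem_sphere, mul_one]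

lemma radialDir_smul_sphere {r : ℝ} (hr : 0 < r) (θ : Metric.sphere (0 : Space n) 1) :
    radialDir (r • (θ : Space n)) = θ := by
  rw [radialDir, norm_smul_sphere hr.le, smul_smul, inv_mul_cancel₀ hr.ne', one_smul]

lemma radialDir_zero : radialDir (0 : Space n) = 0 := by simp [radialDir]

lemma measurable_radialDir : Measurable (radialDir : Space n → Space n) :=
  (measurable_norm.inv).smul measurable_id

lemma norm_radialDir_le (x : Space n) : ‖radialDir x‖ ≤ 1 := by
  rw [radialDir, norm_smul, norm_inv, norm_norm]
  exact inv_mul_le_one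

/-- The spherical integrals of a function. -/
def shell (ψ : Space n → ℝ) (r : ℝ) : ℝ :=
  ∫ θ : Metric.sphere (0 : Space n) 1, ψ (r • (θ : Space n)) ∂surface n

/-- The integral of `Ψ` over the unit sphere in its first variable. -/
def sphereIntegral (Ψ : Space n × (ℝ × ℝ) → ℝ) (p : ℝ × ℝ) : ℝ :=
  ∫ θ : Metric.sphere (0 : Space n) 1, Ψ (θ, p) ∂surface n

lemma integrable_sphere {E : Type*} [NormedAddCommGroup E] {f : Metric.sphere (0 : Space n) 1 → E}
    (hf : Continuous f) : Integrable f (surface n) :=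
  hf.integrable_of_hasCompactSupport (HasCompactSupport.of_compactSpace f)

/-- The derivative of `Ψ` in its second variable. -/
def sndFDeriv (Ψ : Space n × (ℝ × ℝ) → ℝ) (q : Space n × (ℝ × ℝ)) : ℝ × ℝ →L[ℝ] ℝ :=
  (fderiv ℝ Ψ q).comp (ContinuousLinearMap.inr ℝ (Space n) (ℝ × ℝ))

variable {Ψ : Space n × (ℝ × ℝ) → ℝ}

lemma continuous_sndFDeriv (h : ContDiff ℝ 1 Ψ) : Continuous (sndFDeriv Ψ) :=
  (h.continuous_fderiv one_ne_zero).clm_comp continuous_const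

lemma hasFDerivAt_section (h : ContDiff ℝ 1 Ψ) (x : Space n) (p : ℝ × ℝ) :
    HasFDerivAt (fun p => Ψ (x, p)) (sndFDeriv Ψ (x, p)) p :=
  ((h.differentiable one_ne_zero (x, p)).hasFDerivAt).comp p (hasFDerivAt_prodMk_right x p)

lemma hasFDerivAt_sphereIntegral (h : ContDiff ℝ 1 Ψ) (p : ℝ × ℝ) :
    HasFDerivAt (sphereIntegral Ψ)
      (∫ θ : Metric.sphere (0 : Space n) 1, sndFDeriv Ψ (θ, p) ∂surface n) p := by
  have hc := continuous_sndFDeriv h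
  obtain ⟨C, hC⟩ := ((isCompact_sphere (0 : Space n) 1).prod
    (isCompact_closedBall p 1)).exists_bound_of_continuousOn hc.continuousOn
  refine hasFDerivAt_integral_of_dominated_of_fderiv_le (μ := surface n)
    (F := fun p (θ : Metric.sphere (0 : Space n) 1) => Ψ (θ, p))
    (F' := fun p θ => sndFDeriv Ψ (θ, p)) (bound := fun _ => C)
    (Metric.closedBall_mem_nhds p one_pos) ?_ ?_ ?_ ?_ (integrable_const C) ?_
  · refine Eventually.of_forall fun q => (integrable_sphere ?_).aestronglyMeasurable
    have := h.continuous
    fun_prop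
  · refine integrable_sphere ?_
    have := h.continuous
    fun_prop
  · refine (integrable_sphere ?_).aestronglyMeasurable
    fun_prop
  · exact Eventually.of_forall fun θ q hq => hC (θ, q) ⟨θ.2, hq⟩
  · exact Eventually.of_forall fun θ q _ => hasFDerivAt_section h θ q

lemma contDiff_sphereIntegral (h : ContDiff ℝ 1 Ψ) : ContDiff ℝ 1 (sphereIntegral Ψ) := by
  have hd := hasFDerivAt_sphereIntegral h
  refine contDiff_one_iff_fderiv.2 ⟨fun p => (hd p).differentiableAt, ?_⟩
  have : fderiv ℝ (sphereIntegral Ψ) =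
      fun p => ∫ θ : Metric.sphere (0 : Space n) 1, sndFDeriv Ψ (θ, p) ∂surface n :=
    funext fun p => (hd p).fderiv
  rw [this]
  have hc := continuous_sndFDeriv h
  have := continuous_parametric_integral_of_continuous (μ := surface n)
    (f := fun (p : ℝ × ℝ) (θ : Metric.sphere (0 : Space n) 1) => sndFDeriv Ψ (θ, p))
    (by fun_prop) isCompact_univ
  simpa using this

lemma fderiv_sphereIntegral_apply (h : ContDiff ℝ 1 Ψ) (p v : ℝ × ℝ) :
    fderiv ℝ (sphereIntegral Ψ) p v =
      ∫ θ : Metric.sphere (0 : Space n) 1, fderiv ℝ (fun p => Ψ (θ, p)) p v ∂surface n := by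
  have hc := continuous_sndFDeriv h
  rw [(hasFDerivAt_sphereIntegral h p).fderiv,
    ContinuousLinearMap.integral_apply (integrable_sphere (by fun_prop))]
  simp only [(hasFDerivAt_section h _ p).fderiv]

lemma contDiff_snd_section (h : ContDiff ℝ 1 Ψ) (x : Space n) : ContDiff ℝ 1 fun p => Ψ (x, p) :=
  h.comp (contDiff_const.prodMk contDiff_id)

end SphereAverage

/-! ### The mass equation in space -/

namespace RadialData

variable {S : RadialData} {n : ℕ}

lemma radialMeasure_map {α : Type*} [MeasurableSpace α] {m : Measure α} [SFinite m] {T : α → ℝ}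
    (hT : Measurable T) :
    radialMeasure n (m.map T) = (m.prod (surface n)).map
      (fun p : α × Metric.sphere (0 : Space n) 1 => T p.1 • (p.2 : Space n)) := by
  have h1 : Measurable fun p : ℝ × Metric.sphere (0 : Space n) 1 => p.1 • (p.2 : Space n) := by
    fun_prop
  have h2 := Measure.map_prod_map m (surface n) hT measurable_id
  rw [Measure.map_id] at h2
  rw [radialMeasure, h2, Measure.map_map h1 (hT.prodMap measurable_id)]
  rfl

lemma measurable_traj_smul (t : ℝ) : Measurable
    fun p : ℝ × Metric.sphere (0 : Space n) 1 => S.traj t p.1 • (p.2 : Space n) :=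
  ((S.measurable_traj_right t).comp measurable_fst).smul (by fun_prop)

lemma radialMeasure_dist (t : ℝ) : radialMeasure n (S.dist t) = (S.m.prod (surface n)).map
      (fun p : ℝ × Metric.sphere (0 : Space n) 1 => S.traj t p.1 • (p.2 : Space n)) :=
  have := S.finite
  radialMeasure_map (S.measurable_traj_right t)

lemma integral_radialMeasure_dist {f : Space n → ℝ} (hf : Measurable f) (t : ℝ) :
    ∫ x, f x ∂radialMeasure n (S.dist t) =
      ∫ p : ℝ × Metric.sphere (0 : Space n) 1, f (S.traj t p.1 • (p.2 : Space n))
        ∂S.m.prod (surface n) := by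
  rw [radialMeasure_dist, integral_map (measurable_traj_smul t).aemeasurable
    hf.aestronglyMeasurable]

/-- The radial velocity field with speed `S.speed`. -/
def velocity (S : RadialData) (t : ℝ) (x : Space n) : Space n := S.speed t ‖x‖ • radialDir x

lemma measurable_velocity : Measurable fun p : ℝ × Space n => S.velocity p.1 p.2 := by
  have h : Measurable fun p : ℝ × Space n => S.speed p.1 ‖p.2‖ :=
    Measurable.comp (g := fun p : ℝ × ℝ => S.speed p.1 p.2)
      (f := fun p : ℝ × Space n => (p.1, ‖p.2‖)) S.measurable_speed (by fun_prop)
  exact h.smul (measurable_radialDir.comp measurable_snd)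

lemma measurable_velocity_right (t : ℝ) : Measurable (S.velocity t : Space n → Space n) :=
  Measurable.comp (g := fun p : ℝ × Space n => S.velocity p.1 p.2)
    (f := fun x : Space n => (t, x)) measurable_velocity (by fun_prop)

lemma velocity_smul_sphere (t : ℝ) {r : ℝ} (hr : 0 ≤ r) (θ : Metric.sphere (0 : Space n) 1) :
    S.velocity t (r • (θ : Space n)) = S.speed t r • (θ : Space n) := by
  rcases hr.eq_or_lt with rfl | hr
  · simp [velocity, speed_of_nonpos]
  · rw [velocity, norm_smul_sphere hr.le, radialDir_smul_sphere hr]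

/-- A test function along rays. -/
def rayTest (φ : ℝ × Space n → ℝ) (q : Space n × (ℝ × ℝ)) : ℝ := φ (q.2.1, q.2.2 • q.1)

lemma contDiff_rayTest {φ : ℝ × Space n → ℝ} (h : ContDiff ℝ 1 φ) : ContDiff ℝ 1 (rayTest φ) :=
  ContDiff.comp (g := φ) (f := fun q : Space n × (ℝ × ℝ) => (q.2.1, q.2.2 • q.1)) h (by fun_prop)

lemma hasDerivAt_rayTest_fst {F : Type*} [NormedAddCommGroup F] [NormedSpace ℝ F]
    {φ : ℝ × Space n → F} (h : ContDiff ℝ 1 φ) (x : Space n) (t r : ℝ) :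
    HasDerivAt (fun τ => φ (τ, r • x)) (fderiv ℝ φ (t, r • x) (1, 0)) t :=
  ((h.differentiable one_ne_zero (t, r • x)).hasFDerivAt).comp_hasDerivAt t
    ((hasDerivAt_id t).prodMk (hasDerivAt_const t (r • x)))

lemma hasDerivAt_rayTest_snd {F : Type*} [NormedAddCommGroup F] [NormedSpace ℝ F]
    {φ : ℝ × Space n → F} (h : ContDiff ℝ 1 φ) (x : Space n) (t r : ℝ) :
    HasDerivAt (fun ρ : ℝ => φ (t, ρ • x)) (fderiv ℝ φ (t, r • x) (0, x)) r := by
  have h1 : HasDerivAt (fun ρ : ℝ => ρ • x) x r := by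
    simpa using (hasDerivAt_id r).smul_const x
  exact ((h.differentiable one_ne_zero (t, r • x)).hasFDerivAt).comp_hasDerivAt r
    ((hasDerivAt_const r t).prodMk h1)

lemma dt_sphereIntegral_rayTest {φ : ℝ × Space n → ℝ} (h : ContDiff ℝ 1 φ) (t r : ℝ) :
    dt (sphereIntegral (rayTest φ)) t r =
      ∫ θ : Metric.sphere (0 : Space n) 1, fderiv ℝ φ (t, r • (θ : Space n)) (1, 0) ∂surface n := by
  rw [dt, fderiv_sphereIntegral_apply (contDiff_rayTest h)]
  exact integral_congr_ae (Eventually.of_forall fun θ =>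
    dt_eq_of_hasDerivAt (contDiff_snd_section (contDiff_rayTest h) θ)
      (hasDerivAt_rayTest_fst h θ t r))

lemma dr_sphereIntegral_rayTest {φ : ℝ × Space n → ℝ} (h : ContDiff ℝ 1 φ) (t r : ℝ) :
    dr (sphereIntegral (rayTest φ)) t r =
      ∫ θ : Metric.sphere (0 : Space n) 1, fderiv ℝ φ (t, r • (θ : Space n)) (0, (θ : Space n))
        ∂surface n := by
  rw [dr, fderiv_sphereIntegral_apply (contDiff_rayTest h)]
  exact integral_congr_ae (Eventually.of_forall fun θ =>
    dr_eq_of_hasDerivAt (contDiff_snd_section (contDiff_rayTest h) θ)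
      (hasDerivAt_rayTest_snd h θ t r))

lemma exists_support_bound {F : Type*} [NormedAddCommGroup F] {φ : ℝ × Space n → F}
    (h : HasCompactSupport φ) :
    ∃ R : ℝ, 0 ≤ R ∧ ∀ p : ℝ × Space n, R < ‖p‖ → φ p = 0 := by
  obtain ⟨R, hR⟩ := h.isCompact.isBounded.exists_norm_le
  refine ⟨max R 0, le_max_right _ _, fun p hp => ?_⟩
  by_contra h0
  exact absurd (hR p (subset_tsupport _ h0)) (not_le.2 ((le_max_left _ _).trans_lt hp))

lemma norm_prod_smul_sphere (t r : ℝ) (θ : Metric.sphere (0 : Space n) 1) :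
    ‖((t, r • (θ : Space n)) : ℝ × Space n)‖ = ‖((t, r) : ℝ × ℝ)‖ := by
  simp [Prod.norm_def, norm_smul, norm_eq_of_mem_sphere]

lemma hasCompactSupport_sphereIntegral_of_le {Ψ : Space n × (ℝ × ℝ) → ℝ} {R : ℝ}
    (h : ∀ (θ : Metric.sphere (0 : Space n) 1) (p : ℝ × ℝ), R < ‖p‖ → Ψ (θ, p) = 0) :
    HasCompactSupport (sphereIntegral Ψ) := by
  refine HasCompactSupport.intro (isCompact_closedBall (0 : ℝ × ℝ) R) fun p hp => ?_
  rw [mem_closedBall_zero_iff, not_le] at hp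
  simp [sphereIntegral, h _ p hp]

lemma continuous_fderiv_apply_snd {F : Type*} [NormedAddCommGroup F] [NormedSpace ℝ F]
    {φ : ℝ × Space n → F} (h : ContDiff ℝ 1 φ) :
    Continuous fun q : (ℝ × Space n) × Space n => fderiv ℝ φ q.1 (0, q.2) := by
  have := h.continuous_fderiv one_ne_zero
  fun_prop

lemma continuous_fderiv_apply_fst {F : Type*} [NormedAddCommGroup F] [NormedSpace ℝ F]
    {φ : ℝ × Space n → F} (h : ContDiff ℝ 1 φ) :
    Continuous fun q : ℝ × Space n => fderiv ℝ φ q (1, 0) := by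
  have := h.continuous_fderiv one_ne_zero
  fun_prop

lemma integral_mass_test {φ : ℝ × Space n → ℝ} (h1 : ContDiff ℝ 1 φ) (hcs : HasCompactSupport φ)
    (t : ℝ) :
    ∫ x, (fderiv ℝ φ (t, x) (1, 0) + fderiv ℝ φ (t, x) (0, S.velocity t x))
        ∂radialMeasure n (S.dist t) =
      ∫ s, (dt (sphereIntegral (rayTest φ)) t (S.traj t s) +
        S.speed t (S.traj t s) * dr (sphereIntegral (rayTest φ)) t (S.traj t s)) ∂S.m := by
  have := S.finite
  have hc1 := continuous_fderiv_apply_fst h1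
  have hc2 := continuous_fderiv_apply_snd h1
  obtain ⟨C, hC⟩ := (hcs.fderiv (𝕜 := ℝ)).exists_bound_of_continuous
    (h1.continuous_fderiv one_ne_zero)
  have hmeas : Measurable fun x : Space n =>
      fderiv ℝ φ (t, x) (1, 0) + fderiv ℝ φ (t, x) (0, S.velocity t x) := by
    refine Measurable.add (Continuous.measurable (by fun_prop)) ?_
    exact Measurable.comp (g := fun q : (ℝ × Space n) × Space n => fderiv ℝ φ q.1 (0, q.2))
      (f := fun x : Space n => ((t, x), S.velocity t x)) hc2.measurable
      ((by fun_prop : Measurable fun x : Space n => (t, x)).prodMk (measurable_velocity_right t))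
  have hspeed : ∀ (s : ℝ) (θ : Metric.sphere (0 : Space n) 1),
      fderiv ℝ φ (t, S.traj t s • (θ : Space n)) (0, S.velocity t (S.traj t s • (θ : Space n))) =
        S.speed t (S.traj t s) * fderiv ℝ φ (t, S.traj t s • (θ : Space n)) (0, (θ : Space n)) := by
    intro s θ
    rw [velocity_smul_sphere t (S.traj_nonneg t s)]
    have : ((0 : ℝ), S.speed t (S.traj t s) • (θ : Space n)) =
      S.speed t (S.traj t s) • ((0 : ℝ), (θ : Space n)) := by simp
    rw [this, map_smul, smul_eq_mul]
  have hb1 : ∀ (p : ℝ × Space n), ‖fderiv ℝ φ p (1, 0)‖ ≤ C := fun p => by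
    refine ((fderiv ℝ φ p).le_opNorm _).trans ?_
    simpa [Prod.norm_def] using hC p
  have hb2 : ∀ (p : ℝ × Space n) (θ : Metric.sphere (0 : Space n) 1),
      ‖fderiv ℝ φ p (0, (θ : Space n))‖ ≤ C := fun p θ => by
    refine ((fderiv ℝ φ p).le_opNorm _).trans ?_
    simpa [Prod.norm_def, norm_eq_of_mem_sphere] using hC p
  rw [integral_radialMeasure_dist hmeas, integral_prod]
  · refine integral_congr_ae (Eventually.of_forall fun s => ?_)
    simp only [hspeed]
    rw [integral_add, integral_const_mul, dt_sphereIntegral_rayTest h1,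
      dr_sphereIntegral_rayTest h1]
    · exact integrable_sphere (by fun_prop)
    · exact (integrable_sphere (by fun_prop)).const_mul _
  · have hsp : Integrable (fun s => C + C * ‖S.speed t (S.traj t s)‖) S.m :=
      (integrable_const C).add (((isFibreAverage_speed t).integrable_comp).norm.const_mul C)
    refine Integrable.mono' (hsp.comp_fst (surface n))
      (hmeas.comp (measurable_traj_smul t)).aestronglyMeasurable
      (Eventually.of_forall fun p => ?_)
    rw [hspeed]
    refine (norm_add_le _ _).trans (add_le_add (hb1 _) ?_)
    rw [norm_mul, mul_comm]
    exact mul_le_mul_of_nonneg_right (hb2 _ _) (norm_nonneg _)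

lemma integral_radialMeasure {m : Measure ℝ} [SFinite m] {f : Space n → ℝ} (hf : Measurable f)
    (hi : Integrable (fun p : ℝ × Metric.sphere (0 : Space n) 1 => f (p.1 • (p.2 : Space n)))
      (m.prod (surface n))) :
    ∫ x, f x ∂radialMeasure n m =
      ∫ s, ∫ θ : Metric.sphere (0 : Space n) 1, f (s • (θ : Space n)) ∂surface n ∂m := by
  rw [radialMeasure, integral_map (Continuous.aemeasurable (by fun_prop)) hf.aestronglyMeasurable,
    integral_prod _ hi]

theorem weak_mass {φ : ℝ × Space n → ℝ} (h1 : ContDiff ℝ 1 φ) (hcs : HasCompactSupport φ) :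
    (∫ t in Ioi 0, ∫ x, (fderiv ℝ φ (t, x) (1, 0) + fderiv ℝ φ (t, x) (0, S.velocity t x))
        ∂radialMeasure n (S.dist t)) + ∫ s, shell (fun x => φ (0, x)) s ∂S.m = 0 := by
  obtain ⟨R, -, hR⟩ := exists_support_bound hcs
  have key := S.radial_mass (contDiff_sphereIntegral (contDiff_rayTest h1))
    (hasCompactSupport_sphereIntegral_of_le (R := R) fun θ p hp =>
      hR _ (by rwa [norm_prod_smul_sphere]))
  simp only [integral_mass_test h1 hcs]
  exact key

end RadialData


/-! ### Antipodal symmetry of the sphere -/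

section SphereSymmetry

variable {n : ℕ}

/-- The surface measure of a set is a multiple of the volume of the cone over it, and volume is
invariant under negation. -/
lemma map_neg_surface : (surface n).map (fun θ => -θ) = surface n := by
  ext s hs
  have hm : Measurable fun θ : Metric.sphere (0 : Space n) 1 => -θ := continuous_neg.measurable
  rw [Measure.map_apply hm hs, Measure.toSphere_apply' _ (hm hs), Measure.toSphere_apply' _ hs]
  congr 1
  rw [← Measure.measure_neg (volume : Measure (Space n))]
  congr 1
  ext x
  simp only [Set.mem_neg, Set.mem_smul, Set.mem_image, Set.mem_preimage]
  constructor
  · rintro ⟨r, hr, _, ⟨θ, hθ, rfl⟩, h⟩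
    exact ⟨r, hr, _, ⟨-θ, hθ, rfl⟩, by rw [coe_neg_sphere, smul_neg, h, neg_neg]⟩
  · rintro ⟨r, hr, _, ⟨θ, hθ, rfl⟩, h⟩
    exact ⟨r, hr, _, ⟨-θ, by simpa using hθ, rfl⟩, by rw [coe_neg_sphere, smul_neg, h]⟩

/-- The integrand is odd. This is why averaged vector test functions vanish at the origin, as
`radial_momentum` requires. -/
lemma integral_inner_sphere (v : Space n) :
    ∫ θ : Metric.sphere (0 : Space n) 1, ⟪(θ : Space n), v⟫ ∂surface n = 0 := by
  have h : ∫ θ : Metric.sphere (0 : Space n) 1, ⟪(θ : Space n), v⟫ ∂surface n =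
      -∫ θ : Metric.sphere (0 : Space n) 1, ⟪(θ : Space n), v⟫ ∂surface n := by
    have hm : Measurable fun θ : Metric.sphere (0 : Space n) 1 => -θ := continuous_neg.measurable
    conv_lhs => rw [← map_neg_surface]
    rw [integral_map hm.aemeasurable (Continuous.aestronglyMeasurable (by fun_prop)),
      ← integral_neg]
    simp only [coe_neg_sphere, inner_neg_left]
  linarith

end SphereSymmetry

/-! ### The momentum equation in space -/

namespace RadialData

variable {S : RadialData} {n : ℕ}

/-- The radial component of a vector test function along rays. -/
def radialTest (Φ : ℝ × Space n → Space n) (q : Space n × (ℝ × ℝ)) : ℝ :=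
  ⟪q.1, Φ (q.2.1, q.2.2 • q.1)⟫

variable {Φ : ℝ × Space n → Space n}

lemma contDiff_radialTest (h : ContDiff ℝ 1 Φ) : ContDiff ℝ 1 (radialTest Φ) :=
  contDiff_fst.inner ℝ (ContDiff.comp (g := Φ)
    (f := fun q : Space n × (ℝ × ℝ) => (q.2.1, q.2.2 • q.1)) h (by fun_prop))

lemma dt_sphereIntegral_radialTest (h : ContDiff ℝ 1 Φ) (t r : ℝ) :
    dt (sphereIntegral (radialTest Φ)) t r = ∫ θ : Metric.sphere (0 : Space n) 1,
      ⟪(θ : Space n), fderiv ℝ Φ (t, r • (θ : Space n)) (1, 0)⟫ ∂surface n := by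
  rw [dt, fderiv_sphereIntegral_apply (contDiff_radialTest h)]
  refine integral_congr_ae (Eventually.of_forall fun θ =>
    dt_eq_of_hasDerivAt (contDiff_snd_section (contDiff_radialTest h) θ) ?_)
  have := (hasDerivAt_const t (θ : Space n)).inner ℝ (hasDerivAt_rayTest_fst h θ t r)
  rw [inner_zero_left, add_zero] at this
  exact this

lemma dr_sphereIntegral_radialTest (h : ContDiff ℝ 1 Φ) (t r : ℝ) :
    dr (sphereIntegral (radialTest Φ)) t r = ∫ θ : Metric.sphere (0 : Space n) 1,
      ⟪(θ : Space n), fderiv ℝ Φ (t, r • (θ : Space n)) (0, (θ : Space n))⟫ ∂surface n := by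
  rw [dr, fderiv_sphereIntegral_apply (contDiff_radialTest h)]
  refine integral_congr_ae (Eventually.of_forall fun θ =>
    dr_eq_of_hasDerivAt (contDiff_snd_section (contDiff_radialTest h) θ) ?_)
  have := (hasDerivAt_const r (θ : Space n)).inner ℝ (hasDerivAt_rayTest_snd h θ t r)
  rw [inner_zero_left, add_zero] at this
  exact this

lemma radialGradient_dist (t : ℝ) (x : Space n) :
    radialGradient n (S.dist t) x = ((‖x‖ ^ (n - 1))⁻¹ * S.elec t ‖x‖) • radialDir x := by
  rcases eq_or_ne x 0 with rfl | hx
  · simp [radialGradient, radialDir_zero]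
  · rw [radialGradient, elec, if_pos (norm_pos_iff.2 hx)]

lemma measurable_radialGradient :
    Measurable fun p : ℝ × Space n => radialGradient n (S.dist p.1) p.2 := by
  simp only [radialGradient_dist]
  have h : Measurable fun p : ℝ × Space n => S.elec p.1 ‖p.2‖ :=
    Measurable.comp (g := fun p : ℝ × ℝ => S.elec p.1 p.2)
      (f := fun p : ℝ × Space n => (p.1, ‖p.2‖)) S.measurable_elec (by fun_prop)
  exact ((by fun_prop : Measurable fun p : ℝ × Space n => (‖p.2‖ ^ (n - 1))⁻¹).mul h).smul
    (measurable_radialDir.comp measurable_snd)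

lemma measurable_radialGradient_right (t : ℝ) :
    Measurable (radialGradient n (S.dist t)) :=
  Measurable.comp (g := fun p : ℝ × Space n => radialGradient n (S.dist p.1) p.2)
    (f := fun x : Space n => (t, x)) measurable_radialGradient (by fun_prop)

/-- The weight cancels `r^(1-n)` exactly and leaves the bounded field `elec`. At `r = 0` both sides
vanish by the conventions for `radialDir` and `elec`. -/
lemma force_smul_sphere (t : ℝ) {r : ℝ} (hr : 0 ≤ r) (θ : Metric.sphere (0 : Space n) 1)
    (v : Space n) :
    ‖r • (θ : Space n)‖ ^ (n - 1) * ⟪radialGradient n (S.dist t) (r • (θ : Space n)), v⟫ =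
      S.elec t r * ⟪(θ : Space n), v⟫ := by
  rcases hr.eq_or_lt with rfl | hr
  · simp [elec, radialGradient, radialDir_zero]
  · rw [radialGradient_dist, norm_smul_sphere hr.le, radialDir_smul_sphere hr, inner_smul_left]
    have : r ^ (n - 1) ≠ 0 := (pow_pos hr _).ne'
    simp only [conj_trivial]
    field_simp

lemma norm_force_le (t : ℝ) (x : Space n) :
    ‖‖x‖ ^ (n - 1) • radialGradient n (S.dist t) x‖ ≤ S.total := by
  rcases eq_or_ne x 0 with rfl | hx
  · simp [radialGradient, radialDir_zero, S.total_nonneg]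
  · have h : ‖x‖ ^ (n - 1) ≠ 0 := (pow_pos (norm_pos_iff.2 hx) _).ne'
    rw [radialGradient_dist, smul_smul, mul_inv_cancel_left₀ h, norm_smul,
      Real.norm_of_nonneg (elec_nonneg _ _)]
    exact (mul_le_of_le_one_right (elec_nonneg _ _) (norm_radialDir_le x)).trans (elec_le _ _)

variable (S) in
/-- The integrand of the weak momentum equation. -/
def momentumIntegrand (Φ : ℝ × Space n → Space n) (t : ℝ) (x : Space n) : ℝ :=
  ⟪S.velocity t x, fderiv ℝ Φ (t, x) (1, 0)⟫
    + ⟪S.velocity t x, fderiv ℝ Φ (t, x) (0, S.velocity t x)⟫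
    + S.κ * ‖x‖ ^ (n - 1) * ⟪radialGradient n (S.dist t) x, Φ (t, x)⟫

lemma measurable_momentumIntegrand (h1 : ContDiff ℝ 1 Φ) (t : ℝ) :
    Measurable (S.momentumIntegrand Φ t) := by
  have hc := h1.continuous
  have hc1 := continuous_fderiv_apply_fst h1
  have hc2 := continuous_fderiv_apply_snd h1
  have hv := S.measurable_velocity_right (n := n) t
  have hg := S.measurable_radialGradient_right (n := n) t
  have h2 : Measurable fun x : Space n => fderiv ℝ Φ (t, x) (0, S.velocity t x) :=
    Measurable.comp (g := fun q : (ℝ × Space n) × Space n => fderiv ℝ Φ q.1 (0, q.2))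
      (f := fun x : Space n => ((t, x), S.velocity t x)) hc2.measurable
      ((by fun_prop : Measurable fun x : Space n => (t, x)).prodMk hv)
  have h3 : Measurable fun x : Space n => fderiv ℝ Φ (t, x) (1, 0) :=
    Continuous.measurable (by fun_prop)
  have h4 : Measurable fun x : Space n => Φ (t, x) := Continuous.measurable (by fun_prop)
  exact ((hv.inner h3).add (hv.inner h2)).add
    ((by fun_prop : Measurable fun x : Space n => S.κ * ‖x‖ ^ (n - 1)).mul (hg.inner h4))

lemma momentumIntegrand_smul_sphere (t : ℝ) {r : ℝ} (hr : 0 ≤ r)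
    (θ : Metric.sphere (0 : Space n) 1) :
    S.momentumIntegrand Φ t (r • (θ : Space n)) =
      S.speed t r * ⟪(θ : Space n), fderiv ℝ Φ (t, r • (θ : Space n)) (1, 0)⟫
      + S.speed t r ^ 2 * ⟪(θ : Space n), fderiv ℝ Φ (t, r • (θ : Space n)) (0, (θ : Space n))⟫
      + S.κ * S.elec t r * ⟪(θ : Space n), Φ (t, r • (θ : Space n))⟫ := by
  rw [momentumIntegrand, velocity_smul_sphere t hr, mul_assoc S.κ, force_smul_sphere t hr]
  have : ((0 : ℝ), S.speed t r • (θ : Space n)) = S.speed t r • ((0 : ℝ), (θ : Space n)) := by simp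
  rw [this, map_smul]
  simp only [inner_smul_left, inner_smul_right, conj_trivial]
  ring

lemma exists_decay_bound (h1 : ContDiff ℝ 1 Φ) (hcs : HasCompactSupport Φ) :
    ∃ C : ℝ, 0 ≤ C ∧ (∀ p, ‖Φ p‖ ≤ C) ∧ (∀ p, ‖fderiv ℝ Φ p‖ ≤ C) ∧
      ∀ t r (θ : Metric.sphere (0 : Space n) 1),
        ‖fderiv ℝ Φ (t, r • (θ : Space n))‖ ≤ C / (1 + r ^ 2) := by
  obtain ⟨C₀, hC₀⟩ := hcs.exists_bound_of_continuous h1.continuous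
  obtain ⟨C₁, hC₁⟩ := (hcs.fderiv (𝕜 := ℝ)).exists_bound_of_continuous
    (h1.continuous_fderiv one_ne_zero)
  obtain ⟨R, hR0, hR⟩ := exists_support_bound (hcs.fderiv (𝕜 := ℝ))
  have h0 : 0 ≤ C₀ := (norm_nonneg _).trans (hC₀ 0)
  have h1 : 0 ≤ C₁ := (norm_nonneg _).trans (hC₁ 0)
  refine ⟨C₀ + C₁ * (1 + R ^ 2), by positivity, fun p => (hC₀ p).trans ?_,
    fun p => (hC₁ p).trans ?_, fun t r θ => ?_⟩
  · have : 0 ≤ C₁ * (1 + R ^ 2) := by positivity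
    linarith
  · nlinarith [sq_nonneg R]
  · rw [le_div_iff₀ (by positivity)]
    by_cases hr : R < ‖((t, r • (θ : Space n)) : ℝ × Space n)‖
    · rw [hR _ hr, norm_zero, zero_mul]
      positivity
    · have hle : |r| ≤ R := by
        rw [norm_prod_smul_sphere] at hr
        exact (le_max_right _ _).trans (not_lt.1 hr)
      have hsq : r ^ 2 ≤ R ^ 2 := sq_le_sq' (abs_le.1 hle).1 (abs_le.1 hle).2
      calc ‖fderiv ℝ Φ (t, r • (θ : Space n))‖ * (1 + r ^ 2) ≤ C₁ * (1 + R ^ 2) :=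
            mul_le_mul (hC₁ _) (by linarith) (by positivity) h1
        _ ≤ _ := by linarith

lemma integral_momentumIntegrand (h1 : ContDiff ℝ 1 Φ) (hcs : HasCompactSupport Φ) {t : ℝ}
    (ht : Integrable (fun s => S.speed t (S.traj t s) ^ 2 / (1 + S.traj t s ^ 2)) S.m) :
    ∫ x, S.momentumIntegrand Φ t x ∂radialMeasure n (S.dist t) =
      S.momentumRate (sphereIntegral (radialTest Φ)) t := by
  have := S.finite
  have hc := h1.continuous
  have hc1 := continuous_fderiv_apply_fst h1
  have hc2 := continuous_fderiv_apply_snd h1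
  obtain ⟨C, hC, hb, hb1, hb2⟩ := exists_decay_bound h1 hcs
  have hn1 : ‖((1 : ℝ), (0 : Space n))‖ = 1 := by simp [Prod.norm_def]
  have hn2 : ∀ θ : Metric.sphere (0 : Space n) 1, ‖((0 : ℝ), (θ : Space n))‖ = 1 := fun θ => by
    simp [Prod.norm_def, norm_eq_of_mem_sphere]
  have hin : ∀ (θ : Metric.sphere (0 : Space n) 1) (v : Space n), |⟪(θ : Space n), v⟫| ≤ ‖v‖ :=
    fun θ v => (abs_real_inner_le_norm _ _).trans (by rw [norm_eq_of_mem_sphere, one_mul])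
  have hap : ∀ (p v : ℝ × Space n), ‖v‖ = 1 → ‖fderiv ℝ Φ p v‖ ≤ ‖fderiv ℝ Φ p‖ := fun p v hv =>
    ((fderiv ℝ Φ p).le_opNorm v).trans (by rw [hv, mul_one])
  have hmeas := S.measurable_momentumIntegrand h1 t
  rw [integral_radialMeasure_dist hmeas, integral_prod, momentumRate]
  · refine integral_congr_ae (Eventually.of_forall fun s => ?_)
    simp only [momentumIntegrand_smul_sphere t (S.traj_nonneg t s)]
    rw [integral_add, integral_add, integral_const_mul, integral_const_mul, integral_const_mul,
      dt_sphereIntegral_radialTest h1, dr_sphereIntegral_radialTest h1, sphereIntegral]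
    · simp only [radialTest]
      ring
    · exact (integrable_sphere (by fun_prop)).const_mul _
    · exact (integrable_sphere (by fun_prop)).const_mul _
    · exact ((integrable_sphere (by fun_prop)).const_mul _).add
        ((integrable_sphere (by fun_prop)).const_mul _)
    · exact (integrable_sphere (by fun_prop)).const_mul _
  · have hsp : Integrable (fun s => C * ‖S.speed t (S.traj t s)‖
        + C * (S.speed t (S.traj t s) ^ 2 / (1 + S.traj t s ^ 2)) + |S.κ| * S.total * C) S.m :=
      ((((isFibreAverage_speed t).integrable_comp).norm.const_mul C).add (ht.const_mul C)).add
        (integrable_const _)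
    refine Integrable.mono' (hsp.comp_fst (surface n))
      (hmeas.comp (measurable_traj_smul t)).aestronglyMeasurable
      (Eventually.of_forall fun ⟨s, θ⟩ => ?_)
    rw [momentumIntegrand_smul_sphere t (S.traj_nonneg t s), Real.norm_eq_abs, Real.norm_eq_abs]
    refine (abs_add_three _ _ _).trans (add_le_add (add_le_add ?_ ?_) ?_)
    · rw [abs_mul, mul_comm]
      exact mul_le_mul_of_nonneg_right ((hin _ _).trans ((hap _ _ hn1).trans (hb1 _)))
        (abs_nonneg _)
    · rw [abs_mul, abs_of_nonneg (sq_nonneg _), mul_div_left_comm]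
      exact mul_le_mul_of_nonneg_left ((hin _ _).trans ((hap _ _ (hn2 θ)).trans (hb2 _ _ _)))
        (sq_nonneg _)
    · rw [abs_mul, abs_mul, abs_of_nonneg (S.elec_nonneg _ _)]
      exact mul_le_mul (mul_le_mul_of_nonneg_left (S.elec_le _ _) (abs_nonneg _))
        ((hin _ _).trans (hb _)) (abs_nonneg _) (mul_nonneg (abs_nonneg _) S.total_nonneg)

variable (S) in
lemma ae_integrable_energy_Ioi : ∀ᵐ t ∂volume.restrict (Ioi 0),
    Integrable (fun s => S.speed t (S.traj t s) ^ 2 / (1 + S.traj t s ^ 2)) S.m := by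
  have hU : Ioi (0 : ℝ) = ⋃ k : ℕ, Ioc 0 (k : ℝ) := by
    ext t
    simp only [mem_Ioi, mem_iUnion, mem_Ioc]
    refine ⟨fun h => ?_, fun ⟨_, h⟩ => h.1⟩
    obtain ⟨k, hk⟩ := exists_nat_ge t
    exact ⟨k, h, hk⟩
  rw [hU, ae_restrict_iUnion_iff]
  exact fun k => S.ae_integrable_energy k

theorem weak_momentum (h1 : ContDiff ℝ 1 Φ) (hcs : HasCompactSupport Φ) :
    (∫ t in Ioi 0, ∫ x, S.momentumIntegrand Φ t x ∂radialMeasure n (S.dist t))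
      + ∫ s, sphereIntegral (radialTest Φ) (0, s) * S.u s ∂S.m = 0 := by
  obtain ⟨R, -, hR⟩ := exists_support_bound hcs
  have key := S.radial_momentum (contDiff_sphereIntegral (contDiff_radialTest h1))
    (hasCompactSupport_sphereIntegral_of_le (R := R) fun θ p hp => by
      rw [radialTest, hR _ (by rwa [norm_prod_smul_sphere]), inner_zero_right])
    (fun t => by simp only [sphereIntegral, radialTest, zero_smul, integral_inner_sphere])
  rwa [integral_congr_ae ((S.ae_integrable_energy_Ioi).mono fun t ht =>
    integral_momentumIntegrand h1 hcs ht)]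

end RadialData


/-! ### Measurability in time and finite energy -/

namespace RadialData

variable {S : RadialData} {n : ℕ}

variable (S n) in
lemma measurable_radialMeasure_dist : Measurable fun t => radialMeasure n (S.dist t) := by
  have := S.finite
  refine Measure.measurable_of_measurable_coe _ fun s hs => ?_
  have hm : Measurable fun q : ℝ × (ℝ × Metric.sphere (0 : Space n) 1) =>
      S.traj q.1 q.2.1 • (q.2.2 : Space n) := by
    have : Measurable fun q : ℝ × (ℝ × Metric.sphere (0 : Space n) 1) => S.traj q.1 q.2.1 :=
      Measurable.comp (g := fun p : ℝ × ℝ => S.traj p.1 p.2)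
        (f := fun q : ℝ × (ℝ × Metric.sphere (0 : Space n) 1) => (q.1, q.2.1))
        S.measurable_traj (by fun_prop)
    exact this.smul (by fun_prop)
  have h := measurable_measure_prodMk_left (ν := S.m.prod (surface n)) (hm hs)
  have heq : (fun t => radialMeasure n (S.dist t) s) = fun t => (S.m.prod (surface n))
      (Prod.mk t ⁻¹' ((fun q : ℝ × (ℝ × Metric.sphere (0 : Space n) 1) =>
        S.traj q.1 q.2.1 • (q.2.2 : Space n)) ⁻¹' s)) := by
    ext t
    rw [radialMeasure_dist, Measure.map_apply (measurable_traj_smul t) hs]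
    rfl
  rw [heq]
  exact h

lemma norm_velocity_smul_sphere (t : ℝ) {r : ℝ} (hr : 0 ≤ r) (θ : Metric.sphere (0 : Space n) 1) :
    ‖S.velocity t (r • (θ : Space n))‖ = |S.speed t r| := by
  rw [velocity_smul_sphere t hr, norm_smul, norm_eq_of_mem_sphere, mul_one, Real.norm_eq_abs]

/-- On the ball of radius `R` the weight `1 / (1 + |x|²)` costs at most the factor `1 + R²`, so the
weighted energy suffices locally. -/
lemma lintegral_energy_le {t : ℝ}
    (ht : Integrable (fun s => S.speed t (S.traj t s) ^ 2 / (1 + S.traj t s ^ 2)) S.m) (R : ℝ) :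
    ∫⁻ x in Metric.ball 0 R, (1 + ‖S.velocity t x‖ₑ ^ 2) ∂radialMeasure n (S.dist t) ≤
      ENNReal.ofReal (S.total + (1 + R ^ 2) * S.energy t) * surface n univ := by
  have := S.finite
  set f : Space n → ℝ≥0∞ := fun x =>
    ENNReal.ofReal (1 + (1 + R ^ 2) * (‖S.velocity t x‖ ^ 2 / (1 + ‖x‖ ^ 2))) with hf
  have hv := (S.measurable_velocity_right (n := n) t).norm
  have hmeas : Measurable f := by
    refine Measurable.ennreal_ofReal (measurable_const.add (measurable_const.mul ?_))
    exact (hv.pow_const 2).div (by fun_prop)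
  have hle : ∀ x ∈ Metric.ball (0 : Space n) R, 1 + ‖S.velocity t x‖ₑ ^ 2 ≤ f x := by
    intro x hx
    rw [mem_ball_zero_iff] at hx
    rw [hf, ← ofReal_norm, ← ENNReal.ofReal_one, ← ENNReal.ofReal_pow (norm_nonneg _),
      ← ENNReal.ofReal_add zero_le_one (by positivity)]
    refine ENNReal.ofReal_le_ofReal (add_le_add le_rfl ?_)
    rw [mul_div_assoc', le_div_iff₀ (by positivity), mul_comm]
    refine mul_le_mul_of_nonneg_right ?_ (by positivity)
    nlinarith [norm_nonneg x]
  have hint : Integrable (fun s => 1 + (1 + R ^ 2) *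
      (S.speed t (S.traj t s) ^ 2 / (1 + S.traj t s ^ 2))) S.m :=
    (integrable_const 1).add (ht.const_mul _)
  calc ∫⁻ x in Metric.ball 0 R, (1 + ‖S.velocity t x‖ₑ ^ 2) ∂radialMeasure n (S.dist t)
      ≤ ∫⁻ x in Metric.ball 0 R, f x ∂radialMeasure n (S.dist t) :=
        setLIntegral_mono hmeas hle
    _ ≤ ∫⁻ x, f x ∂radialMeasure n (S.dist t) := setLIntegral_le_lintegral _ _
    _ = ∫⁻ p : ℝ × Metric.sphere (0 : Space n) 1, f (S.traj t p.1 • (p.2 : Space n))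
          ∂S.m.prod (surface n) := by
        rw [radialMeasure_dist, lintegral_map hmeas (measurable_traj_smul t)]
    _ = ∫⁻ s, ∫⁻ θ : Metric.sphere (0 : Space n) 1, f (S.traj t s • (θ : Space n))
          ∂surface n ∂S.m :=
        lintegral_prod _ (hmeas.comp (measurable_traj_smul t)).aemeasurable
    _ = ∫⁻ s, ENNReal.ofReal (1 + (1 + R ^ 2) *
          (S.speed t (S.traj t s) ^ 2 / (1 + S.traj t s ^ 2))) * surface n univ ∂S.m := by
        refine lintegral_congr fun s => ?_
        simp only [hf, norm_velocity_smul_sphere t (S.traj_nonneg t s),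
          norm_smul_sphere (S.traj_nonneg t s), sq_abs, lintegral_const]
    _ = ENNReal.ofReal (S.total + (1 + R ^ 2) * S.energy t) * surface n univ := by
        rw [lintegral_mul_const' _ _ (measure_ne_top _ _),
          ← ofReal_integral_eq_lintegral_ofReal hint
            (Eventually.of_forall fun s => by positivity),
          integral_add (integrable_const 1) (ht.const_mul _), integral_const_mul]
        simp [total, energy]

variable (S n) in
theorem finite_energy (T R : ℝ) : ∫⁻ t in Ioc 0 T, ∫⁻ x in Metric.ball 0 R,
    (1 + ‖S.velocity t x‖ₑ ^ 2) ∂radialMeasure n (S.dist t) < ⊤ := by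
  rcases le_or_gt T 0 with hT | hT
  · simp [Ioc_eq_empty (not_lt.2 hT)]
  calc ∫⁻ t in Ioc 0 T, ∫⁻ x in Metric.ball 0 R,
        (1 + ‖S.velocity t x‖ₑ ^ 2) ∂radialMeasure n (S.dist t)
      ≤ ∫⁻ t in Ioc 0 T,
          ENNReal.ofReal (S.total + (1 + R ^ 2) * S.energy t) * surface n univ :=
        lintegral_mono_ae ((S.ae_integrable_energy T).mono fun t ht => lintegral_energy_le ht R)
    _ < ⊤ := by
        rw [lintegral_mul_const' _ _ (measure_ne_top _ _)]
        refine ENNReal.mul_lt_top ?_ (measure_lt_top _ _)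
        have h : IntegrableOn (fun t => S.total + (1 + R ^ 2) * S.energy t) (Ioc 0 T) :=
          (integrable_const _).add ((S.integrableOn_energy hT).const_mul _)
        exact h.lintegral_lt_top

lemma radialMeasure_dist_univ (t : ℝ) :
    radialMeasure n (S.dist t) univ = S.m univ * surface n univ := by
  have := S.finite
  rw [radialMeasure_dist, Measure.map_apply (measurable_traj_smul t) MeasurableSet.univ,
    preimage_univ, ← univ_prod_univ, Measure.prod_prod]

variable (S n) in
theorem finite_force (T R : ℝ) : ∫⁻ t in Ioc 0 T, ∫⁻ x in Metric.ball 0 R,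
    ‖‖x‖ ^ (n - 1) • radialGradient n (S.dist t) x‖ₑ ∂radialMeasure n (S.dist t) < ⊤ := by
  have := S.finite
  calc ∫⁻ t in Ioc 0 T, ∫⁻ x in Metric.ball 0 R,
        ‖‖x‖ ^ (n - 1) • radialGradient n (S.dist t) x‖ₑ ∂radialMeasure n (S.dist t)
      ≤ ∫⁻ t in Ioc 0 T, ENNReal.ofReal S.total * (S.m univ * surface n univ) := by
        refine lintegral_mono fun t => ?_
        rw [← radialMeasure_dist_univ t, ← lintegral_const]
        refine (setLIntegral_le_lintegral _ _).trans (lintegral_mono fun x => ?_)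
        rw [← ofReal_norm]
        exact ENNReal.ofReal_le_ofReal (norm_force_le t x)
    _ < ⊤ := by
        rw [setLIntegral_const]
        refine ENNReal.mul_lt_top (ENNReal.mul_lt_top ENNReal.ofReal_lt_top
          (ENNReal.mul_lt_top (measure_lt_top _ _) (measure_lt_top _ _))) ?_
        simp

end RadialData


/-! ### Polar coordinates -/

section Polar

variable {n : ℕ}

/-- The measure `r^(n-1) dr` on `(0, ∞)`. -/
def rayMeasure (n : ℕ) : Measure ℝ :=
  (volume.restrict (Ioi 0)).withDensity fun r => ENNReal.ofReal (r ^ (n - 1))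

instance : SFinite (rayMeasure n) := by
  unfold rayMeasure
  infer_instance

lemma map_volumeIoiPow (k : ℕ) : (Measure.volumeIoiPow k).map ((↑) : Ioi (0 : ℝ) → ℝ) =
    (volume.restrict (Ioi 0)).withDensity fun r => ENNReal.ofReal (r ^ k) := by
  ext s hs
  have hv : Measurable ((↑) : Ioi (0 : ℝ) → ℝ) := measurable_subtype_coe
  rw [Measure.map_apply hv hs, Measure.volumeIoiPow, withDensity_apply _ (hv hs),
    withDensity_apply _ hs, setLIntegral_subtype measurableSet_Ioi _
      fun a : ℝ => ENNReal.ofReal (a ^ k), Subtype.image_preimage_coe,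
    Measure.restrict_restrict hs, inter_comm]

lemma radialMeasure_rayMeasure (hn : 1 ≤ n) :
    radialMeasure n (rayMeasure n) = (volume : Measure (Space n)) := by
  have : Nonempty (Fin n) := ⟨⟨0, hn⟩⟩
  have hdim : Module.finrank ℝ (Space n) = n := by simp
  have hpres := (volume : Measure (Space n)).measurePreserving_homeomorphUnitSphereProd
  rw [hdim] at hpres
  have hsymm := (hpres.symm (homeomorphUnitSphereProd (Space n)).toMeasurableEquiv).map_eq
  have h0 : (volume : Measure (Space n)) =
      (Measure.comap ((↑) : ({0}ᶜ : Set (Space n)) → Space n) volume).map (↑) := by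
    rw [(MeasurableEmbedding.subtype_coe (measurableSet_singleton _).compl).map_comap,
      Subtype.range_coe, restrict_compl_singleton]
  have hs : Measurable fun q : Metric.sphere (0 : Space n) 1 × Ioi (0 : ℝ) =>
      (q.2 : ℝ) • (q.1 : Space n) := Continuous.measurable (by fun_prop)
  rw [rayMeasure, ← map_volumeIoiPow, RadialData.radialMeasure_map measurable_subtype_coe,
    ← Measure.prod_swap, Measure.map_map (Continuous.measurable (by fun_prop)) measurable_swap]
  conv_rhs => rw [h0, ← hsymm]
  rw [Measure.map_map measurable_subtype_coe (MeasurableEquiv.measurable _)]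
  congr 1

lemma integral_rayMeasure (f : ℝ → ℝ) :
    ∫ r, f r ∂rayMeasure n = ∫ r in Ioi 0, r ^ (n - 1) * f r := by
  rw [rayMeasure, integral_withDensity_eq_integral_toReal_smul (by fun_prop)
    (Eventually.of_forall fun _ => ENNReal.ofReal_lt_top)]
  refine setIntegral_congr_fun measurableSet_Ioi fun r hr => ?_
  simp only [smul_eq_mul, ENNReal.toReal_ofReal (pow_nonneg (le_of_lt hr) _)]

/-- Integration in polar coordinates. -/
lemma integral_polar (hn : 1 ≤ n) {g : Space n → ℝ} (hg : Integrable g) :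
    ∫ x, g x = ∫ r in Ioi 0, r ^ (n - 1) *
      ∫ θ : Metric.sphere (0 : Space n) 1, g (r • (θ : Space n)) ∂surface n := by
  have hm : Measurable fun p : ℝ × Metric.sphere (0 : Space n) 1 => p.1 • (p.2 : Space n) := by
    fun_prop
  rw [← radialMeasure_rayMeasure hn, radialMeasure] at hg ⊢
  rw [integral_map hm.aemeasurable hg.aestronglyMeasurable,
    integral_prod (fun p : ℝ × Metric.sphere (0 : Space n) 1 => g (p.1 • (p.2 : Space n)))
      ((integrable_map_measure hg.aestronglyMeasurable hm.aemeasurable).1 hg),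
    integral_rayMeasure]

end Polar


/-! ### The electric field and Gauss's law -/

section Field

lemma electricField_nonneg (μ : Measure ℝ) (r : ℝ) : 0 ≤ electricField μ r := by
  unfold electricField
  positivity

lemma norm_radialGradient_le {n : ℕ} (μ : Measure ℝ) (x : Space n) :
    ‖radialGradient n μ x‖ ≤ (‖x‖ ^ (n - 1))⁻¹ * electricField μ ‖x‖ := by
  have h : 0 ≤ (‖x‖ ^ (n - 1))⁻¹ * electricField μ ‖x‖ :=
    mul_nonneg (by positivity) (electricField_nonneg μ _)
  rw [radialGradient, norm_smul, Real.norm_of_nonneg h]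
  exact mul_le_of_le_one_right h (norm_radialDir_le x)

variable (μ : Measure ℝ) [IsFiniteMeasure μ]

lemma electricField_le (r : ℝ) : electricField μ r ≤ μ.real univ := by
  have h1 : μ.real (Iio r) ≤ μ.real univ := measureReal_mono (subset_univ _)
  have h2 : μ.real (Iic r) ≤ μ.real univ := measureReal_mono (subset_univ _)
  simp only [electricField, ← measureReal_def]
  linarith

lemma electricField_mono : Monotone (electricField μ) := fun r r' h => by
  have h1 : μ.real (Iio r) ≤ μ.real (Iio r') := measureReal_mono (Iio_subset_Iio h)
  have h2 : μ.real (Iic r) ≤ μ.real (Iic r') := measureReal_mono (Iic_subset_Iic.2 h)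
  simp only [electricField, ← measureReal_def]
  linarith

lemma measurable_electricField : Measurable (electricField μ) :=
  (electricField_mono μ).measurable

/-- The open and closed masses agree wherever the distribution function is continuous, that is, off
a countable set. The average rule is thus invisible to Lebesgue integrals. -/
lemma ae_electricField_eq : ∀ᵐ r : ℝ, electricField μ r = μ.real (Iic r) := by
  have h : Monotone fun r => μ.real (Iic r) := fun r r' h => measureReal_mono (Iic_subset_Iic.2 h)
  filter_upwards [h.countable_not_continuousAt.ae_notMem volume] with r hr
  have hc : ContinuousAt (fun r => μ.real (Iic r)) r := not_not.1 hr
  have hle : μ.real (Iic r) ≤ μ.real (Iio r) := by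
    have hlim : Tendsto (fun q => μ.real (Iic q)) (𝓝[<] r) (𝓝 (μ.real (Iic r))) :=
      hc.tendsto.mono_left nhdsWithin_le_nhds
    refine le_of_tendsto hlim ?_
    filter_upwards [self_mem_nhdsWithin] with q hq
    exact measureReal_mono (Iic_subset_Iio.2 hq)
  have hge : μ.real (Iio r) ≤ μ.real (Iic r) := measureReal_mono Iio_subset_Iic_self
  simp only [electricField, ← measureReal_def]
  linarith

variable {n : ℕ}

lemma measurable_radialGradient_of_finite : Measurable (radialGradient n μ) := by
  have := measurable_electricField μ
  have h : Measurable fun x : Space n => (‖x‖ ^ (n - 1))⁻¹ * electricField μ ‖x‖ := by fun_prop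
  exact h.smul measurable_radialDir

lemma locallyIntegrable_of_integrableOn_ball {E : Type*} [NormedAddCommGroup E]
    {f : Space n → E} (h : ∀ R : ℝ, IntegrableOn f (Metric.ball 0 R)) : LocallyIntegrable f :=
  fun x => ⟨Metric.ball 0 (‖x‖ + 1),
    Metric.isOpen_ball.mem_nhds (by simp), h _⟩

/-- A radial function which is `O(r^(1-n))` is integrable on balls. -/
lemma integrableOn_ball_of_pow_mul_le (hn : 1 ≤ n) {f : ℝ → ℝ} {R C : ℝ}
    (hf : AEStronglyMeasurable f (volume.restrict (Ioo 0 R)))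
    (hC : ∀ r, 0 < r → r < R → r ^ (n - 1) * |f r| ≤ C) :
    IntegrableOn (fun x : Space n => f ‖x‖) (Metric.ball 0 R) := by
  have : Nonempty (Fin n) := ⟨⟨0, hn⟩⟩
  have hdim : Module.finrank ℝ (Space n) = n := by simp
  rw [integrableOn_fun_norm_addHaar (E := Space n) volume, hdim]
  refine Integrable.mono' (g := fun _ => C) (integrable_const C)
    ((by fun_prop : Continuous fun r : ℝ => r ^ (n - 1)).aestronglyMeasurable.smul hf) ?_
  filter_upwards [ae_restrict_mem measurableSet_Ioo] with r hr
  rw [norm_smul, Real.norm_of_nonneg (pow_nonneg hr.1.le _), Real.norm_eq_abs]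
  exact hC r hr.1 hr.2

lemma locallyIntegrable_radialGradient (hn : 1 ≤ n) : LocallyIntegrable (radialGradient n μ) := by
  refine locallyIntegrable_of_integrableOn_ball fun R => ?_
  have hE := measurable_electricField μ
  have h := integrableOn_ball_of_pow_mul_le (n := n) hn (R := R) (C := μ.real univ)
    (f := fun r => (r ^ (n - 1))⁻¹ * electricField μ r)
    (Measurable.aestronglyMeasurable (by fun_prop)) fun r hr _ => by
      rw [abs_mul, abs_of_nonneg (inv_nonneg.2 (pow_nonneg hr.le _)),
        abs_of_nonneg (electricField_nonneg μ r), mul_inv_cancel_left₀ (pow_pos hr _).ne']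
      exact electricField_le μ r
  exact Integrable.mono' h (measurable_radialGradient_of_finite μ).aestronglyMeasurable
    (Eventually.of_forall fun x => norm_radialGradient_le μ x)

lemma integrable_smul_of_locallyIntegrable {G : Space n → Space n} (hG : LocallyIntegrable G)
    {L : Space n → Space n →L[ℝ] ℝ} (hL : Continuous L) (hcs : HasCompactSupport L) :
    Integrable (fun x => L x (G x)) := by
  obtain ⟨C, hC⟩ := hcs.exists_bound_of_continuous hL
  have h1 : IntegrableOn (fun x => L x (G x)) (tsupport L) := by
    refine Integrable.mono' ((hG.integrableOn_isCompact hcs.isCompact).norm.const_mul C) ?_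
      (Eventually.of_forall fun x =>
        ((L x).le_opNorm _).trans (mul_le_mul_of_nonneg_right (hC x) (norm_nonneg _)))
    exact (isBoundedBilinearMap_apply (𝕜 := ℝ) (E := Space n) (F := ℝ)).continuous.comp_aestronglyMeasurable
      (hL.aestronglyMeasurable.prodMk
        (hG.integrableOn_isCompact hcs.isCompact).aestronglyMeasurable)
  refine (integrableOn_iff_integrable_of_support_subset fun x hx => ?_).1 h1
  refine subset_tsupport _ fun h0 => hx ?_
  simp [h0]

section Divergence

variable {ψ : Space n → ℝ}

lemma hasDerivAt_shell (h : ContDiff ℝ 1 ψ) (r : ℝ) : HasDerivAt (shell ψ)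
    (∫ θ : Metric.sphere (0 : Space n) 1, fderiv ℝ ψ (r • (θ : Space n)) (θ : Space n)
      ∂surface n) r := by
  have h2 : ContDiff ℝ 1 fun p : ℝ × Space n => ψ p.2 := h.comp contDiff_snd
  have hd := (((contDiff_sphereIntegral (RadialData.contDiff_rayTest h2)).differentiable
    one_ne_zero (0, r)).hasFDerivAt).comp_hasDerivAt r
      ((hasDerivAt_const r (0 : ℝ)).prodMk (hasDerivAt_id r))
  have hdr := RadialData.dr_sphereIntegral_rayTest h2 0 r
  rw [dr] at hdr
  rw [hdr] at hd
  have hf : ∀ x v : Space n, fderiv ℝ (fun p : ℝ × Space n => ψ p.2) (0, x) (0, v) =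
      fderiv ℝ ψ x v := fun x v => by
    have := ((h.differentiable one_ne_zero x).hasFDerivAt).comp (0, x)
      (hasFDerivAt_snd (𝕜 := ℝ) (E := ℝ) (F := Space n) (p := (0, x)))
    rw [show (fun p : ℝ × Space n => ψ p.2) = ψ ∘ Prod.snd from rfl, this.fderiv]
    rfl
  simp only [hf] at hd
  exact hd

lemma contDiff_shell (h : ContDiff ℝ 1 ψ) : ContDiff ℝ 1 (shell ψ) := by
  have h2 : ContDiff ℝ 1 fun p : ℝ × Space n => ψ p.2 := h.comp contDiff_snd
  exact (contDiff_sphereIntegral (RadialData.contDiff_rayTest h2)).comp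
    (contDiff_const.prodMk contDiff_id : ContDiff ℝ 1 fun r : ℝ => ((0 : ℝ), r))

lemma hasCompactSupport_shell (hcs : HasCompactSupport ψ) : HasCompactSupport (shell ψ) := by
  obtain ⟨R, hR⟩ := hcs.isCompact.isBounded.exists_norm_le
  refine HasCompactSupport.intro (isCompact_closedBall (0 : ℝ) R) fun r hr => ?_
  rw [mem_closedBall_zero_iff, not_le] at hr
  have : ∀ θ : Metric.sphere (0 : Space n) 1, ψ (r • (θ : Space n)) = 0 := fun θ => by
    by_contra h0
    have := hR _ (subset_tsupport _ h0)
    rw [norm_smul, norm_eq_of_mem_sphere, mul_one] at this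
    linarith
  simp [shell, this]

/-- Fubini for `E(r) = ∫ 1_{s ≤ r} dμ(s)`: the inner integral of `A'` over `r > s` is `-A s`. Mass
at `s = 0` is included, so an atom at the origin acts as a point source. -/
lemma integral_electricField_mul_deriv (hμ : μ (Iio 0) = 0) {A : ℝ → ℝ} (hA : ContDiff ℝ 1 A)
    (hcs : HasCompactSupport A) :
    ∫ r in Ioi 0, electricField μ r * deriv A r = -∫ s, A s ∂μ := by
  have hA' : Continuous (deriv A) := hA.continuous_deriv le_rfl
  have hint : Integrable (deriv A) := hA'.integrable_of_hasCompactSupport hcs.deriv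
  have hpos : ∀ᵐ s ∂μ, 0 ≤ s := by
    rw [ae_iff]
    simpa [Iio_def] using hμ
  have h1 : ∫ r in Ioi 0, electricField μ r * deriv A r =
      ∫ r in Ioi 0, ∫ s, (Iic r).indicator (fun _ => deriv A r) s ∂μ := by
    refine setIntegral_congr_ae measurableSet_Ioi ?_
    filter_upwards [ae_electricField_eq μ] with r hr _
    rw [hr, integral_indicator measurableSet_Iic, setIntegral_const, smul_eq_mul]
  have hm : Measurable fun p : ℝ × ℝ => (Iic p.1).indicator (fun _ => deriv A p.1) p.2 := by
    have : (fun p : ℝ × ℝ => (Iic p.1).indicator (fun _ => deriv A p.1) p.2) =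
        {p : ℝ × ℝ | p.2 ≤ p.1}.indicator fun p => deriv A p.1 := by
      ext p
      simp [indicator]
    rw [this]
    exact (hA'.measurable.comp measurable_fst).indicator
      (measurableSet_le measurable_snd measurable_fst)
  rw [h1, integral_integral_swap]
  · rw [← integral_neg]
    refine integral_congr_ae (hpos.mono fun s hs => ?_)
    have : ∀ r : ℝ, (Iic r).indicator (fun _ => deriv A r) s = (Ici s).indicator (deriv A) r := by
      intro r
      simp [indicator]
    simp only [this]
    rw [setIntegral_indicator measurableSet_Ici]
    have h2 : ∫ r in Ioi 0 ∩ Ici s, deriv A r = ∫ r in Ioi s, deriv A r := by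
      rcases hs.eq_or_lt with rfl | hs
      · rw [inter_eq_left.2 Ioi_subset_Ici_self]
      · have : (Ioi 0 ∩ Ici s : Set ℝ) = Ici s :=
          inter_eq_right.2 fun r (hr : s ≤ r) => hs.trans_le hr
        rw [this, integral_Ici_eq_integral_Ioi]
    rw [h2, HasCompactSupport.integral_Ioi_deriv_eq hA hcs]
  · refine Integrable.mono' ((hint.restrict (s := Ioi 0)).norm.comp_fst μ)
      hm.aestronglyMeasurable (Eventually.of_forall fun p => ?_)
    exact norm_indicator_le_norm_self (fun _ => deriv A p.1) p.2

theorem hasWeakDivergence_radialGradient (hn : 1 ≤ n) (hμ : μ (Iio 0) = 0) :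
    HasWeakDivergence (radialGradient n μ) (radialMeasure n μ) := by
  intro ψ hψ hcs
  have h1 : ContDiff ℝ 1 ψ := hψ.of_le (by simp)
  obtain ⟨C, hC⟩ := hcs.exists_bound_of_continuous h1.continuous
  have hc := h1.continuous
  rw [RadialData.integral_radialMeasure h1.continuous.measurable
    (Integrable.of_bound (Continuous.aestronglyMeasurable (by fun_prop)) C
      (Eventually.of_forall fun p => hC _))]
  rw [integral_polar hn (integrable_smul_of_locallyIntegrable
    (locallyIntegrable_radialGradient μ hn) (h1.continuous_fderiv one_ne_zero)
    (hcs.fderiv (𝕜 := ℝ)))]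
  refine Eq.trans (setIntegral_congr_fun measurableSet_Ioi fun r hr => ?_)
    (integral_electricField_mul_deriv μ hμ (contDiff_shell h1) (hasCompactSupport_shell hcs))
  have hr : 0 < r := hr
  have hd := (hasDerivAt_shell h1 r).deriv
  unfold shell at hd
  simp only [hd, radialGradient, norm_smul_sphere hr.le,
    radialDir_smul_sphere hr, map_smul, smul_eq_mul, integral_const_mul]
  rw [← mul_assoc, mul_inv_cancel_left₀ (pow_pos hr _).ne']

end Divergence

end Field


/-! ### The potential and its weak gradient -/

section Potential

variable (n : ℕ) (μ : Measure ℝ)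

/-- The radial derivative of the potential. -/
def fieldStrength (r : ℝ) : ℝ := (r ^ (n - 1))⁻¹ * electricField μ r

/-- The potential as a function of the radius. -/
def radialPotential (r : ℝ) : ℝ := ∫ ρ in (1 : ℝ)..r, fieldStrength n μ ρ

variable {n}

lemma fieldStrength_nonneg {r : ℝ} (hr : 0 ≤ r) : 0 ≤ fieldStrength n μ r :=
  mul_nonneg (inv_nonneg.2 (pow_nonneg hr _)) (electricField_nonneg μ r)

lemma radialPotential_one : radialPotential n μ 1 = 0 := intervalIntegral.integral_same

lemma inner_radialGradient (x e : Space n) :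
    ⟪radialGradient n μ x, e⟫ = fieldStrength n μ ‖x‖ * (‖x‖⁻¹ * ⟪x, e⟫) := by
  simp only [radialGradient, radialDir, fieldStrength, inner_smul_left, conj_trivial]

/-- The potential made constant on a small ball. -/
def cutPotential (n : ℕ) (μ : Measure ℝ) (ε : ℝ) (x : Space n) : ℝ :=
  radialPotential n μ (max ‖x‖ ε)

lemma lineDeriv_cutPotential_of_gt {ε : ℝ} {x : Space n} (hx : ‖x‖ < ε) (e : Space n) :
    lineDeriv ℝ (cutPotential n μ ε) x e = 0 := by
  refine ((hasDerivAt_const (0 : ℝ) (radialPotential n μ ε)).congr_of_eventuallyEq ?_).deriv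
  have hcont : Continuous fun t : ℝ => ‖x + t • e‖ := by fun_prop
  have : ∀ᶠ t in 𝓝 (0 : ℝ), ‖x + t • e‖ < ε :=
    hcont.continuousAt.eventually (gt_mem_nhds (by simpa using hx))
  filter_upwards [this] with t ht
  simp only [cutPotential, max_eq_right ht.le]

variable [IsFiniteMeasure μ]

lemma measurable_fieldStrength : Measurable (fieldStrength n μ) := by
  have := measurable_electricField μ
  unfold fieldStrength
  fun_prop

lemma fieldStrength_le {ε r : ℝ} (hε : 0 < ε) (hr : ε ≤ r) :
    fieldStrength n μ r ≤ (ε ^ (n - 1))⁻¹ * μ.real univ :=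
  mul_le_mul (inv_anti₀ (pow_pos hε _) (pow_le_pow_left₀ hε.le hr _)) (electricField_le μ r)
    (electricField_nonneg μ r) (inv_nonneg.2 (pow_nonneg hε.le _))

lemma intervalIntegrable_fieldStrength {a b : ℝ} (ha : 0 < a) (hb : 0 < b) :
    IntervalIntegrable (fieldStrength n μ) volume a b := by
  refine (intervalIntegrable_const (c := ((min a b) ^ (n - 1))⁻¹ * μ.real univ)).mono_fun'
    (measurable_fieldStrength μ).aestronglyMeasurable ?_
  filter_upwards [ae_restrict_mem measurableSet_uIoc] with r hr
  have h0 : 0 < min a b := lt_min ha hb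
  rw [Real.norm_of_nonneg (fieldStrength_nonneg μ (h0.trans hr.1).le)]
  exact fieldStrength_le μ h0 hr.1.le

lemma radialPotential_sub {a b : ℝ} (ha : 0 < a) (hb : 0 < b) :
    radialPotential n μ b - radialPotential n μ a = ∫ ρ in a..b, fieldStrength n μ ρ :=
  intervalIntegral.integral_interval_sub_left (intervalIntegrable_fieldStrength μ one_pos hb)
    (intervalIntegrable_fieldStrength μ one_pos ha)

lemma radialPotential_mono {a b : ℝ} (ha : 0 < a) (hab : a ≤ b) :
    radialPotential n μ a ≤ radialPotential n μ b := by
  rw [← sub_nonneg, radialPotential_sub μ ha (ha.trans_le hab)]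
  exact intervalIntegral.integral_nonneg hab fun r hr => fieldStrength_nonneg μ (ha.le.trans hr.1)

lemma abs_radialPotential_sub_le {ε a b : ℝ} (hε : 0 < ε) (ha : ε ≤ a) (hb : ε ≤ b) :
    |radialPotential n μ b - radialPotential n μ a| ≤
      (ε ^ (n - 1))⁻¹ * μ.real univ * |b - a| := by
  rw [radialPotential_sub μ (hε.trans_le ha) (hε.trans_le hb), ← Real.norm_eq_abs]
  refine intervalIntegral.norm_integral_le_of_norm_le_const fun r hr => ?_
  have hr : ε ≤ r := (le_min ha hb).trans hr.1.le
  rw [Real.norm_of_nonneg (fieldStrength_nonneg μ (hε.le.trans hr))]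
  exact fieldStrength_le μ hε hr

/-- The potential increases and vanishes at radius `1`, so raising the radius to `ε ≤ 1` moves its
value towards `0`. This supplies the dominating function when the cut-off is removed. -/
lemma abs_radialPotential_max_le {ε r : ℝ} (hr : 0 < r) (hε : ε ≤ 1) :
    |radialPotential n μ (max r ε)| ≤ |radialPotential n μ r| := by
  rcases le_total ε r with h | h
  · rw [max_eq_left h]
  · rw [max_eq_right h]
    have h1 := radialPotential_mono (n := n) μ hr h
    have h2 := radialPotential_mono (n := n) μ (hr.trans_le h) hε
    rw [radialPotential_one] at h2
    rw [abs_of_nonpos h2, abs_of_nonpos (h1.trans h2)]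
    linarith

/-- Integrating the crude bound `r^(1-n) μ(ℝ)` for the slope from `r` to `1` gives local
integrability in all dimensions at once, without the explicit logarithm or power. -/
lemma pow_mul_abs_radialPotential_le {r R : ℝ} (hr : 0 < r) (hR : r < R) :
    r ^ (n - 1) * |radialPotential n μ r| ≤
      μ.real univ + R ^ (n - 1) * (μ.real univ * R) := by
  have hM : 0 ≤ μ.real univ := measureReal_nonneg
  have hR0 : 0 < R := hr.trans hR
  rcases le_total r 1 with h | h
  · have := abs_radialPotential_sub_le (n := n) μ hr le_rfl h
    rw [radialPotential_one, zero_sub, abs_neg, abs_of_nonneg (by linarith : 0 ≤ 1 - r)] at this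
    have hp : 0 < r ^ (n - 1) := pow_pos hr _
    calc r ^ (n - 1) * |radialPotential n μ r|
        ≤ r ^ (n - 1) * ((r ^ (n - 1))⁻¹ * μ.real univ * (1 - r)) :=
          mul_le_mul_of_nonneg_left this hp.le
      _ = μ.real univ * (1 - r) := by field_simp
      _ ≤ μ.real univ * 1 := mul_le_mul_of_nonneg_left (by linarith) hM
      _ ≤ μ.real univ + R ^ (n - 1) * (μ.real univ * R) := by
          have : 0 ≤ R ^ (n - 1) * (μ.real univ * R) := by positivity
          linarith
  · have := abs_radialPotential_sub_le (n := n) μ one_pos le_rfl h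
    rw [radialPotential_one, sub_zero, abs_of_nonneg (by linarith : 0 ≤ r - 1), one_pow, inv_one,
      one_mul] at this
    calc r ^ (n - 1) * |radialPotential n μ r| ≤ R ^ (n - 1) * (μ.real univ * R) := by
          refine mul_le_mul (pow_le_pow_left₀ hr.le hR.le _) (this.trans ?_) (abs_nonneg _)
            (pow_nonneg hR0.le _)
          exact mul_le_mul_of_nonneg_left (by linarith) hM
      _ ≤ _ := by linarith

lemma locallyIntegrable_radialPotential (hn : 1 ≤ n) :
    LocallyIntegrable fun x : Space n => radialPotential n μ ‖x‖ := by
  refine locallyIntegrable_of_integrableOn_ball fun R => ?_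
  refine integrableOn_ball_of_pow_mul_le hn ?_
    fun r hr hR => pow_mul_abs_radialPotential_le μ hr hR
  have hmono : MonotoneOn (radialPotential n μ) (Ioo 0 R) := fun a ha b _ hab =>
    radialPotential_mono μ ha.1 hab
  exact (aemeasurable_restrict_of_monotoneOn measurableSet_Ioo hmono).aestronglyMeasurable

lemma lipschitzWith_cutPotential {ε : ℝ} (hε : 0 < ε) :
    LipschitzWith ((ε ^ (n - 1))⁻¹ * μ.real univ).toNNReal (cutPotential n μ ε) := by
  refine LipschitzWith.of_dist_le_mul fun x y => ?_
  rw [Real.coe_toNNReal _ (by positivity), Real.dist_eq, _root_.dist_eq_norm]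
  refine (abs_radialPotential_sub_le μ hε (le_max_right _ _) (le_max_right _ _)).trans ?_
  refine mul_le_mul_of_nonneg_left ?_ (by positivity)
  exact (abs_max_sub_max_le_abs _ _ _).trans (abs_norm_sub_norm_le _ _)

lemma hasDerivAt_radialPotential {r : ℝ} (hr : 0 < r) (hc : ContinuousAt (electricField μ) r) :
    HasDerivAt (radialPotential n μ) (fieldStrength n μ r) r := by
  refine intervalIntegral.integral_hasDerivAt_right
    (intervalIntegrable_fieldStrength μ one_pos hr)
    ((measurable_fieldStrength μ).stronglyMeasurable.stronglyMeasurableAtFilter) ?_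
  exact ((continuous_pow (n - 1)).continuousAt.inv₀ (pow_pos hr _).ne').mul hc

lemma hasDerivAt_norm_line {x : Space n} (hx : x ≠ 0) (e : Space n) :
    HasDerivAt (fun t : ℝ => ‖x + t • e‖) (‖x‖⁻¹ * ⟪x, e⟫) 0 := by
  have h1 : HasDerivAt (fun t : ℝ => x + t • e) e 0 := by
    simpa using ((hasDerivAt_id (0 : ℝ)).smul_const e).const_add x
  have h2 := h1.norm_sq.sqrt (by simpa using hx)
  simp only [Real.sqrt_sq (norm_nonneg _), zero_smul, add_zero] at h2
  convert h2 using 1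
  have := norm_pos_iff.2 hx
  field_simp

lemma lineDeriv_cutPotential_of_lt {ε : ℝ} (hε : 0 < ε) {x : Space n} (hx : ε < ‖x‖)
    (hc : ContinuousAt (electricField μ) ‖x‖) (e : Space n) :
    lineDeriv ℝ (cutPotential n μ ε) x e = ⟪radialGradient n μ x, e⟫ := by
  have hx0 : 0 < ‖x‖ := hε.trans hx
  have hl := hasDerivAt_norm_line (norm_pos_iff.1 hx0) e
  have hd : HasDerivAt (radialPotential n μ) (fieldStrength n μ ‖x‖) ‖x + (0 : ℝ) • e‖ := by
    rw [zero_smul, add_zero]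
    exact hasDerivAt_radialPotential μ hx0 hc
  rw [inner_radialGradient]
  refine ((hd.comp 0 hl).congr_of_eventuallyEq ?_).deriv
  have hcont : Continuous fun t : ℝ => ‖x + t • e‖ := by fun_prop
  have : ∀ᶠ t in 𝓝 (0 : ℝ), ε < ‖x + t • e‖ :=
    hcont.continuousAt.eventually (lt_mem_nhds (by simpa using hx))
  filter_upwards [this] with t ht
  simp only [cutPotential, max_eq_left ht.le, Function.comp_apply]

lemma ae_norm_notMem (hn : 1 ≤ n) {D : Set ℝ} (hD : D.Countable) :
    ∀ᵐ x : Space n, ‖x‖ ∉ D := by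
  have : Nonempty (Fin n) := ⟨⟨0, hn⟩⟩
  have hset : {x : Space n | ¬‖x‖ ∉ D} = ⋃ d ∈ D, Metric.sphere 0 d := by
    ext x
    simp
  rw [ae_iff, hset, measure_biUnion_null_iff hD]
  exact fun d _ => Measure.addHaar_sphere _ _ _

variable {μ} in
-- The cut potential is globally Lipschitz, so integration by parts leaves no boundary term. Its
-- line derivative is explicit off the sphere of radius `ε` and the countably many spheres where `E`
-- jumps, all of them null.
lemma integral_cutPotential (hn : 1 ≤ n) {ε : ℝ} (hε : 0 < ε) {ψ : Space n → ℝ}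
    (hψ : ContDiff ℝ 1 ψ) (hcs : HasCompactSupport ψ) (e : Space n) :
    ∫ x, {x : Space n | ε < ‖x‖}.indicator (fun x => ⟪radialGradient n μ x, e⟫ * ψ x) x =
      -∫ x, fderiv ℝ ψ x e * cutPotential n μ ε x := by
  obtain ⟨K, hK⟩ := hψ.lipschitzWith_of_hasCompactSupport hcs one_ne_zero
  have key := LipschitzWith.integral_lineDeriv_mul_eq (μ := (volume : Measure (Space n)))
    (lipschitzWith_cutPotential μ hε) hK hcs e
  simp only [map_neg, (hψ.differentiable one_ne_zero).differentiableAt.lineDeriv_eq_fderiv,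
    neg_mul, integral_neg] at key
  rw [← key]
  refine integral_congr_ae ?_
  filter_upwards [ae_norm_notMem hn (electricField_mono μ).countable_not_continuousAt,
    ae_norm_notMem hn (countable_singleton ε)] with x hx hx2
  rcases lt_trichotomy ‖x‖ ε with h | h | h
  · rw [indicator_of_notMem (show x ∉ {x : Space n | ε < ‖x‖} from h.not_gt), lineDeriv_cutPotential_of_gt μ h,
      zero_mul]
  · exact absurd h hx2
  · rw [indicator_of_mem (show x ∈ {x : Space n | ε < ‖x‖} from h),
      lineDeriv_cutPotential_of_lt μ hε h (not_not.1 hx)]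

theorem isWeakGradient_radialPotential (hn : 1 ≤ n) :
    IsWeakGradient (fun x : Space n => radialPotential n μ ‖x‖) (radialGradient n μ) := by
  refine ⟨locallyIntegrable_radialPotential μ hn, locallyIntegrable_radialGradient μ hn,
    fun ψ e hψ hcs => ?_⟩
  have h1 : ContDiff ℝ 1 ψ := hψ.of_le (by simp)
  have hfc : Continuous fun x => fderiv ℝ ψ x e :=
    (h1.continuous_fderiv one_ne_zero).clm_apply continuous_const
  have hfs : HasCompactSupport fun x => fderiv ℝ ψ x e := hcs.fderiv_apply (𝕜 := ℝ) e
  have hne : ∀ᵐ x : Space n, 0 < ‖x‖ := by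
    filter_upwards [ae_norm_notMem hn (countable_singleton (0 : ℝ))] with x hx
    exact (norm_nonneg x).lt_of_ne fun h => hx h.symm
  have hG : Integrable fun x => ⟪radialGradient n μ x, e⟫ * ψ x := by
    have hL : Continuous fun x => ψ x • innerSL ℝ e := by
      have := h1.continuous
      fun_prop
    have := integrable_smul_of_locallyIntegrable (locallyIntegrable_radialGradient μ hn) hL
      hcs.smul_right
    refine this.congr (Eventually.of_forall fun x => ?_)
    simp [real_inner_comm, mul_comm]
  have hV : Integrable fun x : Space n => fderiv ℝ ψ x e * radialPotential n μ ‖x‖ :=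
    (locallyIntegrable_radialPotential μ hn).integrable_smul_left_of_hasCompactSupport hfc hfs
  have hε0 : ∀ k : ℕ, (0 : ℝ) < 1 / (k + 1) := fun k => Nat.one_div_pos_of_nat
  have hε1 : ∀ k : ℕ, (1 : ℝ) / (k + 1) ≤ 1 := fun k => by
    rw [div_le_one (by positivity)]
    linarith [k.cast_nonneg (α := ℝ)]
  have hlim1 : Tendsto (fun k : ℕ => ∫ x, {x : Space n | 1 / ((k : ℝ) + 1) < ‖x‖}.indicator
      (fun x => ⟪radialGradient n μ x, e⟫ * ψ x) x) atTop
      (𝓝 (∫ x, ⟪radialGradient n μ x, e⟫ * ψ x)) := by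
    refine tendsto_integral_of_dominated_convergence
      (fun x => ‖⟪radialGradient n μ x, e⟫ * ψ x‖) (fun k => ?_) hG.norm (fun k => ?_) ?_
    · exact hG.aestronglyMeasurable.indicator (measurableSet_lt measurable_const measurable_norm)
    · exact Eventually.of_forall fun x => norm_indicator_le_norm_self _ _
    · filter_upwards [hne] with x hx
      refine tendsto_const_nhds.congr' ?_
      filter_upwards [(tendsto_one_div_add_atTop_nhds_zero_nat (𝕜 := ℝ)).eventually
        (gt_mem_nhds hx)] with k hk
      rw [indicator_of_mem (show x ∈ {x : Space n | 1 / ((k : ℝ) + 1) < ‖x‖} from hk)]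
  have hlim2 : Tendsto (fun k : ℕ => ∫ x, fderiv ℝ ψ x e * cutPotential n μ (1 / (k + 1)) x) atTop
      (𝓝 (∫ x : Space n, fderiv ℝ ψ x e * radialPotential n μ ‖x‖)) := by
    refine tendsto_integral_of_dominated_convergence
      (fun x => ‖fderiv ℝ ψ x e * radialPotential n μ ‖x‖‖) (fun k => ?_) hV.norm (fun k => ?_) ?_
    · exact (hfc.mul (lipschitzWith_cutPotential μ (hε0 k)).continuous).aestronglyMeasurable
    · filter_upwards [hne] with x hx
      rw [norm_mul, norm_mul]
      exact mul_le_mul_of_nonneg_left (abs_radialPotential_max_le μ hx (hε1 k)) (norm_nonneg _)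
    · filter_upwards [hne] with x hx
      refine tendsto_const_nhds.congr' ?_
      filter_upwards [(tendsto_one_div_add_atTop_nhds_zero_nat (𝕜 := ℝ)).eventually
        (gt_mem_nhds hx)] with k hk
      rw [cutPotential, max_eq_left hk.le]
  have heq := tendsto_nhds_unique
    (hlim1.congr fun k => integral_cutPotential hn (hε0 k) h1 hcs e) hlim2.neg
  rw [heq, neg_neg]
  simp only [mul_comm]

end Potential


/-! ### The action at infinity -/

namespace RadialData

variable {S : RadialData}

variable (S) in
lemma restrict_below_top : S.m.restrict (below ⊤) = S.m := by
  rw [below_top]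
  exact Measure.restrict_eq_self_of_ae_mem S.ae_pos

lemma tendsto_act_top (hy : S.Admissible ⊤) (r t : ℝ) :
    Tendsto (fun z => S.act r t (ENNReal.ofReal z)) atTop (𝓝 (S.act r t ⊤)) := by
  have hint := hy.integrableOn_pos_sub r t
  rw [IntegrableOn, restrict_below_top] at hint
  exact ((S.continuous_cum hint).tendsto ⊤).comp ENNReal.tendsto_ofReal_atTop

lemma monotone_cum_id : Monotone fun z : ℝ => S.cum (fun s => s) (ENNReal.ofReal z) :=
  fun _ _ hab => setIntegral_mono_set (admissible_of_ne_top ENNReal.ofReal_ne_top)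
    ((ae_restrict_mem (measurableSet_below _)).mono fun _ hs => hs.1.le)
    (below_mono (ENNReal.ofReal_le_ofReal hab)).eventuallyLE

/-- With infinite first moment, `∫ s dm` increases to infinity while the remaining terms converge.
Hence the lower limit defining the action at `∞` is a true limit whether or not `∞` is admissible.
-/
lemma tendsto_act_atTop (hy : ¬S.Admissible ⊤) (r t : ℝ) :
    Tendsto (fun z => S.act r t (ENNReal.ofReal z)) atTop atTop := by
  have hid : Tendsto (fun z : ℝ => S.cum (fun s => s) (ENNReal.ofReal z)) atTop atTop := by
    refine (tendsto_atTop_of_monotone S.monotone_cum_id).resolve_right fun ⟨l, hl⟩ => hy ?_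
    have hcov : AECover S.m atTop fun z : ℝ => below (ENNReal.ofReal z) :=
      ⟨S.ae_pos.mono fun s hs => (eventually_gt_atTop s).mono fun z hz =>
          ⟨hs, (ENNReal.ofReal_lt_ofReal_iff (hs.trans hz)).2 hz⟩,
        fun z => measurableSet_below _⟩
    refine (hcov.integrable_of_integral_norm_bounded l
      (fun z => admissible_of_ne_top ENNReal.ofReal_ne_top)
      (Eventually.of_forall fun z => ?_)).integrableOn
    simp only [Real.norm_eq_abs]
    exact (cum_abs (S := S) _).le.trans (S.monotone_cum_id.ge_of_tendsto hl z)
  have hrest : Tendsto (fun z : ℝ => S.actRest r t (ENNReal.ofReal z)) atTop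
      (𝓝 (S.actRest r t ⊤)) := by
    have hc : Continuous fun y => S.actRest r t y :=
      continuous_actRest.comp (f := fun y : ℝ≥0∞ => ((r, t), y)) (by fun_prop)
    exact (hc.tendsto ⊤).comp ENNReal.tendsto_ofReal_atTop
  exact (hid.atTop_add hrest).congr fun z =>
    (act_eq (admissible_of_ne_top ENNReal.ofReal_ne_top) r t).symm

end RadialData

/-! ### From the initial data to the radial problem -/

/-- Admissible initial data on the half-line. -/
structure IsInitialData (n : ℕ) (ρ₀ u₀ : ℝ → ℝ) : Prop where
  nonneg : ∀ᵐ r ∂volume.restrict (Ioi 0), 0 ≤ ρ₀ r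
  density : IntegrableOn (fun s => s ^ (n - 1) * ρ₀ s) (Ioi 0)
  continuous : Continuous fun s => u₀ (max s 0)
  momentum : IntegrableOn (fun s => s ^ (n - 1) * (ρ₀ s * u₀ s)) (Ioi 0)

/-- The radial mass distribution `s^(n-1) ρ₀(s) ds`. -/
def initialMeasure (n : ℕ) (ρ₀ : ℝ → ℝ) : Measure ℝ :=
  (volume.restrict (Ioi 0)).withDensity fun s => ENNReal.ofReal (s ^ (n - 1) * ρ₀ s)

namespace IsInitialData

variable {n : ℕ} {ρ₀ u₀ : ℝ → ℝ}

lemma aemeasurable (h : IsInitialData n ρ₀ u₀) :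
    AEMeasurable (fun s => ENNReal.ofReal (s ^ (n - 1) * ρ₀ s)) (volume.restrict (Ioi 0)) :=
  h.density.aestronglyMeasurable.aemeasurable.ennreal_ofReal

lemma ae_toReal (h : IsInitialData n ρ₀ u₀) : ∀ᵐ s ∂volume.restrict (Ioi 0),
    (ENNReal.ofReal (s ^ (n - 1) * ρ₀ s)).toReal = s ^ (n - 1) * ρ₀ s := by
  filter_upwards [h.nonneg, ae_restrict_mem measurableSet_Ioi] with s hs hpos
  exact ENNReal.toReal_ofReal (mul_nonneg (pow_nonneg (le_of_lt hpos) _) hs)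

lemma integral_eq (h : IsInitialData n ρ₀ u₀) (f : ℝ → ℝ) :
    ∫ s, f s ∂initialMeasure n ρ₀ = ∫ s in Ioi 0, s ^ (n - 1) * ρ₀ s * f s := by
  rw [initialMeasure, integral_withDensity_eq_integral_toReal_smul₀ h.aemeasurable
    (Eventually.of_forall fun _ => ENNReal.ofReal_lt_top)]
  refine integral_congr_ae (h.ae_toReal.mono fun s hs => ?_)
  simp only [hs, smul_eq_mul]

lemma setIntegral_eq (h : IsInitialData n ρ₀ u₀) (f : ℝ → ℝ) {A : Set ℝ} (hA : MeasurableSet A)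
    (hA0 : A ⊆ Ioi 0) :
    ∫ s in A, f s ∂initialMeasure n ρ₀ = ∫ s in A, s ^ (n - 1) * ρ₀ s * f s := by
  rw [← integral_indicator hA, h.integral_eq]
  have : ∀ s, s ^ (n - 1) * ρ₀ s * A.indicator f s =
      A.indicator (fun s => s ^ (n - 1) * ρ₀ s * f s) s := fun s => by
    by_cases hs : s ∈ A <;> simp [hs]
  simp only [this]
  rw [setIntegral_indicator hA, inter_eq_right.2 hA0]

lemma initialMeasure_null {A : Set ℝ} (hA : volume (A ∩ Ioi 0) = 0) :
    initialMeasure n ρ₀ A = 0 := by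
  refine withDensity_absolutelyContinuous _ _ ?_
  rwa [Measure.restrict_apply' measurableSet_Ioi]

lemma isFiniteMeasure (h : IsInitialData n ρ₀ u₀) : IsFiniteMeasure (initialMeasure n ρ₀) :=
  isFiniteMeasure_withDensity_ofReal h.density.2

lemma initialMeasure_Iic_zero : initialMeasure n ρ₀ (Iic 0) = 0 :=
  initialMeasure_null (by rw [Iic_inter_Ioi, Ioc_self, measure_empty])

lemma ae_pos_initialMeasure : ∀ᵐ s ∂initialMeasure n ρ₀, 0 < s := by
  rw [ae_iff]
  simpa [Iic_def] using initialMeasure_Iic_zero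

lemma integrable_velocity (h : IsInitialData n ρ₀ u₀) :
    Integrable (fun s => u₀ (max s 0)) (initialMeasure n ρ₀) := by
  rw [initialMeasure, integrable_withDensity_iff_integrable_smul₀' h.aemeasurable
    (Eventually.of_forall fun _ => ENNReal.ofReal_lt_top)]
  refine Integrable.congr (f := fun s => s ^ (n - 1) * (ρ₀ s * u₀ s)) h.momentum ?_
  filter_upwards [h.ae_toReal, ae_restrict_mem measurableSet_Ioi] with s hs hpos
  rw [hs, max_eq_left (le_of_lt hpos), smul_eq_mul, mul_assoc]

/-- The radial data of admissible initial data. -/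
def data (h : IsInitialData n ρ₀ u₀) (κ : ℝ) : RadialData where
  m := initialMeasure n ρ₀
  -- Only the values of `u₀` on `[0, ∞)` are controlled; the constant extension to the left is
  -- continuous on `ℝ`.
  u s := u₀ (max s 0)
  κ := κ
  finite := h.isFiniteMeasure
  noAtoms := ⟨fun s => initialMeasure_null
    (measure_mono_null inter_subset_left (measure_singleton s))⟩
  null_nonpos := initialMeasure_Iic_zero
  cont := h.continuous
  integrable := h.integrable_velocity

variable {κ : ℝ}

lemma field_eq (h : IsInitialData n ρ₀ u₀) {s : ℝ} (hs : 0 ≤ s) : (h.data κ).field s = initialField n ρ₀ s := by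
  have := h.isFiniteMeasure
  have h1 : (initialMeasure n ρ₀).real (Iic s) = (initialMeasure n ρ₀).real (Ioc 0 s) := by
    refine measureReal_congr ?_
    filter_upwards [ae_pos_initialMeasure (n := n) (ρ₀ := ρ₀)] with x hx
    exact propext ⟨fun hx2 => ⟨hx, hx2⟩, fun hx2 => hx2.2⟩
  have h2 := h.setIntegral_eq (fun _ => 1) measurableSet_Ioc (Ioc_subset_Ioi_self : Ioc 0 s ⊆ Ioi 0)
  simp only [setIntegral_const, mul_one, smul_eq_mul] at h2
  rw [initialField, intervalIntegral.integral_of_le hs, ← h2, ← h1]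
  rfl

lemma vel_eq (h : IsInitialData n ρ₀ u₀) {s : ℝ} (hs : 0 ≤ s) (t : ℝ) :
    (h.data κ).vel t s = u₀ s + κ * initialField n ρ₀ s * t := by
  rw [RadialData.vel, h.field_eq hs]
  simp only [data, max_eq_left hs]

lemma pos_sub_eq (h : IsInitialData n ρ₀ u₀) {s : ℝ} (hs : 0 ≤ s) (r t : ℝ) :
    (h.data κ).pos t s - r = quadForm n κ ρ₀ u₀ r t s := by
  rw [RadialData.pos, quadForm, h.field_eq hs]
  simp only [data, max_eq_left hs]

lemma act_ofReal (h : IsInitialData n ρ₀ u₀) {y : ℝ} (hy : 0 ≤ y) (r t : ℝ) :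
    (h.data κ).act r t (ENNReal.ofReal y) = action n κ ρ₀ u₀ r t y := by
  rw [RadialData.act, RadialData.cum, below_ofReal, action, intervalIntegral.integral_of_le hy,
    integral_Ioc_eq_integral_Ioo]
  refine (h.setIntegral_eq _ measurableSet_Ioo Ioo_subset_Ioi_self).trans
    (setIntegral_congr_fun measurableSet_Ioo fun s hs => ?_)
  simp only [h.pos_sub_eq hs.1.le]
  ring

lemma extAction_of_admissible (h : IsInitialData n ρ₀ u₀) {y : ℝ≥0∞}
    (hy : (h.data κ).Admissible y) (r t : ℝ) :
    extAction n κ ρ₀ u₀ r t y = ((h.data κ).act r t y : EReal) := by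
  rw [extAction]
  split_ifs with htop
  · subst htop
    refine Tendsto.liminf_eq ?_
    refine ((continuous_coe_real_ereal.tendsto _).comp
      (RadialData.tendsto_act_top hy r t)).congr' ?_
    filter_upwards [eventually_ge_atTop 0] with z hz
    rw [Function.comp_apply, h.act_ofReal hz]
  · rw [← h.act_ofReal ENNReal.toReal_nonneg, ENNReal.ofReal_toReal htop]

lemma extAction_of_not_admissible (h : IsInitialData n ρ₀ u₀) {y : ℝ≥0∞}
    (hy : ¬(h.data κ).Admissible y) (r t : ℝ) : extAction n κ ρ₀ u₀ r t y = ⊤ := by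
  have htop : y = ⊤ := by
    by_contra h0
    exact hy (RadialData.admissible_of_ne_top h0)
  subst htop
  rw [extAction, if_pos rfl]
  refine Tendsto.liminf_eq ?_
  rw [EReal.tendsto_coe_nhds_top_iff]
  refine (RadialData.tendsto_act_atTop hy r t).congr' ?_
  filter_upwards [eventually_ge_atTop 0] with z hz
  rw [h.act_ofReal hz]

/-- A non-admissible point has action `⊤`, whereas `y = 0` has finite action, so minimizing over all
of `[0, ∞]` or over admissible points is the same. -/
lemma minimizers_eq (h : IsInitialData n ρ₀ u₀) (r t : ℝ) :
    minimizers n κ ρ₀ u₀ r t = {y | (h.data κ).IsMin r t y} := by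
  ext y
  constructor
  · intro hy
    have hadm : (h.data κ).Admissible y := by
      by_contra hna
      have h0 := hy 0
      rw [h.extAction_of_not_admissible hna, h.extAction_of_admissible
        (RadialData.admissible_of_ne_top ENNReal.zero_ne_top)] at h0
      exact absurd h0 (not_le.2 (EReal.coe_lt_top _))
    refine ⟨hadm, fun z hz => ?_⟩
    have hz' := hy z
    rwa [h.extAction_of_admissible hadm, h.extAction_of_admissible hz, EReal.coe_le_coe_iff] at hz'
  · rintro ⟨hadm, hmin⟩ z
    by_cases hz : (h.data κ).Admissible z
    · rw [h.extAction_of_admissible hadm, h.extAction_of_admissible hz, EReal.coe_le_coe_iff]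
      exact hmin z hz
    · rw [h.extAction_of_not_admissible hz]
      exact le_top

lemma minimizer_eq (h : IsInitialData n ρ₀ u₀) (r t : ℝ) :
    minimizer n κ ρ₀ u₀ r t = (h.data κ).ymax r t := by
  rw [minimizer, h.minimizers_eq]
  rfl

lemma isGreatest_minimizer (h : IsInitialData n ρ₀ u₀) (r t : ℝ) :
    IsGreatest (minimizers n κ ρ₀ u₀ r t) (minimizer n κ ρ₀ u₀ r t) := by
  rw [h.minimizer_eq, h.minimizers_eq]
  exact ⟨RadialData.isMin_ymax r t, fun y hy => RadialData.IsMin.le_ymax hy⟩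

lemma radialMass_eq (h : IsInitialData n ρ₀ u₀) (r t : ℝ) :
    radialMass n κ ρ₀ u₀ r t = (h.data κ).mass ((h.data κ).ymax r t) := by
  have h1 := h.setIntegral_eq (fun _ => 1) (measurableSet_below ((h.data κ).ymax r t))
    fun _ hs => hs.1
  simp only [setIntegral_const, mul_one, smul_eq_mul] at h1
  rw [radialMass, h.minimizer_eq]
  simp only [mul_comm (ρ₀ _)]
  exact h1.symm

lemma radialMomentum_eq (h : IsInitialData n ρ₀ u₀) (r t : ℝ) :
    radialMomentum n κ ρ₀ u₀ r t = (h.data κ).mom t ((h.data κ).ymax r t) := by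
  rw [radialMomentum, h.minimizer_eq, RadialData.mom, RadialData.cum]
  refine ((h.setIntegral_eq _ (measurableSet_below _) fun _ hs => hs.1).trans
    (setIntegral_congr_fun (measurableSet_below _) fun s hs => ?_)).symm
  simp only [h.vel_eq hs.1.le]
  ring

lemma isRadialDerivative (h : IsInitialData n ρ₀ u₀) (t : ℝ) :
    IsRadialDerivative (fun r => radialMass n κ ρ₀ u₀ r t) ((h.data κ).dist t) := by
  refine ⟨RadialData.dist_Iio_zero t, fun r hr => ?_⟩
  simp only [h.radialMass_eq]
  rw [← RadialData.dist_Iic hr, ofReal_measureReal]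

lemma hasRadialDensity (h : IsInitialData n ρ₀ u₀) (t : ℝ) :
    HasRadialDensity (fun r => radialMomentum n κ ρ₀ u₀ r t) ((h.data κ).speed t)
      ((h.data κ).dist t) := by
  refine ⟨(RadialData.integrable_speed_dist t).integrableOn, fun a b ha hab => ?_⟩
  simp only [h.radialMomentum_eq]
  rw [RadialData.setIntegral_speed ha hab]

lemma integral_initial_mass (h : IsInitialData n ρ₀ u₀) (hn : 1 ≤ n)
    (hint : Integrable fun x : Space n => ρ₀ ‖x‖) {k : Space n → ℝ} (hk : Continuous k)
    {C : ℝ} (hC : ∀ x, ‖k x‖ ≤ C) :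
    ∫ x, k x * ρ₀ ‖x‖ = ∫ s, shell k s ∂initialMeasure n ρ₀ := by
  rw [integral_polar hn (hint.bdd_mul hk.aestronglyMeasurable (Eventually.of_forall hC)),
    h.integral_eq]
  refine setIntegral_congr_fun measurableSet_Ioi fun r hr => ?_
  simp only [norm_smul_sphere (le_of_lt hr), integral_mul_const, shell]
  ring

lemma integral_initial_momentum (h : IsInitialData n ρ₀ u₀) (hn : 1 ≤ n)
    (hint : Integrable fun x : Space n => ρ₀ ‖x‖ * u₀ ‖x‖) {Φ : ℝ × Space n → Space n}
    (hΦ : Continuous Φ) (hcs : HasCompactSupport Φ) :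
    ∫ x, ⟪(ρ₀ ‖x‖ * u₀ ‖x‖) • radialDir x, Φ (0, x)⟫ =
      ∫ s, sphereIntegral (RadialData.radialTest Φ) (0, s) * (h.data κ).u s ∂(h.data κ).m := by
  obtain ⟨C, hC⟩ := hcs.exists_bound_of_continuous hΦ
  have hΦ0 : Measurable fun x : Space n => Φ (0, x) := Continuous.measurable (by fun_prop)
  have hi : Integrable fun x : Space n => ⟪radialDir x, Φ (0, x)⟫ * (ρ₀ ‖x‖ * u₀ ‖x‖) := by
    refine hint.bdd_mul (c := C) (measurable_radialDir.inner hΦ0).aestronglyMeasurable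
      (Eventually.of_forall fun x => (norm_inner_le_norm _ _).trans ?_)
    exact (mul_le_of_le_one_left (norm_nonneg _) (norm_radialDir_le x)).trans (hC _)
  have heq : ∀ x : Space n, ⟪(ρ₀ ‖x‖ * u₀ ‖x‖) • radialDir x, Φ (0, x)⟫ =
      ⟪radialDir x, Φ (0, x)⟫ * (ρ₀ ‖x‖ * u₀ ‖x‖) := fun x => by
    rw [inner_smul_left, conj_trivial, mul_comm]
  simp only [heq]
  rw [integral_polar hn hi]
  refine Eq.trans (setIntegral_congr_fun measurableSet_Ioi fun r hr => ?_) (h.integral_eq _).symm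
  have hr : 0 < r := hr
  simp only [norm_smul_sphere hr.le, radialDir_smul_sphere hr, integral_mul_const, sphereIntegral,
    RadialData.radialTest, data, max_eq_left hr.le]
  ring

theorem isWeakSolution (h : IsInitialData n ρ₀ u₀) (hn : 1 ≤ n)
    (hρ : Integrable fun x : Space n => ρ₀ ‖x‖)
    (hm : Integrable fun x : Space n => ρ₀ ‖x‖ * u₀ ‖x‖) :
    IsWeakSolution n κ (fun x => ρ₀ ‖x‖) (fun x => (ρ₀ ‖x‖ * u₀ ‖x‖) • radialDir x)
      (fun t => radialMeasure n ((h.data κ).dist t)) (h.data κ).velocity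
      (fun t x => radialPotential n ((h.data κ).dist t) ‖x‖)
      (fun t => radialGradient n ((h.data κ).dist t)) where
  measurable_density := (h.data κ).measurable_radialMeasure_dist n
  measurable_velocity := RadialData.measurable_velocity
  measurable_gradient := RadialData.measurable_radialGradient
  finite_energy := (h.data κ).finite_energy n
  finite_force := (h.data κ).finite_force n
  gradient t _ := isWeakGradient_radialPotential _ hn
  poisson t _ := by
    refine ⟨?_, hasWeakDivergence_radialGradient _ hn (RadialData.dist_Iio_zero t)⟩
    unfold radialMeasure
    infer_instance
  mass φ hφ hcs := by
    have h1 : ContDiff ℝ 1 φ := hφ.of_le (by simp)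
    have hc : Continuous fun x : Space n => φ (0, x) := by
      have := h1.continuous
      fun_prop
    obtain ⟨C, hC⟩ := hcs.exists_bound_of_continuous h1.continuous
    rw [h.integral_initial_mass hn hρ hc fun x => hC (0, x)]
    exact RadialData.weak_mass (S := h.data κ) h1 hcs
  momentum Φ hΦ hcs := by
    have h1 : ContDiff ℝ 1 Φ := hΦ.of_le (by simp)
    rw [h.integral_initial_momentum (κ := κ) hn hm h1.continuous hcs]
    exact RadialData.weak_momentum (S := h.data κ) h1 hcs

end IsInitialData

end EulerPoisson

end

/-! ### The theorem -/

theorem theorem1p3 (n : ℕ) (hn : 1 ≤ n) (κ : ℝ) (ρ₀ u₀ : ℝ → ℝ)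
    (hρ₀_nonneg : ∀ᵐ r ∂(volume.restrict (Ioi (0 : ℝ))), 0 ≤ ρ₀ r)
    (hρ₀_int : Integrable (fun x : EulerPoisson.Space n => ρ₀ ‖x‖))
    (hu₀ : ContDiffOn ℝ 1 u₀ (Ici 0))
    (hm₀_int : Integrable (fun x : EulerPoisson.Space n => ρ₀ ‖x‖ * u₀ ‖x‖)) :
    (∀ r t : ℝ, 0 ≤ r → 0 ≤ t →
      IsGreatest (EulerPoisson.minimizers n κ ρ₀ u₀ r t)
        (EulerPoisson.minimizer n κ ρ₀ u₀ r t)) ∧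
    ∃ (μ : ℝ → Measure ℝ) (w : ℝ → ℝ → ℝ) (V : ℝ → EulerPoisson.Space n → ℝ),
      (∀ t : ℝ, 0 ≤ t →
        EulerPoisson.IsRadialDerivative
          (fun r => EulerPoisson.radialMass n κ ρ₀ u₀ r t) (μ t) ∧
        EulerPoisson.HasRadialDensity
          (fun r => EulerPoisson.radialMomentum n κ ρ₀ u₀ r t) (w t) (μ t)) ∧
      EulerPoisson.IsWeakSolution n κ
        (fun x => ρ₀ ‖x‖)
        (fun x => (ρ₀ ‖x‖ * u₀ ‖x‖) • EulerPoisson.radialDir x)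
        (fun t => EulerPoisson.radialMeasure n (μ t))
        (fun t x => w t ‖x‖ • EulerPoisson.radialDir x)
        V
        (fun t => EulerPoisson.radialGradient n (μ t)) := by
  have : Nonempty (Fin n) := ⟨⟨0, hn⟩⟩
  have hdim : Module.finrank ℝ (EulerPoisson.Space n) = n := by simp
  have hint : ∀ {f : ℝ → ℝ}, Integrable (fun x : EulerPoisson.Space n => f ‖x‖) →
      IntegrableOn (fun s => s ^ (n - 1) * f s) (Ioi 0) := fun {f} hf => by
    have := (integrable_fun_norm_addHaar (E := EulerPoisson.Space n) volume (f := f)).1 hf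
    rwa [hdim] at this
  have h : EulerPoisson.IsInitialData n ρ₀ u₀ :=
    { nonneg := hρ₀_nonneg
      density := hint hρ₀_int
      continuous := hu₀.continuousOn.comp_continuous (by fun_prop) fun s => le_max_right s 0
      momentum := hint (f := fun s => ρ₀ s * u₀ s) hm₀_int }
  exact ⟨fun r t _ _ => h.isGreatest_minimizer r t, (h.data κ).dist, (h.data κ).speed, _,
    fun t _ => ⟨h.isRadialDerivative t, h.hasRadialDensity t⟩,
    h.isWeakSolution hn hρ₀_int hm₀_int⟩
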